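/- **Definitions.** All spaces are over $\mathbb C$; $p$ denotes parity, $\mathbb N=\{0,1,2,\dots\}$, and formulas with $p$ are for homogeneous vectors. A *conformal superalgebra* is a $\mathbb Z/2$-graded vector space $R$ with parity-preserving products $a\otimes b\mapsto a_{(n)}b$ ($n\in\mathbb N$), a parity-preserving operator $\partial$ and an even vector $L$ such that, with $\partial^{(j)}=\partial^j/j!$, * $a_{(n)}b=0$ for $n$ large (depending on $a,b$); * $(\partial a)_{(n)}b=-n\,a_{(n-1)}b$; * $a_{(n)}b=(-1)^{p(a)p(b)}\sum_{j\ge 0}(-1)^{j+n+1}\partial^{(j)}(b_{(n+j)}a)$; * $a_{(m)}(b_{(n)}c)=\sum_{j\ge 0}\binom mj (a_{(j)}b)_{(m+n-j)}c+(-1)^{p(a)p(b)}b_{(n)}(a_{(m)}c)$; * $L_{(0)}=\partial$, $L_{(1)}L=2L$, $L_{(2)}L=0$, and $L_{(1)}$ is diagonalizable. Put $R^k=\{x: L_{(1)}x=kx\}$; nonzero $x\in R^k$ have weight $\Delta(x)=k$. $R$ is *physical* if there is a finite-dimensional $\mathbb Z/2$-graded subspace $\mathcal F\subset R^2\oplus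 R^{3/2}\oplus R^1\oplus R^{1/2}$ with $R=\mathbb C[\partial]\mathcal F$ and $\mathcal F\cap R^2=\mathbb CL$, all weights lie in $\frac12\mathbb N$, $R_{\rm even}=\bigoplus_{n\in\mathbb N}R^n$ and $R_{\rm odd}=\bigoplus_{n\in\mathbb N}R^{n+1/2}$. The *reduced subspace* is $\check R=\{x: L_{(2)}x\in R^0\}$, with $\check R^k=\check R\cap R^k$. The *$0$-part* of $x\in R$ is the vector $x^0\in\check R$ in a decomposition $x=\sum_{j=0}^m\partial^{(j)}x^j$ with $x^j\in\bigoplus_{k\neq0}\check R^k$ for $j>0$. Let $a_{\langle n\rangle}b$ be the $0$-part of $a_{(n)}b$. **(1)** Let $R$ be a physical conformal superalgebra. Then $\check R=\mathbb CL\oplus V\oplus A\oplus F$ with $V=\check R^{3/2}$, $A=\check R^1$, $F=\check R^{1/2}$, where $\check R^2=\mathbb CL$, $\mathbb CL\oplus A$ is even and $V\oplus F$ is odd. There are unique bilinear products $\bullet,\circ$ on $\check R$ with $a\bullet b=a_{\langle0\rangle}b$ and, for $a,b$ homogeneous in weight, $a\circ b=a_{\langle1\rangle}b/(\Delta(a)+\Delta(b)-2)$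 if $\Delta(a)+\Delta(b)\ne2$ and $a\circ b=0$ otherwise. They satisfy $\Delta(a\bullet b)=\Delta(a)+\Delta(b)-1$, $\Delta(a\circ b)=\Delta(a)+\Delta(b)-2$ (a product whose weight does not occur being $0$), and * (H0) $L\circ x=x$ and $L\bullet x=0$ for all $x$; * (H1) $(\check R,\bullet)$ is a Lie superalgebra; * (H2) $(\check R,\circ)$ is an associative supercommutative superalgebra; * (H3) $a\bullet(x\circ y)=(a\bullet x)\circ y+x\circ(a\bullet y)$ for $a\in A$ and all $x,y$; * (H4) $u\circ(v\bullet f)=(u\circ v)\bullet f+(u\bullet v)\circ f$ for $u,v\in V$, $f\in F$; * (H5) $(u\circ+u\bullet)^2v=(u,u)v$ for $u,v\in V$; * (H6) $(u\circ+u\bullet)^2a=(u,u)a$ for $u\in V$, $a\in A$; where $(\cdot,\cdot)$ is a bilinear form on $V$ with $u\bullet v=(u,v)L$. **(2)** Conversely, let $P=\mathbb CL\oplus V\oplus A\oplus F$ be a finite-dimensional $\mathbb Z/2$-graded vector space with the weights $2,\frac32,1,\frac12$ on the four summands, $\mathbb CL\oplus A$ even and $V\oplus F$ odd, and with bilinear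 products $\bullet,\circ$ of weights $\Delta(a\bullet b)=\Delta(a)+\Delta(b)-1$, $\Delta(a\circ b)=\Delta(a)+\Delta(b)-2$ satisfying (H0)–(H6). Then there are a physical conformal superalgebra $R$ and a linear isomorphism $e:P\to\check R$ preserving parity, weight and $L$ such that $e(a)_{\langle0\rangle}e(b)=e(a\bullet b)$; $e(a)_{\langle1\rangle}e(b)=(\Delta(a)+\Delta(b)-2)\,e(a\circ b)$ for $a,b$ homogeneous in weight; and $e(a)_{\langle n\rangle}e(b)=0$ for $n\ge2$. -/

import Mathlib

open scoped Nat

universe u v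

namespace PhysConf

/-- The sign `(-1)^{p(a)p(b)}` for vectors of parities `i` and `j`. -/
def superSign (i j : ZMod 2) : ℂ := (-1) ^ (i.val * j.val)

/-- The divided power `T^{(j)} = T^j / j!` of an operator. -/
noncomputable def divPow {R : Type*} [AddCommGroup R] [Module ℂ R] (T : Module.End ℂ R) (j : ℕ) :
    Module.End ℂ R :=
  ((j ! : ℂ)⁻¹) • T ^ j

/-- A `ℤ/2`-grading of a vector space. -/
structure IsSuperGrading {R : Type*} [AddCommGroup R] [Module ℂ R]
    (par : ZMod 2 → Submodule ℂ R) : Prop where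
  indep : iSupIndep par
  span : ⨆ i, par i = ⊤

/-- A conformal superalgebra over `ℂ` (with conformal vector `L`).  `prod n a b` is the product
`a_(n) b`, `D` is the operator `∂`, `par` is the `ℤ/2`-grading. -/
structure ConformalSuperalgebra (R : Type*) [AddCommGroup R] [Module ℂ R] where
  par : ZMod 2 → Submodule ℂ R
  par_grading : IsSuperGrading par
  prod : ℕ → R →ₗ[ℂ] R →ₗ[ℂ] R
  prod_par : ∀ n i j a b, a ∈ par i → b ∈ par j → prod n a b ∈ par (i + j)
  D : Module.End ℂ R
  D_par : ∀ i a, a ∈ par i → D a ∈ par i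
  L : R
  L_even : L ∈ par 0
  c0 : ∀ a b, ∃ N, ∀ n, N ≤ n → prod n a b = 0
  /-- For `n = 0` the right hand side is `0`, as it should be. -/
  c1 : ∀ n a b, prod n (D a) b = -(n : ℂ) • prod (n - 1) a b
  /-- The sum has only finitely many nonzero terms, by `c0`. -/
  c2 : ∀ n i j a b, a ∈ par i → b ∈ par j →
    prod n a b =
      superSign i j • ∑ᶠ k : ℕ, (-1 : ℂ) ^ (k + n + 1) • divPow D k (prod (n + k) b a)
  /-- The binomial coefficients `m.choose k` vanish for `k > m`. -/
  c3 : ∀ m n i j a b c, a ∈ par i → b ∈ par j →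
    prod m a (prod n b c) =
      ∑ k ∈ Finset.range (m + 1), (m.choose k : ℂ) • prod (n + m - k) (prod k a b) c
        + superSign i j • prod n b (prod m a c)
  L_one : prod 1 L L = (2 : ℂ) • L
  L_two : prod 2 L L = 0
  L_zero : ∀ a, prod 0 L a = D a
  L_diag : ⨆ k : ℂ, Module.End.eigenspace (prod 1 L) k = ⊤

namespace ConformalSuperalgebra

variable {R : Type*} [AddCommGroup R] [Module ℂ R]

/-- `R^k`, the space of vectors of conformal weight `k`. -/
def wt (S : ConformalSuperalgebra R) (k : ℂ) : Submodule ℂ R :=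
  Module.End.eigenspace (S.prod 1 S.L) k

/-- `S` is a superconformal algebra with generating space `G`: `G` is a finite-dimensional
(`ℤ/2`-graded) subspace, `R = ℂ[∂] G`, all conformal weights lie in `½ℕ`, and the parity is given
by the conformal weights. -/
structure IsSuperconformalWith (S : ConformalSuperalgebra R) (G : Submodule ℂ R) : Prop where
  finite : FiniteDimensional ℂ G
  graded : ⨆ i, G ⊓ S.par i = G
  generates : ⨆ n : ℕ, G.map (S.D ^ n) = ⊤
  weights : ∀ k, S.wt k ≠ ⊥ → ∃ n : ℕ, k = (n : ℂ) / 2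
  even : S.par 0 = ⨆ n : ℕ, S.wt (n : ℂ)
  odd : S.par 1 = ⨆ n : ℕ, S.wt ((n : ℂ) + 1 / 2)

/-- Physical conformal superalgebras. -/
def IsPhysical (S : ConformalSuperalgebra R) : Prop :=
  ∃ G : Submodule ℂ R, S.IsSuperconformalWith G ∧
    G ≤ S.wt 2 ⊔ S.wt (3 / 2) ⊔ S.wt 1 ⊔ S.wt (1 / 2) ∧
    G ⊓ S.wt 2 = Submodule.span ℂ {S.L}

/-- The reduced subspace `{x | L_(2) x ∈ R^0}`. -/
def reduced (S : ConformalSuperalgebra R) : Submodule ℂ R :=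
  (S.wt 0).comap (S.prod 2 S.L)

/-- `y` is the `0`-part of `x`: there is a `∂`-decomposition `x = ∑ ∂^{(j)} x^j` with `x^0 = y`
in the reduced subspace and, for `j > 0`, `x^j` a sum of reduced vectors of nonzero weights. -/
def IsZeroPart (S : ConformalSuperalgebra R) (x y : R) : Prop :=
  ∃ (m : ℕ) (z : ℕ → R), z 0 = y ∧ y ∈ S.reduced ∧
    (∀ j, 0 < j → z j ∈ ⨆ k : {k : ℂ // k ≠ 0}, S.reduced ⊓ S.wt k) ∧
    x = ∑ j ∈ Finset.range (m + 1), divPow S.D j (z j)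

/-- The parity spaces of the reduced subspace. -/
def redPar (S : ConformalSuperalgebra R) (i : ZMod 2) : Submodule ℂ S.reduced :=
  (S.par i).comap S.reduced.subtype

/-- The weight spaces of the reduced subspace. -/
def redWt (S : ConformalSuperalgebra R) (k : ℂ) : Submodule ℂ S.reduced :=
  (S.wt k).comap S.reduced.subtype

/-- `circ` and `bullet` are the products `∘` and `•` on the reduced subspace: `a • b` is the
`0`-part of `a_(0) b`; for `a`, `b` of weights `p`, `q`, `a ∘ b` is the `0`-part of `a_(1) b`
divided by `p + q - 2` if `p + q - 2 ≠ 0`, and `0` otherwise. -/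
structure IsReducedProducts (S : ConformalSuperalgebra R)
    (circ bullet : S.reduced →ₗ[ℂ] S.reduced →ₗ[ℂ] S.reduced) : Prop where
  bullet_eq : ∀ a b : S.reduced, S.IsZeroPart (S.prod 0 a b) (bullet a b)
  circ_eq : ∀ (p q : ℂ) (a b : S.reduced), a ∈ S.redWt p → b ∈ S.redWt q → p + q - 2 ≠ 0 →
    ∃ z : S.reduced, S.IsZeroPart (S.prod 1 a b) z ∧ circ a b = (p + q - 2)⁻¹ • z
  circ_zero : ∀ (p q : ℂ) (a b : S.reduced), a ∈ S.redWt p → b ∈ S.redWt q → p + q - 2 = 0 →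
    circ a b = 0

end ConformalSuperalgebra

section Algebra

variable {P : Type*} [AddCommGroup P] [Module ℂ P]

/-- The bracket `br` makes the `ℤ/2`-graded space a Lie superalgebra. -/
structure IsLieSuperalgebra (par : ZMod 2 → Submodule ℂ P) (br : P →ₗ[ℂ] P →ₗ[ℂ] P) : Prop where
  grading : ∀ i j a b, a ∈ par i → b ∈ par j → br a b ∈ par (i + j)
  skew : ∀ i j a b, a ∈ par i → b ∈ par j → br a b = -(superSign i j • br b a)
  jacobi : ∀ i j a b c, a ∈ par i → b ∈ par j →
    br a (br b c) = br (br a b) c + superSign i j • br b (br a c)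

/-- The product `mul` makes the `ℤ/2`-graded space an associative supercommutative algebra. -/
structure IsCommSuperalgebra (par : ZMod 2 → Submodule ℂ P) (mul : P →ₗ[ℂ] P →ₗ[ℂ] P) :
    Prop where
  grading : ∀ i j a b, a ∈ par i → b ∈ par j → mul a b ∈ par (i + j)
  comm : ∀ i j a b, a ∈ par i → b ∈ par j → mul a b = superSign i j • mul b a
  assoc : ∀ a b c, mul (mul a b) c = mul a (mul b c)

/-- A `ℤ/2`-graded space with a decomposition `P = ℂL ⊕ V ⊕ A ⊕ F` with respect to a weight,
where `V = W (3/2)`, `A = W 1`, `F = W (1/2)`, with `ℂL ⊕ A` even and `V ⊕ F` odd. -/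
structure IsPhysicalGrading (par : ZMod 2 → Submodule ℂ P) (W : ℂ → Submodule ℂ P) (L : P) :
    Prop where
  super : IsSuperGrading par
  indep : iSupIndep W
  span : ⨆ k, W k = ⊤
  weights : ∀ k : ℂ, k ≠ 2 → k ≠ 3 / 2 → k ≠ 1 → k ≠ 1 / 2 → W k = ⊥
  two : W 2 = Submodule.span ℂ {L}
  even : par 0 = W 2 ⊔ W 1
  odd : par 1 = W (3 / 2) ⊔ W (1 / 2)

/-- The two products have the prescribed weights. -/
structure HasProductWeights (W : ℂ → Submodule ℂ P) (circ bullet : P →ₗ[ℂ] P →ₗ[ℂ] P) : Prop where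
  bullet : ∀ p q a b, a ∈ W p → b ∈ W q → bullet a b ∈ W (p + q - 1)
  circ : ∀ p q a b, a ∈ W p → b ∈ W q → circ a b ∈ W (p + q - 2)

/-- The properties (H0)-(H6).  In `h56`, `form` is the inner product on `V` given by
`u • v = (u, v) L`. -/
structure IsHAlgebra (par : ZMod 2 → Submodule ℂ P) (W : ℂ → Submodule ℂ P) (L : P)
    (circ bullet : P →ₗ[ℂ] P →ₗ[ℂ] P) : Prop where
  h0 : circ L = LinearMap.id ∧ bullet L = 0
  h1 : IsLieSuperalgebra par bullet
  h2 : IsCommSuperalgebra par circ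
  h3 : ∀ a ∈ W 1, ∀ x y, bullet a (circ x y) = circ (bullet a x) y + circ x (bullet a y)
  h4 : ∀ u ∈ W (3 / 2), ∀ v ∈ W (3 / 2), ∀ f ∈ W (1 / 2),
    circ u (bullet v f) = bullet (circ u v) f + circ (bullet u v) f
  h56 : ∃ form : W (3 / 2) →ₗ[ℂ] W (3 / 2) →ₗ[ℂ] ℂ,
    (∀ u v : W (3 / 2), bullet (u : P) (v : P) = form u v • L) ∧
    (∀ u v : W (3 / 2),
      (circ (u : P) + bullet (u : P)) ((circ (u : P) + bullet (u : P)) (v : P))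
        = form u u • (v : P)) ∧
    (∀ u : W (3 / 2), ∀ a ∈ W 1,
      (circ (u : P) + bullet (u : P)) ((circ (u : P) + bullet (u : P)) a) = form u u • a)

/-- `e` identifies the triple `(P, {⟨n⟩}, L)`, where `a⟨0⟩b = a • b`,
`a⟨1⟩b = (Δ(a) + Δ(b) - 2) a ∘ b` and `a⟨n⟩b = 0` for `n ≥ 2`, with the reduced subspace of the
conformal superalgebra `S`, where `a⟨n⟩b` is the `0`-part of `a_(n) b`. -/
structure IsRealization (par : ZMod 2 → Submodule ℂ P) (W : ℂ → Submodule ℂ P) (L : P)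
    (circ bullet : P →ₗ[ℂ] P →ₗ[ℂ] P) {R : Type*} [AddCommGroup R] [Module ℂ R]
    (S : ConformalSuperalgebra R) (e : P ≃ₗ[ℂ] S.reduced) : Prop where
  conformal : (e L : R) = S.L
  parity : ∀ i, (par i).map (e : P →ₗ[ℂ] S.reduced) = S.redPar i
  weight : ∀ k, (W k).map (e : P →ₗ[ℂ] S.reduced) = S.redWt k
  prod_zero : ∀ a b, S.IsZeroPart (S.prod 0 (e a) (e b)) (e (bullet a b))
  prod_one : ∀ p q a b, a ∈ W p → b ∈ W q →
    S.IsZeroPart (S.prod 1 (e a) (e b)) (e ((p + q - 2) • circ a b))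
  prod_ge_two : ∀ n a b, 2 ≤ n → S.IsZeroPart (S.prod n (e a) (e b)) 0

end Algebra

end PhysConf

open PhysConf

/-!
For vectors `a`, `b` of a conformal superalgebra write `[a_λ b] = ∑ λⁿ/n! a_(n) b`.  The operators
`L_(0) = ∂`, `L_(1)`, `L_(2)` generate an action of `sl₂`, in which `∂` raises and `L_(2)` lowers
the weight by `1`.

In a physical conformal superalgebra all weights are positive.  The algebra is spanned by the
vectors `∂ⁿx` with `x` killed by `L_(2)` and of weight `2`, `3/2`, `1` or `1/2`, and the operator
`L_(2)∂` multiplies `∂ⁿx` by the nonzero number `(n+1)(2Δ(x)+n)`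
(`IsPhysical.L_two_D_injective`).  Hence the algebra is the direct sum of the reduced subspace and
the image of `∂` (`IsPhysical.isCompl`), and the `0`-part is the projection onto the first summand.
Weights exclude almost all terms of the `λ`-bracket of two reduced vectors `a`, `b` of weights `p`
and `q`, and applying `L_(2)` determines the derivative which remains:

  `[a_λ b] = a • b + (p - 1) ∂(a ∘ b) + (p + q - 2) λ (a ∘ b)`

(`IsPhysical.prod_zero_eq`, `IsPhysical.prod_one_eq`).

In the Jacobi identity of this bracket, the constant term is the Jacobi identity of `•`, and the
coefficients of quadratic monomials in `∂`, `λ`, `μ` follow from associativity and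
supercommutativity of `∘`; in turn, the coefficient of `λμ` and supercommutativity imply
associativity (`IsPhysical.circ_assoc`).  The linear coefficients contain (H3)-(H6)
(`IsPhysical.jacobi_lambda`, `IsPhysical.jacobi_mu`), which gives `IsPhysical.isHAlgebra`.
Conversely (H0)-(H6) imply the linear coefficients (`IsHAlgebra.linearJacobi`): these are invariant
under permutations of the three vectors, so the weights may be assumed to decrease, and then
products of weight at most `0` vanish and leave a few cases, which follow from (H3), (H4) and the
polarizations of (H5) and (H6).

For the converse, the free `ℂ[∂]`-module `ℂ[∂] ⊗ P` carries a unique sesquilinear `λ`-bracket which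
is given by the displayed formula on `P` (`freeProd`, `genProd`).  Skew-symmetry and the Jacobi
identity are preserved by sums and by `∂` in each argument (`IsSesquilinear.skewAt_D_left`,
`IsSesquilinear.jacobiAt_D_left` and their analogues), so they only have to be checked for vectors
of `P` that are homogeneous (`skewAt_gen`, `jacobiAt_gen`).  This is the conformal superalgebra
`realization`; its reduced subspace is `P`, because `P` is reduced and a complement to the image of
`∂`.
-/

namespace PhysConf

open Module

/-! ### Signs -/

lemma superSign_zero_left (j : ZMod 2) : superSign 0 j = 1 := by simp [superSign]

lemma superSign_zero_right (i : ZMod 2) : superSign i 0 = 1 := by simp [superSign]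

lemma superSign_one_one : superSign 1 1 = -1 := by
  have : (1 : ZMod 2).val = 1 := rfl
  simp [superSign, this]

lemma superSign_comm (i j : ZMod 2) : superSign i j = superSign j i := by
  rw [superSign, superSign, mul_comm]

lemma superSign_eq_one_or (i j : ZMod 2) : superSign i j = 1 ∨ superSign i j = -1 :=
  neg_one_pow_eq_or ℂ _

lemma superSign_add_left (i j k : ZMod 2) :
    superSign (i + j) k = superSign i k * superSign j k := by
  have h11 : (1 : ZMod 2) + 1 = 0 := rfl
  have h01 : ∀ i : ZMod 2, i = 0 ∨ i = 1 := by decide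
  rcases h01 i with rfl | rfl <;> rcases h01 j with rfl | rfl <;> rcases h01 k with rfl | rfl <;>
    simp [superSign_zero_left, superSign_zero_right, superSign_one_one, h11]

/-! ### The operators `L_(n)` -/

namespace ConformalSuperalgebra

variable {R : Type*} [AddCommGroup R] [Module ℂ R] (S : ConformalSuperalgebra R)

/-- Extends a statement closed under addition from parity-homogeneous vectors to all vectors. -/
lemma par_induction {motive : R → Prop} (x : R) (hom : ∀ i, ∀ x ∈ S.par i, motive x)
    (add : ∀ x y, motive x → motive y → motive (x + y)) : motive x :=
  Submodule.iSup_induction S.par (motive := motive)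
    (S.par_grading.span ▸ Submodule.mem_top : x ∈ ⨆ i, S.par i) hom (hom 0 0 (zero_mem _)) add

lemma prod_L_prod (m n : ℕ) (b c : R) :
    S.prod m S.L (S.prod n b c) =
      ∑ k ∈ Finset.range (m + 1), (m.choose k : ℂ) • S.prod (n + m - k) (S.prod k S.L b) c
        + S.prod n b (S.prod m S.L c) := by
  induction b using S.par_induction with
  | hom i b hb => simpa [superSign_zero_left] using S.c3 m n 0 i S.L b c S.L_even hb
  | add x y hx hy =>
    simp only [map_add, LinearMap.add_apply, hx, hy, smul_add, Finset.sum_add_distrib]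
    abel

lemma prod_D_left (n : ℕ) (a b : R) :
    S.prod n (S.D a) b = -(n : ℂ) • S.prod (n - 1) a b := S.c1 n a b

lemma D_prod (n : ℕ) (a b : R) :
    S.D (S.prod n a b) = S.prod n (S.D a) b + S.prod n a (S.D b) := by
  simpa [S.L_zero] using S.prod_L_prod 0 n a b

lemma prod_D_right (n : ℕ) (a b : R) :
    S.prod n a (S.D b) = S.D (S.prod n a b) + (n : ℂ) • S.prod (n - 1) a b := by
  rw [D_prod, prod_D_left]; module

lemma prod_zero_D_right (a b : R) : S.prod 0 a (S.D b) = S.D (S.prod 0 a b) := by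
  simp [prod_D_right]

lemma prod_one_D_right (a b : R) :
    S.prod 1 a (S.D b) = S.D (S.prod 1 a b) + S.prod 0 a b := by
  simp [prod_D_right]

lemma prod_zero_D_left (a b : R) : S.prod 0 (S.D a) b = 0 := by simp [prod_D_left]

lemma prod_one_D_left (a b : R) : S.prod 1 (S.D a) b = -S.prod 0 a b := by
  simp [prod_D_left]

lemma L_one_D (x : R) : S.prod 1 S.L (S.D x) = S.D (S.prod 1 S.L x) + S.D x := by
  rw [prod_one_D_right, L_zero]

lemma L_two_D (x : R) :
    S.prod 2 S.L (S.D x) = S.D (S.prod 2 S.L x) + (2 : ℂ) • S.prod 1 S.L x := by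
  simp [prod_D_right]

lemma L_one_prod (n : ℕ) (a b : R) :
    S.prod 1 S.L (S.prod n a b) = S.prod n (S.prod 1 S.L a) b + S.prod n a (S.prod 1 S.L b)
      - ((n : ℂ) + 1) • S.prod n a b := by
  have := S.prod_L_prod 1 n a b
  simp only [Finset.sum_range_succ, Finset.range_zero, Finset.sum_empty, S.L_zero, S.prod_D_left,
    Nat.choose_one_right, Nat.choose_zero_right] at this
  rw [this]
  push_cast
  simp only [zero_add]
  module

lemma L_two_prod_zero (a b : R) :
    S.prod 2 S.L (S.prod 0 a b) = (2 : ℂ) • S.prod 1 (S.prod 1 S.L a) b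
      - (2 : ℂ) • S.prod 1 a b + S.prod 0 (S.prod 2 S.L a) b + S.prod 0 a (S.prod 2 S.L b) := by
  have := S.prod_L_prod 2 0 a b
  simp only [Finset.sum_range_succ, Finset.range_zero, Finset.sum_empty, S.L_zero, S.prod_D_left,
    Nat.choose_one_right, Nat.choose_zero_right, Nat.choose_self] at this
  rw [this]
  norm_num
  module

lemma mem_wt {k : ℂ} {x : R} : x ∈ S.wt k ↔ S.prod 1 S.L x = k • x :=
  Module.End.mem_eigenspace_iff

lemma L_mem_wt : S.L ∈ S.wt 2 := S.mem_wt.2 S.L_one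

lemma iSupIndep_wt : iSupIndep S.wt := Module.End.eigenspaces_iSupIndep _

lemma eq_zero_of_mem_wt {k l : ℂ} {x : R} (hkl : k ≠ l) (hk : x ∈ S.wt k) (hl : x ∈ S.wt l) :
    x = 0 := by
  rw [mem_wt] at hk hl
  have : (k - l) • x = 0 := by rw [sub_smul, ← hk, ← hl, sub_self]
  exact (smul_eq_zero.1 this).resolve_left (sub_ne_zero.2 hkl)

lemma prod_mem_wt {p q : ℂ} {a b : R} (ha : a ∈ S.wt p) (hb : b ∈ S.wt q) (n : ℕ) :
    S.prod n a b ∈ S.wt (p + q - n - 1) := by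
  rw [mem_wt] at *
  rw [L_one_prod, ha, hb]
  simp only [map_smul, LinearMap.smul_apply]
  module

lemma D_mem_wt {k : ℂ} {x : R} (hx : x ∈ S.wt k) : S.D x ∈ S.wt (k + 1) := by
  rw [mem_wt] at *
  rw [L_one_D, hx, map_smul]
  module

lemma D_pow_mem_wt {k : ℂ} {x : R} (hx : x ∈ S.wt k) (n : ℕ) : (S.D ^ n) x ∈ S.wt (k + n) := by
  induction n with
  | zero => simpa using hx
  | succ n ih =>
    rw [pow_succ', Module.End.mul_apply]
    have := S.D_mem_wt ih
    push_cast
    rwa [← add_assoc]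

lemma L_two_mem_wt {k : ℂ} {x : R} (hx : x ∈ S.wt k) : S.prod 2 S.L x ∈ S.wt (k - 1) := by
  have := S.prod_mem_wt S.L_mem_wt hx 2
  convert this using 2
  push_cast; ring

/-- On a vector of weight `k` killed by `L_(2)`, the operator `L_(2)∂` and the powers of `∂`
satisfy the relations of a lowest weight module of `sl₂`. -/
lemma L_two_D_pow {k : ℂ} {x : R} (hx : x ∈ S.wt k) (h : S.prod 2 S.L x = 0) (n : ℕ) :
    S.prod 2 S.L (S.D ((S.D ^ n) x)) = (((n : ℂ) + 1) * (2 * k + n)) • (S.D ^ n) x := by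
  induction n with
  | zero =>
    rw [L_two_D, pow_zero, Module.End.one_apply, h, S.mem_wt.1 hx, map_zero]
    push_cast; module
  | succ n ih =>
    have hw := S.mem_wt.1 (S.D_pow_mem_wt hx (n + 1))
    rw [L_two_D, hw, pow_succ', Module.End.mul_apply, ih, map_smul]
    push_cast; module

/-- The derivatives of the vectors of weights `2`, `3/2`, `1`, `1/2` span a physical conformal
superalgebra. -/
lemma IsPhysical.iSup_D_pow {S : ConformalSuperalgebra R} (h : S.IsPhysical) :
    ⨆ n : ℕ, (S.wt 2 ⊔ S.wt (3 / 2) ⊔ S.wt 1 ⊔ S.wt (1 / 2)).map (S.D ^ n) = ⊤ := by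
  obtain ⟨G, hG, hle, -⟩ := h
  rw [eq_top_iff, ← hG.generates]
  exact iSup_mono fun n => Submodule.map_mono hle

/-- Only weights with positive real part occur, as `∂` raises weights. -/
lemma IsPhysical.wt_eq_bot {S : ConformalSuperalgebra R} (h : S.IsPhysical) {k : ℂ}
    (hk : k.re ≤ 0) : S.wt k = ⊥ := by
  have htop : ⨆ (l : ℂ) (_ : l ≠ k), S.wt l = ⊤ := by
    rw [eq_top_iff, ← h.iSup_D_pow]
    refine iSup_le fun n => ?_
    simp only [Submodule.map_sup, sup_le_iff]
    have key : ∀ r : ℂ, 0 < r.re → (S.wt r).map (S.D ^ n) ≤ ⨆ (l : ℂ) (_ : l ≠ k), S.wt l := by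
      rintro r hr _ ⟨x, hx, rfl⟩
      refine Submodule.mem_iSup_of_mem (r + n) (Submodule.mem_iSup_of_mem ?_ (S.D_pow_mem_wt hx n))
      rintro rfl
      simp at hk
      have : (0 : ℝ) ≤ n := n.cast_nonneg
      linarith
    refine ⟨⟨⟨key _ ?_, key _ ?_⟩, key _ ?_⟩, key _ ?_⟩ <;> norm_num
  have := S.iSupIndep_wt k
  rwa [htop, disjoint_top] at this

lemma IsPhysical.eq_zero_of_mem_wt {S : ConformalSuperalgebra R} (h : S.IsPhysical) {k : ℂ}
    (hk : k.re ≤ 0) {x : R} (hx : x ∈ S.wt k) : x = 0 := by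
  rwa [h.wt_eq_bot hk, Submodule.mem_bot] at hx

lemma IsPhysical.mem_reduced {S : ConformalSuperalgebra R} (h : S.IsPhysical) {x : R} :
    x ∈ S.reduced ↔ S.prod 2 S.L x = 0 := by
  rw [reduced, Submodule.mem_comap, h.wt_eq_bot (by simp), Submodule.mem_bot]

lemma IsPhysical.L_mem_reduced {S : ConformalSuperalgebra R} (h : S.IsPhysical) :
    S.L ∈ S.reduced := h.mem_reduced.2 S.L_two

lemma IsPhysical.mem_reduced_of_mem_wt {S : ConformalSuperalgebra R} (h : S.IsPhysical) {k : ℂ}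
    (hk : k.re ≤ 1) {x : R} (hx : x ∈ S.wt k) : x ∈ S.reduced :=
  h.mem_reduced.2 (h.eq_zero_of_mem_wt (by simpa using hk) (S.L_two_mem_wt hx))

/-- A vector of weight `k` with `Re k ≤ 2` is the sum of a reduced vector and the derivative of a
reduced vector. -/
lemma IsPhysical.exists_reduced_add_D {S : ConformalSuperalgebra R} (h : S.IsPhysical) {k : ℂ}
    (hk : k.re ≤ 2) {x : R} (hx : x ∈ S.wt k) :
    ∃ y ∈ S.reduced ⊓ S.wt k, ∃ z ∈ S.reduced ⊓ S.wt (k - 1), x = y + S.D z := by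
  by_cases hk1 : k.re ≤ 1
  · exact ⟨x, ⟨h.mem_reduced_of_mem_wt hk1 hx, hx⟩, 0, zero_mem _, by simp⟩
  have hk1' : 2 * (k - 1) ≠ 0 := by
    intro h0
    have : k = 1 := by linear_combination h0 / 2
    simp [this] at hk1
  have hE := S.L_two_mem_wt hx
  have hEr : S.prod 2 S.L x ∈ S.reduced := h.mem_reduced_of_mem_wt (by simp; linarith) hE
  -- `L_(2)∂z = 2(k - 1)z` for reduced `z` of weight `k - 1`, so this `z` makes `x - ∂z` reduced
  set z := (2 * (k - 1))⁻¹ • S.prod 2 S.L x with hz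
  have hzw : z ∈ S.wt (k - 1) := Submodule.smul_mem _ _ hE
  have hzr : z ∈ S.reduced := Submodule.smul_mem _ _ hEr
  have hDz : S.D z ∈ S.wt k := by simpa using S.D_mem_wt hzw
  refine ⟨x - S.D z, ⟨?_, sub_mem hx hDz⟩, z, ⟨hzr, hzw⟩, by abel⟩
  rw [SetLike.mem_coe, h.mem_reduced, map_sub, L_two_D, h.mem_reduced.1 hzr, S.mem_wt.1 hzw, hz,
    smul_smul, smul_smul, map_zero, zero_add]
  rw [mul_inv_cancel₀ hk1', one_smul, sub_self]

/-- The sum of the reduced vectors of weight `2`, `3/2`, `1`, `1/2`. -/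
noncomputable def lowReduced (S : ConformalSuperalgebra R) : Submodule ℂ R :=
  S.reduced ⊓ S.wt 2 ⊔ S.reduced ⊓ S.wt (3 / 2) ⊔ S.reduced ⊓ S.wt 1 ⊔ S.reduced ⊓ S.wt (1 / 2)

lemma lowReduced_le : S.lowReduced ≤ S.reduced := by
  simp [lowReduced]

lemma IsPhysical.wt_le {S : ConformalSuperalgebra R} (h : S.IsPhysical) :
    S.wt 2 ⊔ S.wt (3 / 2) ⊔ S.wt 1 ⊔ S.wt (1 / 2) ≤ S.lowReduced ⊔ S.lowReduced.map S.D := by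
  have h2 : S.reduced ⊓ S.wt 2 ≤ S.lowReduced :=
    le_sup_left.trans (le_sup_left.trans le_sup_left)
  have h3 : S.reduced ⊓ S.wt (3 / 2) ≤ S.lowReduced :=
    le_sup_right.trans (le_sup_left.trans le_sup_left)
  have h1 : S.reduced ⊓ S.wt 1 ≤ S.lowReduced := le_sup_right.trans le_sup_left
  have h0 : S.reduced ⊓ S.wt (1 / 2) ≤ S.lowReduced := le_sup_right
  have key : ∀ k : ℂ, k.re ≤ 2 → S.reduced ⊓ S.wt k ≤ S.lowReduced →
      S.reduced ⊓ S.wt (k - 1) ≤ S.lowReduced → S.wt k ≤ S.lowReduced ⊔ S.lowReduced.map S.D := by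
    intro k hk hy hz x hx
    obtain ⟨y, hy', z, hz', rfl⟩ := h.exists_reduced_add_D hk hx
    exact Submodule.add_mem_sup (hy hy') (Submodule.mem_map_of_mem (hz hz'))
  have hneg : ∀ k : ℂ, k.re ≤ 0 → S.reduced ⊓ S.wt k ≤ S.lowReduced := fun k hk => by
    rw [h.wt_eq_bot hk]; simp
  refine sup_le (sup_le (sup_le (key _ ?_ h2 ?_) (key _ ?_ h3 ?_)) (key _ ?_ h1 ?_))
    (key _ ?_ h0 ?_)
  · norm_num
  · norm_num; exact h1
  · norm_num
  · norm_num; norm_num at h0; exact h0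
  · norm_num
  · exact hneg _ (by norm_num)
  · norm_num
  · exact hneg _ (by norm_num)

lemma IsPhysical.iSup_lowReduced {S : ConformalSuperalgebra R} (h : S.IsPhysical) :
    ⨆ n : ℕ, S.lowReduced.map (S.D ^ n) = ⊤ := by
  rw [eq_top_iff, ← h.iSup_D_pow]
  refine iSup_le fun n => (Submodule.map_mono h.wt_le).trans ?_
  rw [Submodule.map_sup, ← Submodule.map_comp]
  refine sup_le (le_iSup (fun n : ℕ => S.lowReduced.map (S.D ^ n)) n) ?_
  exact le_iSup (fun n : ℕ => S.lowReduced.map (S.D ^ n)) (n + 1)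

lemma IsPhysical.lowReduced_sup_range {S : ConformalSuperalgebra R} (h : S.IsPhysical) :
    S.lowReduced ⊔ LinearMap.range S.D = ⊤ := by
  rw [eq_top_iff, ← h.iSup_lowReduced]
  refine iSup_le fun n => ?_
  cases n with
  | zero => simp [Module.End.one_eq_id]
  | succ n =>
    refine le_trans ?_ le_sup_right
    rintro _ ⟨x, -, rfl⟩
    exact ⟨(S.D ^ n) x, by rw [pow_succ', Module.End.mul_apply]⟩

/-- `L_(2)∂` is injective: the algebra is spanned by its eigenvectors `∂ⁿx` with `x` reduced of
weight `r > 0`, and their eigenvalues `(n+1)(2r+n)` are nonzero. -/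
lemma IsPhysical.L_two_D_injective {S : ConformalSuperalgebra R} (h : S.IsPhysical) {x : R}
    (hx : S.prod 2 S.L (S.D x) = 0) : x = 0 := by
  set T : Module.End ℂ R := S.prod 2 S.L ∘ₗ S.D
  have htop : ⨆ (l : ℂ) (_ : l ≠ 0), T.eigenspace l = ⊤ := by
    rw [eq_top_iff, ← h.iSup_lowReduced]
    refine iSup_le fun n => ?_
    have key : ∀ r : ℂ, 0 < r.re → (S.reduced ⊓ S.wt r).map (S.D ^ n) ≤
        ⨆ (l : ℂ) (_ : l ≠ 0), T.eigenspace l := by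
      rintro r hr _ ⟨x, ⟨hx, hxw⟩, rfl⟩
      refine Submodule.mem_iSup_of_mem (((n : ℂ) + 1) * (2 * r + n))
        (Submodule.mem_iSup_of_mem ?_ ?_)
      · refine mul_ne_zero (Nat.cast_add_one_ne_zero n) fun h0 => ?_
        have := congrArg Complex.re h0
        simp at this
        have : (0 : ℝ) ≤ n := n.cast_nonneg
        linarith
      · rw [Module.End.mem_eigenspace_iff]
        exact S.L_two_D_pow hxw (h.mem_reduced.1 hx) n
    simp only [lowReduced, Submodule.map_sup, sup_le_iff]
    refine ⟨⟨⟨key _ ?_, key _ ?_⟩, key _ ?_⟩, key _ ?_⟩ <;> norm_num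
  have := Module.End.eigenspaces_iSupIndep T 0
  rw [htop, disjoint_top] at this
  rw [← Submodule.mem_bot ℂ, ← this, Module.End.mem_eigenspace_iff, zero_smul]
  exact hx

lemma IsPhysical.disjoint_reduced_range {S : ConformalSuperalgebra R} (h : S.IsPhysical) :
    Disjoint S.reduced (LinearMap.range S.D) := by
  rw [Submodule.disjoint_def]
  rintro _ hx ⟨y, rfl⟩
  rw [h.L_two_D_injective (h.mem_reduced.1 hx), map_zero]

/-- A subspace of the reduced subspace which, together with the image of `∂`, spans the algebra,
is the whole reduced subspace. -/
lemma IsPhysical.reduced_eq {S : ConformalSuperalgebra R} (h : S.IsPhysical) {Q : Submodule ℂ R}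
    (hQ : Q ≤ S.reduced) (hQD : Q ⊔ LinearMap.range S.D = ⊤) : S.reduced = Q := by
  refine le_antisymm (fun x hx => ?_) hQ
  obtain ⟨q, hq, d, hd, rfl⟩ := Submodule.mem_sup.1 (hQD ▸ Submodule.mem_top : x ∈ Q ⊔ _)
  have hd' : d ∈ S.reduced := by simpa using sub_mem hx (hQ hq)
  rw [Submodule.disjoint_def.1 h.disjoint_reduced_range d hd' hd, add_zero]
  exact hq

lemma IsPhysical.reduced_eq_lowReduced {S : ConformalSuperalgebra R} (h : S.IsPhysical) :
    S.reduced = S.lowReduced := h.reduced_eq S.lowReduced_le h.lowReduced_sup_range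

lemma IsPhysical.isCompl {S : ConformalSuperalgebra R} (h : S.IsPhysical) :
    IsCompl S.reduced (LinearMap.range S.D) :=
  ⟨h.disjoint_reduced_range, codisjoint_iff.2 <| by
    rw [h.reduced_eq_lowReduced]; exact h.lowReduced_sup_range⟩

end ConformalSuperalgebra

/-! ### The reduced subspace and its gradings -/

lemma iSupIndep_comap {ι : Type*} {M N : Type*} [AddCommGroup M] [Module ℂ M] [AddCommGroup N]
    [Module ℂ N] {p : ι → Submodule ℂ N} (hp : iSupIndep p) {f : M →ₗ[ℂ] N}
    (hf : Function.Injective f) : iSupIndep fun i => (p i).comap f := by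
  rw [iSupIndep_iff_finsetSum_eq_zero_imp_eq_zero] at hp ⊢
  intro s v hv h0 i hi
  refine hf ?_
  rw [map_zero]
  exact hp s (fun i => f (v i)) hv (by rw [← map_sum, h0, map_zero]) i hi

lemma IsSuperGrading.eq_zero {P : Type*} [AddCommGroup P] [Module ℂ P]
    {par : ZMod 2 → Submodule ℂ P} (h : IsSuperGrading par) {x : P} (h0 : x ∈ par 0)
    (h1 : x ∈ par 1) : x = 0 :=
  Submodule.disjoint_def.1 (h.indep.pairwiseDisjoint zero_ne_one) x h0 h1

lemma IsSuperGrading.exists_eq_add {P : Type*} [AddCommGroup P] [Module ℂ P]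
    {par : ZMod 2 → Submodule ℂ P} (h : IsSuperGrading par) (x : P) :
    ∃ y ∈ par 0, ∃ z ∈ par 1, x = y + z := by
  have : x ∈ ⨆ i, par i := h.span ▸ Submodule.mem_top
  induction this using Submodule.iSup_induction' with
  | mem i y hy =>
    fin_cases i
    · exact ⟨y, hy, 0, zero_mem _, by simp⟩
    · exact ⟨0, zero_mem _, y, hy, by simp⟩
  | zero => exact ⟨0, zero_mem _, 0, zero_mem _, by simp⟩
  | add y z _ _ hy hz =>
    obtain ⟨y₀, hy₀, y₁, hy₁, rfl⟩ := hy
    obtain ⟨z₀, hz₀, z₁, hz₁, rfl⟩ := hz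
    exact ⟨y₀ + z₀, add_mem hy₀ hz₀, y₁ + z₁, add_mem hy₁ hz₁, by abel⟩

namespace ConformalSuperalgebra

variable {R : Type*} [AddCommGroup R] [Module ℂ R] {S : ConformalSuperalgebra R}

lemma IsPhysical.wt_le_par_zero (h : S.IsPhysical) (n : ℕ) : S.wt n ≤ S.par 0 := by
  obtain ⟨G, hG, -⟩ := h
  rw [hG.even]
  exact le_iSup (fun n : ℕ => S.wt (n : ℂ)) n

lemma IsPhysical.wt_le_par_one (h : S.IsPhysical) (n : ℕ) : S.wt ((n : ℂ) + 1 / 2) ≤ S.par 1 := by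
  obtain ⟨G, hG, -⟩ := h
  rw [hG.odd]
  exact le_iSup (fun n : ℕ => S.wt ((n : ℂ) + 1 / 2)) n

lemma IsPhysical.wt_two_le (h : S.IsPhysical) : S.wt 2 ≤ S.par 0 := by
  simpa using h.wt_le_par_zero 2

lemma IsPhysical.wt_one_le (h : S.IsPhysical) : S.wt 1 ≤ S.par 0 := by
  simpa using h.wt_le_par_zero 1

lemma IsPhysical.wt_three_half_le (h : S.IsPhysical) : S.wt (3 / 2) ≤ S.par 1 := by
  have := h.wt_le_par_one 1
  norm_num at this ⊢
  exact this

lemma IsPhysical.wt_half_le (h : S.IsPhysical) : S.wt (1 / 2) ≤ S.par 1 := by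
  simpa using h.wt_le_par_one 0

lemma IsPhysical.mem_even (h : S.IsPhysical) {x : R} (h0 : x ∈ S.par 0)
    (hx : x ∈ S.wt 2 ⊔ S.wt (3 / 2) ⊔ S.wt 1 ⊔ S.wt (1 / 2)) : x ∈ S.wt 2 ⊔ S.wt 1 := by
  obtain ⟨y, hy, x₀, hx₀, rfl⟩ := Submodule.mem_sup.1 hx
  obtain ⟨z, hz, x₁, hx₁, rfl⟩ := Submodule.mem_sup.1 hy
  obtain ⟨x₂, hx₂, x₃, hx₃, rfl⟩ := Submodule.mem_sup.1 hz
  have he : x₂ + x₁ ∈ S.par 0 := add_mem (h.wt_two_le hx₂) (h.wt_one_le hx₁)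
  have ho : x₃ + x₀ ∈ S.par 1 := add_mem (h.wt_three_half_le hx₃) (h.wt_half_le hx₀)
  have ho' : x₃ + x₀ ∈ S.par 0 := by
    have := sub_mem h0 he
    rwa [show x₂ + x₃ + x₁ + x₀ - (x₂ + x₁) = x₃ + x₀ by abel] at this
  have := S.par_grading.eq_zero ho' ho
  rw [show x₂ + x₃ + x₁ + x₀ = (x₂ + x₁) + (x₃ + x₀) by abel, this, add_zero]
  exact Submodule.add_mem_sup hx₂ hx₁

lemma IsPhysical.mem_odd (h : S.IsPhysical) {x : R} (h1 : x ∈ S.par 1)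
    (hx : x ∈ S.wt 2 ⊔ S.wt (3 / 2) ⊔ S.wt 1 ⊔ S.wt (1 / 2)) :
    x ∈ S.wt (3 / 2) ⊔ S.wt (1 / 2) := by
  obtain ⟨y, hy, x₀, hx₀, rfl⟩ := Submodule.mem_sup.1 hx
  obtain ⟨z, hz, x₁, hx₁, rfl⟩ := Submodule.mem_sup.1 hy
  obtain ⟨x₂, hx₂, x₃, hx₃, rfl⟩ := Submodule.mem_sup.1 hz
  have he : x₂ + x₁ ∈ S.par 0 := add_mem (h.wt_two_le hx₂) (h.wt_one_le hx₁)
  have ho : x₃ + x₀ ∈ S.par 1 := add_mem (h.wt_three_half_le hx₃) (h.wt_half_le hx₀)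
  have he' : x₂ + x₁ ∈ S.par 1 := by
    have := sub_mem h1 ho
    rwa [show x₂ + x₃ + x₁ + x₀ - (x₃ + x₀) = x₂ + x₁ by abel] at this
  have := S.par_grading.eq_zero he he'
  rw [show x₂ + x₃ + x₁ + x₀ = (x₂ + x₁) + (x₃ + x₀) by abel, this, zero_add]
  exact Submodule.add_mem_sup hx₃ hx₀

/-- The weights of reduced vectors in a physical conformal superalgebra. -/
def IsPhysWeight (k : ℂ) : Prop := k = 2 ∨ k = 3 / 2 ∨ k = 1 ∨ k = 1 / 2

lemma IsPhysical.reduced_induction (h : S.IsPhysical) {motive : S.reduced → Prop}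
    (x : S.reduced) (hom : ∀ k, IsPhysWeight k → ∀ x ∈ S.redWt k, motive x)
    (add : ∀ x y, motive x → motive y → motive (x + y)) : motive x := by
  obtain ⟨x, hx⟩ := x
  have hx' : x ∈ S.lowReduced := h.reduced_eq_lowReduced ▸ hx
  obtain ⟨y, hy, x₀, hx₀, rfl⟩ := Submodule.mem_sup.1 hx'
  obtain ⟨z, hz, x₁, hx₁, rfl⟩ := Submodule.mem_sup.1 hy
  obtain ⟨x₂, hx₂, x₃, hx₃, rfl⟩ := Submodule.mem_sup.1 hz
  refine add ⟨x₂ + x₃ + x₁, add_mem (add_mem hx₂.1 hx₃.1) hx₁.1⟩ ⟨x₀, hx₀.1⟩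
    (add ⟨x₂ + x₃, add_mem hx₂.1 hx₃.1⟩ ⟨x₁, hx₁.1⟩ (add ⟨x₂, hx₂.1⟩ ⟨x₃, hx₃.1⟩ ?_ ?_) ?_) ?_
  · exact hom _ (.inl rfl) _ hx₂.2
  · exact hom _ (.inr (.inl rfl)) _ hx₃.2
  · exact hom _ (.inr (.inr (.inl rfl))) _ hx₁.2
  · exact hom _ (.inr (.inr (.inr rfl))) _ hx₀.2

lemma mem_redWt {k : ℂ} {x : S.reduced} : x ∈ S.redWt k ↔ (x : R) ∈ S.wt k := Iff.rfl

lemma mem_redPar {i : ZMod 2} {x : S.reduced} : x ∈ S.redPar i ↔ (x : R) ∈ S.par i := Iff.rfl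

lemma iSupIndep_redWt (S : ConformalSuperalgebra R) : iSupIndep S.redWt :=
  iSupIndep_comap S.iSupIndep_wt S.reduced.injective_subtype

lemma IsPhysical.iSup_redWt (h : S.IsPhysical) : ⨆ k, S.redWt k = ⊤ := by
  rw [eq_top_iff]
  rintro x -
  induction x using h.reduced_induction with
  | hom k _ x hx => exact Submodule.mem_iSup_of_mem k hx
  | add x y hx hy => exact add_mem hx hy

lemma IsPhysical.redWt_eq_bot (h : S.IsPhysical) {k : ℂ} (hk : ¬ IsPhysWeight k) :
    S.redWt k = ⊥ := by
  have htop : ⨆ (l : ℂ) (_ : l ≠ k), S.redWt l = ⊤ := by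
    rw [eq_top_iff]
    rintro x -
    induction x using h.reduced_induction with
    | hom l hl x hx =>
      exact Submodule.mem_iSup_of_mem l (Submodule.mem_iSup_of_mem (by rintro rfl; exact hk hl) hx)
    | add x y hx hy => exact add_mem hx hy
  have := S.iSupIndep_redWt k
  rwa [htop, disjoint_top] at this

/-- The projection of a physical conformal superalgebra onto its reduced subspace along the image
of `∂`; it maps every vector to its `0`-part. -/
noncomputable def IsPhysical.zeroPart (h : S.IsPhysical) : R →ₗ[ℂ] S.reduced :=
  S.reduced.projectionOnto (LinearMap.range S.D) h.isCompl

lemma IsPhysical.zeroPart_coe (h : S.IsPhysical) (x : S.reduced) : h.zeroPart x = x :=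
  Submodule.projectionOnto_apply_left h.isCompl x

lemma IsPhysical.zeroPart_of_mem (h : S.IsPhysical) {x : R} (hx : x ∈ S.reduced) :
    h.zeroPart x = ⟨x, hx⟩ := h.zeroPart_coe ⟨x, hx⟩

lemma IsPhysical.zeroPart_D (h : S.IsPhysical) (x : R) : h.zeroPart (S.D x) = 0 := by
  have : S.D x ∈ LinearMap.ker (S.reduced.projectionOnto (LinearMap.range S.D) h.isCompl) := by
    rw [Submodule.ker_projectionOnto]; exact ⟨x, rfl⟩
  exact this

lemma IsPhysical.exists_eq_zeroPart_add_D (h : S.IsPhysical) (x : R) :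
    ∃ y, x = h.zeroPart x + S.D y := by
  obtain ⟨a, ha, _, ⟨b, rfl⟩, rfl⟩ :=
    Submodule.mem_sup.1 (h.isCompl.sup_eq_top ▸ Submodule.mem_top : x ∈ S.reduced ⊔ _)
  exact ⟨b, by rw [map_add, h.zeroPart_of_mem ha, h.zeroPart_D, add_zero]⟩

lemma L_two_L_one (S : ConformalSuperalgebra R) (x : R) :
    S.prod 2 S.L (S.prod 1 S.L x) = S.prod 1 S.L (S.prod 2 S.L x) + S.prod 2 S.L x := by
  have := S.L_one_prod 2 S.L x
  rw [S.L_one] at this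
  rw [this]
  simp only [map_smul, LinearMap.smul_apply]
  push_cast
  module

lemma IsPhysical.L_one_mem_reduced (h : S.IsPhysical) {x : R} (hx : x ∈ S.reduced) :
    S.prod 1 S.L x ∈ S.reduced := by
  rw [h.mem_reduced] at *
  rw [L_two_L_one, hx, map_zero, add_zero]

lemma IsPhysical.zeroPart_L_one (h : S.IsPhysical) (x : R) :
    (h.zeroPart (S.prod 1 S.L x) : R) = S.prod 1 S.L (h.zeroPart x) := by
  obtain ⟨y, hy⟩ := h.exists_eq_zeroPart_add_D x
  have : S.prod 1 S.L x = S.prod 1 S.L (h.zeroPart x) + S.D (S.prod 1 S.L y + y) := by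
    conv_lhs => rw [hy]
    rw [map_add, L_one_D, map_add]
  rw [this, map_add, h.zeroPart_D, add_zero,
    h.zeroPart_of_mem (h.L_one_mem_reduced (h.zeroPart x).2)]

lemma IsPhysical.zeroPart_mem_redWt (h : S.IsPhysical) {k : ℂ} {x : R} (hx : x ∈ S.wt k) :
    h.zeroPart x ∈ S.redWt k := by
  rw [mem_redWt, mem_wt, ← h.zeroPart_L_one, S.mem_wt.1 hx, map_smul, Submodule.coe_smul]

lemma IsPhysWeight.ne_zero {k : ℂ} (hk : IsPhysWeight k) : k ≠ 0 := by
  rcases hk with rfl | rfl | rfl | rfl <;> norm_num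

lemma IsPhysical.reduced_le_iSup (h : S.IsPhysical) :
    S.reduced ≤ ⨆ k : {k : ℂ // k ≠ 0}, S.reduced ⊓ S.wt k := by
  intro x hx
  suffices ∀ x : S.reduced, (x : R) ∈ ⨆ k : {k : ℂ // k ≠ 0}, S.reduced ⊓ S.wt k from
    this ⟨x, hx⟩
  intro x
  induction x using h.reduced_induction with
  | hom k hk x hx =>
    exact Submodule.mem_iSup_of_mem (⟨k, hk.ne_zero⟩ : {k : ℂ // k ≠ 0}) ⟨x.2, hx⟩
  | add x y hx hy => exact add_mem hx hy

lemma IsPhysical.eq_zeroPart (h : S.IsPhysical) {x y : R} (hxy : S.IsZeroPart x y) :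
    y = h.zeroPart x := by
  obtain ⟨m, z, rfl, hy, -, rfl⟩ := hxy
  rw [Finset.sum_range_succ', map_add, map_sum, Finset.sum_eq_zero, zero_add]
  · simp [divPow, h.zeroPart_of_mem hy]
  · intro j _
    rw [divPow, LinearMap.smul_apply, map_smul, pow_succ', Module.End.mul_apply, h.zeroPart_D,
      smul_zero]

/-- A sum of a reduced vector and the derivative of a reduced vector has the first one as its
`0`-part. -/
lemma IsPhysical.isZeroPart_add_D (h : S.IsPhysical) {y z : R} (hy : y ∈ S.reduced)
    (hz : z ∈ S.reduced) : S.IsZeroPart (y + S.D z) y := by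
  refine ⟨1, fun j => if j = 0 then y else z, by simp, hy, fun j hj => ?_, ?_⟩
  · simp only [hj.ne', if_false]
    exact h.reduced_le_iSup hz
  · simp [Finset.sum_range_succ, divPow]

lemma IsPhysical.isZeroPart_self (h : S.IsPhysical) {y : R} (hy : y ∈ S.reduced) :
    S.IsZeroPart y y := by
  simpa using h.isZeroPart_add_D hy (zero_mem _)

/-- The reduced vectors of weight `2` are the multiples of `L`.  Let `G` be a generating space.
A reduced vector `x` of weight `2` is the `0`-part of some even `g ∈ G`, a sum of vectors of weight
`2` and `1`.  As vectors of weight `1` are reduced, the part of weight `1` vanishes, so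
`g ∈ G ∩ R² = ℂL`. -/
lemma IsPhysical.redWt_two (h : S.IsPhysical) :
    S.redWt 2 = Submodule.span ℂ {⟨S.L, h.L_mem_reduced⟩} := by
  refine le_antisymm (fun x hx => ?_) ?_
  swap
  · rw [Submodule.span_le, Set.singleton_subset_iff]
    exact S.L_mem_wt
  obtain ⟨G, hG, hle, h2⟩ := id h
  have hx' : ∃ g ∈ G, h.zeroPart g = x := by
    have hr : ∀ r : R, ∃ g ∈ G, h.zeroPart g = h.zeroPart r := by
      intro r
      have : r ∈ ⨆ n : ℕ, G.map (S.D ^ n) := hG.generates ▸ Submodule.mem_top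
      induction this using Submodule.iSup_induction' with
      | mem n y hy =>
        obtain ⟨g, hg, rfl⟩ := hy
        cases n with
        | zero => exact ⟨g, hg, rfl⟩
        | succ n => exact ⟨0, zero_mem _, by
            rw [pow_succ', Module.End.mul_apply, h.zeroPart_D, map_zero]⟩
      | zero => exact ⟨0, zero_mem _, rfl⟩
      | add y z _ _ hy hz =>
        obtain ⟨g, hg, hgy⟩ := hy
        obtain ⟨g', hg', hgz⟩ := hz
        exact ⟨g + g', add_mem hg hg', by rw [map_add, map_add, hgy, hgz]⟩
    obtain ⟨g, hg, hgx⟩ := hr x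
    exact ⟨g, hg, by rw [hgx, h.zeroPart_coe]⟩
  obtain ⟨g, hg, hgx⟩ := hx'
  have hsplit : ∃ g₀ ∈ G ⊓ S.par 0, ∃ g₁ ∈ G ⊓ S.par 1, g = g₀ + g₁ := by
    have : g ∈ ⨆ i, G ⊓ S.par i := hG.graded.symm ▸ hg
    clear hgx hg
    induction this using Submodule.iSup_induction' with
    | mem i y hy =>
      fin_cases i
      · exact ⟨y, hy, 0, zero_mem _, by simp⟩
      · exact ⟨0, zero_mem _, y, hy, by simp⟩
    | zero => exact ⟨0, zero_mem _, 0, zero_mem _, by simp⟩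
    | add y z _ _ hy hz =>
      obtain ⟨y₀, hy₀, y₁, hy₁, rfl⟩ := hy
      obtain ⟨z₀, hz₀, z₁, hz₁, rfl⟩ := hz
      exact ⟨y₀ + z₀, add_mem hy₀ hz₀, y₁ + z₁, add_mem hy₁ hz₁, by abel⟩
  obtain ⟨g₀, ⟨hg₀, hg₀'⟩, g₁, ⟨hg₁, hg₁'⟩, rfl⟩ := hsplit
  obtain ⟨w₂, hw₂, w₁, hw₁, rfl⟩ := Submodule.mem_sup.1 (h.mem_even hg₀' (hle hg₀))
  obtain ⟨w₃, hw₃, w₀, hw₀, rfl⟩ := Submodule.mem_sup.1 (h.mem_odd hg₁' (hle hg₁))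
  have hx₁ : (h.zeroPart w₁ : R) = w₁ := by rw [h.zeroPart_of_mem
    (h.mem_reduced_of_mem_wt (by norm_num) hw₁)]
  have hodd : (h.zeroPart (w₃ + w₀) : R) = 0 := by
    have h1 : (h.zeroPart (w₃ + w₀) : R) ∈ S.par 1 := by
      rw [map_add]
      exact add_mem (h.wt_three_half_le (h.zeroPart_mem_redWt hw₃))
        (h.wt_half_le (h.zeroPart_mem_redWt hw₀))
    refine S.par_grading.eq_zero ?_ h1
    have : (h.zeroPart (w₃ + w₀) : R) = x - (h.zeroPart w₂ + h.zeroPart w₁) := by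
      rw [← hgx]; simp only [map_add, Submodule.coe_add]; abel
    rw [this]
    exact sub_mem (h.wt_two_le hx) (add_mem (h.wt_two_le (h.zeroPart_mem_redWt hw₂))
      (h.wt_one_le (h.zeroPart_mem_redWt hw₁)))
  have hx₂ : (x : R) = h.zeroPart w₂ + w₁ := by
    rw [← hgx, map_add, Submodule.coe_add, hodd, map_add, Submodule.coe_add, hx₁, add_zero]
  have hw₁0 : w₁ = 0 := by
    refine S.eq_zero_of_mem_wt (k := 2) (by norm_num) ?_ hw₁
    rw [← sub_eq_of_eq_add' hx₂]
    exact sub_mem hx (h.zeroPart_mem_redWt hw₂)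
  subst hw₁0
  have hmem : w₂ ∈ Submodule.span ℂ {S.L} := h2 ▸ ⟨by simpa using hg₀, hw₂⟩
  obtain ⟨c, rfl⟩ := Submodule.mem_span_singleton.1 hmem
  refine Submodule.mem_span_singleton.2 ⟨c, Subtype.ext ?_⟩
  rw [hx₂, map_smul, h.zeroPart_of_mem h.L_mem_reduced, add_zero]

lemma IsPhysWeight.par_le (h : S.IsPhysical) {k : ℂ} (hk : IsPhysWeight k) :
    ∃ i : ZMod 2, S.redWt k ≤ S.redPar i := by
  rcases hk with rfl | rfl | rfl | rfl
  · exact ⟨0, fun x hx => h.wt_two_le hx⟩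
  · exact ⟨1, fun x hx => h.wt_three_half_le hx⟩
  · exact ⟨0, fun x hx => h.wt_one_le hx⟩
  · exact ⟨1, fun x hx => h.wt_half_le hx⟩

lemma IsPhysical.redPar_grading (h : S.IsPhysical) : IsSuperGrading S.redPar := by
  refine ⟨iSupIndep_comap S.par_grading.indep S.reduced.injective_subtype, ?_⟩
  rw [eq_top_iff]
  rintro x -
  induction x using h.reduced_induction with
  | hom k hk x hx =>
    obtain ⟨i, hi⟩ := hk.par_le h
    exact Submodule.mem_iSup_of_mem i (hi hx)
  | add x y hx hy => exact add_mem hx hy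

lemma IsPhysical.lowReduced_le_wt (h : S.IsPhysical) (x : S.reduced) :
    (x : R) ∈ S.wt 2 ⊔ S.wt (3 / 2) ⊔ S.wt 1 ⊔ S.wt (1 / 2) := by
  have : (x : R) ∈ S.lowReduced := h.reduced_eq_lowReduced.le x.2
  have hle : S.lowReduced ≤ S.wt 2 ⊔ S.wt (3 / 2) ⊔ S.wt 1 ⊔ S.wt (1 / 2) :=
    sup_le_sup (sup_le_sup (sup_le_sup inf_le_right inf_le_right) inf_le_right) inf_le_right
  exact hle this

lemma IsPhysical.isPhysicalGrading (h : S.IsPhysical) :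
    IsPhysicalGrading S.redPar S.redWt ⟨S.L, h.L_mem_reduced⟩ where
  super := h.redPar_grading
  indep := S.iSupIndep_redWt
  span := h.iSup_redWt
  weights k h2 h3 h1 h0 := h.redWt_eq_bot (by rintro (h | h | h | h) <;> contradiction)
  two := h.redWt_two
  even := by
    refine le_antisymm (fun x hx => ?_) (sup_le (fun x hx => h.wt_two_le hx)
      (fun x hx => h.wt_one_le hx))
    obtain ⟨y, hy, z, hz, hyz⟩ := Submodule.mem_sup.1 (h.mem_even hx (h.lowReduced_le_wt x))
    have hz' : z ∈ S.reduced := h.mem_reduced_of_mem_wt (by norm_num) hz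
    have hy' : y ∈ S.reduced := by
      rw [eq_sub_of_add_eq hyz]; exact sub_mem x.2 hz'
    exact Submodule.mem_sup.2 ⟨⟨y, hy'⟩, hy, ⟨z, hz'⟩, hz, Subtype.ext hyz⟩
  odd := by
    refine le_antisymm (fun x hx => ?_) (sup_le (fun x hx => h.wt_three_half_le hx)
      (fun x hx => h.wt_half_le hx))
    obtain ⟨y, hy, z, hz, hyz⟩ := Submodule.mem_sup.1 (h.mem_odd hx (h.lowReduced_le_wt x))
    have hz' : z ∈ S.reduced := h.mem_reduced_of_mem_wt (by norm_num) hz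
    have hy' : y ∈ S.reduced := by
      rw [eq_sub_of_add_eq hyz]; exact sub_mem x.2 hz'
    exact Submodule.mem_sup.2 ⟨⟨y, hy'⟩, hy, ⟨z, hz'⟩, hz, Subtype.ext hyz⟩

end ConformalSuperalgebra

/-! ### The products on the reduced subspace -/

namespace ConformalSuperalgebra

variable {R : Type*} [AddCommGroup R] [Module ℂ R] {S : ConformalSuperalgebra R}

lemma IsPhysWeight.eq_two_or_re_le {k : ℂ} (hk : IsPhysWeight k) : k = 2 ∨ k.re ≤ 3 / 2 := by
  rcases hk with rfl | rfl | rfl | rfl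
  · exact .inl rfl
  all_goals right; norm_num

lemma prod_zero_of_skew {i j : ZMod 2} {a b : R} (ha : a ∈ S.par i) (hb : b ∈ S.par j)
    (hba : ∀ n, 2 ≤ n → S.prod n b a = 0) :
    S.prod 0 a b = superSign i j • (S.D (S.prod 1 b a) - S.prod 0 b a) := by
  rw [S.c2 0 i j a b ha hb, finsum_eq_sum_of_support_subset (s := Finset.range 2)]
  · simp only [Finset.sum_range_succ, Finset.sum_range_zero, divPow]
    norm_num
    rw [smul_sub]; abel
  · intro k hk
    by_contra h
    simp only [Finset.coe_range, Set.mem_Iio, not_lt] at h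
    exact hk (by simp [hba k h])

lemma prod_one_of_skew {i j : ZMod 2} {a b : R} (ha : a ∈ S.par i) (hb : b ∈ S.par j)
    (hba : ∀ n, 2 ≤ n → S.prod n b a = 0) :
    S.prod 1 a b = superSign i j • S.prod 1 b a := by
  rw [S.c2 1 i j a b ha hb, finsum_eq_sum_of_support_subset (s := Finset.range 1)]
  · simp [divPow]
  · intro k hk
    by_contra h
    simp only [Finset.coe_range, Set.mem_Iio, not_lt] at h
    exact hk (by simp [hba (1 + k) (by omega)])

lemma prod_eq_zero_of_skew {i j : ZMod 2} {a b : R} (ha : a ∈ S.par i) (hb : b ∈ S.par j)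
    (hba : ∀ n, 2 ≤ n → S.prod n b a = 0) {n : ℕ} (hn : 2 ≤ n) : S.prod n a b = 0 := by
  rw [S.c2 n i j a b ha hb, finsum_eq_zero_of_forall_eq_zero, smul_zero]
  intro k
  rw [hba (n + k) (by omega), map_zero, smul_zero]

lemma IsPhysical.exists_smul_L (h : S.IsPhysical) {x : S.reduced} (hx : x ∈ S.redWt 2) :
    ∃ c : ℂ, x = c • ⟨S.L, h.L_mem_reduced⟩ := by
  rw [h.redWt_two] at hx
  obtain ⟨c, hc⟩ := Submodule.mem_span_singleton.1 hx
  exact ⟨c, hc.symm⟩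

lemma IsPhysical.L_prod_eq_zero (h : S.IsPhysical) (x : S.reduced) {n : ℕ} (hn : 2 ≤ n) :
    S.prod n S.L x = 0 := by
  induction x using h.reduced_induction with
  | add x y hx hy => rw [Submodule.coe_add, map_add, hx, hy, add_zero]
  | hom q hq x hx =>
    rcases hn.eq_or_lt with rfl | hn
    · exact h.mem_reduced.1 x.2
    · refine h.eq_zero_of_mem_wt ?_ (S.prod_mem_wt S.L_mem_wt hx n)
      have : (3 : ℝ) ≤ n := by exact_mod_cast hn
      have hq2 : q.re ≤ 2 := by
        rcases hq.eq_two_or_re_le with rfl | h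
        · norm_num
        · linarith
      simp
      linarith

/-- Reduced vectors `a`, `b` satisfy `a_(n) b = 0` for `n ≥ 2`.  If neither is a multiple of `L`,
their weights are at most `3/2`, and `a_(n) b` has weight at most `0`. -/
lemma IsPhysical.prod_eq_zero (h : S.IsPhysical) (a b : S.reduced) {n : ℕ} (hn : 2 ≤ n) :
    S.prod n (a : R) b = 0 := by
  induction a using h.reduced_induction with
  | add x y hx hy => rw [Submodule.coe_add, map_add, LinearMap.add_apply, hx, hy, add_zero]
  | hom p hp a ha =>
  induction b using h.reduced_induction with
  | add x y hx hy => rw [Submodule.coe_add, map_add, hx, hy, add_zero]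
  | hom q hq b hb =>
  rcases hp.eq_two_or_re_le with rfl | hp'
  · obtain ⟨c, rfl⟩ := h.exists_smul_L ha
    rw [Submodule.coe_smul, map_smul, LinearMap.smul_apply, h.L_prod_eq_zero b hn, smul_zero]
  rcases hq.eq_two_or_re_le with rfl | hq'
  · obtain ⟨c, rfl⟩ := h.exists_smul_L hb
    obtain ⟨i, hi⟩ := hp.par_le h
    rw [Submodule.coe_smul, map_smul, prod_eq_zero_of_skew (mem_redPar.1 (hi ha)) S.L_even
      (fun n hn => h.L_prod_eq_zero a hn) hn, smul_zero]
  refine h.eq_zero_of_mem_wt ?_ (S.prod_mem_wt (mem_redWt.1 ha) (mem_redWt.1 hb) n)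
  have : (2 : ℝ) ≤ n := by exact_mod_cast hn
  simp
  linarith

lemma IsPhysical.prod_one_mem (h : S.IsPhysical) (a b : S.reduced) :
    S.prod 1 (a : R) b ∈ S.reduced := by
  induction a using h.reduced_induction with
  | add x y hx hy =>
    rw [Submodule.coe_add, map_add, LinearMap.add_apply]; exact add_mem hx hy
  | hom p hp a ha =>
  induction b using h.reduced_induction with
  | add x y hx hy => rw [Submodule.coe_add, map_add]; exact add_mem hx hy
  | hom q hq b hb =>
  rcases hp.eq_two_or_re_le with rfl | hp'
  · obtain ⟨c, rfl⟩ := h.exists_smul_L ha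
    rw [Submodule.coe_smul, map_smul, LinearMap.smul_apply]
    exact Submodule.smul_mem _ _ (h.L_one_mem_reduced b.2)
  rcases hq.eq_two_or_re_le with rfl | hq'
  · obtain ⟨c, rfl⟩ := h.exists_smul_L hb
    obtain ⟨i, hi⟩ := hp.par_le h
    rw [Submodule.coe_smul, map_smul, prod_one_of_skew (mem_redPar.1 (hi ha)) S.L_even
      (fun n hn => h.L_prod_eq_zero a hn)]
    exact Submodule.smul_mem _ _ (Submodule.smul_mem _ _ (h.L_one_mem_reduced a.2))
  refine h.mem_reduced_of_mem_wt ?_ (S.prod_mem_wt (mem_redWt.1 ha) (mem_redWt.1 hb) 1)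
  simp
  linarith

lemma IsPhysical.prod_zero_eq_zeroPart_add_D (h : S.IsPhysical) (a b : S.reduced) :
    ∃ z : S.reduced, S.prod 0 (a : R) b = h.zeroPart (S.prod 0 (a : R) b) + S.D z := by
  induction a using h.reduced_induction with
  | add x y hx hy =>
    obtain ⟨z, hz⟩ := hx
    obtain ⟨w, hw⟩ := hy
    refine ⟨z + w, ?_⟩
    simp only [Submodule.coe_add, map_add, LinearMap.add_apply]
    conv_lhs => rw [hz, hw]
    abel
  | hom p hp a ha =>
  induction b using h.reduced_induction with
  | add x y hx hy =>
    obtain ⟨z, hz⟩ := hx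
    obtain ⟨w, hw⟩ := hy
    refine ⟨z + w, ?_⟩
    simp only [Submodule.coe_add, map_add]
    conv_lhs => rw [hz, hw]
    abel
  | hom q hq b hb =>
  have of_D : ∀ z : S.reduced, S.prod 0 (a : R) b = S.D z →
      ∃ z : S.reduced, S.prod 0 (a : R) b = h.zeroPart (S.prod 0 (a : R) b) + S.D z :=
    fun z hz => ⟨z, by rw [hz, h.zeroPart_D, Submodule.coe_zero, zero_add]⟩
  rcases hp.eq_two_or_re_le with rfl | hp'
  · obtain ⟨c, rfl⟩ := h.exists_smul_L ha
    exact of_D (c • b) (by simp [S.L_zero])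
  rcases hq.eq_two_or_re_le with rfl | hq'
  · obtain ⟨c, rfl⟩ := h.exists_smul_L hb
    obtain ⟨i, hi⟩ := hp.par_le h
    refine of_D (c • superSign i 0 • (⟨S.prod 1 S.L a, h.L_one_mem_reduced a.2⟩ - a)) ?_
    rw [Submodule.coe_smul, map_smul, prod_zero_of_skew (mem_redPar.1 (hi ha)) S.L_even
      (fun n hn => h.L_prod_eq_zero a hn), S.L_zero]
    simp
  · have hw : (p + q - (0 : ℕ) - 1).re ≤ 2 := by simp; linarith
    obtain ⟨y, ⟨hy, -⟩, z, ⟨hz, -⟩, hyz⟩ :=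
      h.exists_reduced_add_D hw (S.prod_mem_wt (mem_redWt.1 ha) (mem_redWt.1 hb) 0)
    refine ⟨⟨z, hz⟩, ?_⟩
    rw [hyz, map_add, h.zeroPart_D, h.zeroPart_of_mem hy, add_zero]

lemma IsPhysical.L_one_bijective (h : S.IsPhysical) : Function.Bijective (S.prod 1 S.L) := by
  constructor
  · rw [← LinearMap.ker_eq_bot, ← h.wt_eq_bot (k := 0) (by simp)]
    ext x
    simp [mem_wt]
  · rw [← LinearMap.range_eq_top, eq_top_iff, ← S.L_diag]
    refine iSup_le fun k x hx => ?_
    have hx' : x ∈ S.wt k := hx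
    by_cases hk : k = 0
    · subst hk
      rw [h.eq_zero_of_mem_wt (by simp) hx']
      exact zero_mem _
    · exact ⟨k⁻¹ • x, by rw [map_smul, S.mem_wt.1 hx', smul_smul, inv_mul_cancel₀ hk, one_smul]⟩

/-- The inverse of `L_(1)`. -/
noncomputable def IsPhysical.wtInv (h : S.IsPhysical) : R →ₗ[ℂ] R :=
  (LinearEquiv.ofBijective (S.prod 1 S.L) h.L_one_bijective).symm.toLinearMap

lemma IsPhysical.L_one_wtInv (h : S.IsPhysical) (x : R) : S.prod 1 S.L (h.wtInv x) = x :=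
  (LinearEquiv.ofBijective (S.prod 1 S.L) h.L_one_bijective).apply_symm_apply x

lemma IsPhysical.wtInv_of_mem_wt (h : S.IsPhysical) {k : ℂ} {x : R} (hx : x ∈ S.wt k) :
    h.wtInv x = k⁻¹ • x := by
  apply h.L_one_bijective.1
  rw [h.L_one_wtInv, map_smul, S.mem_wt.1 hx, smul_smul]
  by_cases hk : k = 0
  · subst hk
    rw [h.eq_zero_of_mem_wt (by simp) hx, smul_zero]
  · rw [inv_mul_cancel₀ hk, one_smul]

/-- The product `a • b`, the `0`-part of `a_(0) b`. -/
noncomputable def IsPhysical.bullet (h : S.IsPhysical) :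
    S.reduced →ₗ[ℂ] S.reduced →ₗ[ℂ] S.reduced :=
  ((S.prod 0).compl₁₂ S.reduced.subtype S.reduced.subtype).compr₂ h.zeroPart

/-- The product `a ∘ b`.  As `a_(1) b` has weight `Δ(a) + Δ(b) - 2`, it is the `0`-part of
`L_(1)⁻¹ (a_(1) b)`. -/
noncomputable def IsPhysical.circ (h : S.IsPhysical) :
    S.reduced →ₗ[ℂ] S.reduced →ₗ[ℂ] S.reduced :=
  ((S.prod 1).compl₁₂ S.reduced.subtype S.reduced.subtype).compr₂ (h.zeroPart ∘ₗ h.wtInv)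

lemma IsPhysical.bullet_apply (h : S.IsPhysical) (a b : S.reduced) :
    h.bullet a b = h.zeroPart (S.prod 0 (a : R) b) := rfl

lemma IsPhysical.circ_apply (h : S.IsPhysical) (a b : S.reduced) :
    h.circ a b = h.zeroPart (h.wtInv (S.prod 1 (a : R) b)) := rfl

lemma prod_one_mem_wt {p q : ℂ} {a b : R} (ha : a ∈ S.wt p) (hb : b ∈ S.wt q) :
    S.prod 1 a b ∈ S.wt (p + q - 2) := by
  have := S.prod_mem_wt ha hb 1
  rwa [show p + q - (1 : ℕ) - 1 = p + q - 2 by push_cast; ring] at this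

lemma IsPhysical.circ_eq (h : S.IsPhysical) {p q : ℂ} {a b : S.reduced} (ha : a ∈ S.redWt p)
    (hb : b ∈ S.redWt q) : (h.circ a b : R) = (p + q - 2)⁻¹ • S.prod 1 (a : R) b := by
  rw [circ_apply, h.wtInv_of_mem_wt (prod_one_mem_wt (mem_redWt.1 ha) (mem_redWt.1 hb)), map_smul,
    h.zeroPart_of_mem (h.prod_one_mem a b)]
  rfl

lemma IsPhysical.prod_one_eq (h : S.IsPhysical) {p q : ℂ} {a b : S.reduced} (ha : a ∈ S.redWt p)
    (hb : b ∈ S.redWt q) : S.prod 1 (a : R) b = (p + q - 2) • (h.circ a b : R) := by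
  rw [h.circ_eq ha hb, smul_smul]
  by_cases hk : p + q - 2 = 0
  · have := prod_one_mem_wt (mem_redWt.1 ha) (mem_redWt.1 hb)
    rw [hk] at this
    rw [h.eq_zero_of_mem_wt (by simp) this, smul_zero]
  · rw [mul_inv_cancel₀ hk, one_smul]

lemma IsPhysical.hasProductWeights (h : S.IsPhysical) :
    HasProductWeights S.redWt h.circ h.bullet where
  bullet p q a b ha hb := by
    have := S.prod_mem_wt (mem_redWt.1 ha) (mem_redWt.1 hb) 0
    rw [Nat.cast_zero, sub_zero] at this
    exact h.zeroPart_mem_redWt this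
  circ p q a b ha hb := by
    rw [mem_redWt, h.circ_eq ha hb]
    exact Submodule.smul_mem _ _ (prod_one_mem_wt (mem_redWt.1 ha) (mem_redWt.1 hb))

/-- The decomposition of `a_(0) b` for reduced vectors; the coefficient is found by applying
`L_(2)`. -/
lemma IsPhysical.prod_zero_eq (h : S.IsPhysical) {p q : ℂ} {a b : S.reduced} (ha : a ∈ S.redWt p)
    (hb : b ∈ S.redWt q) :
    S.prod 0 (a : R) b = h.bullet a b + (p - 1) • S.D (h.circ a b) := by
  obtain ⟨z, hz⟩ := h.prod_zero_eq_zeroPart_add_D a b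
  have h1 := S.L_two_prod_zero (a : R) b
  rw [hz, map_add, h.mem_reduced.1 (h.zeroPart _).2, L_two_D, h.mem_reduced.1 z.2,
    h.mem_reduced.1 a.2, h.mem_reduced.1 b.2, S.mem_wt.1 (mem_redWt.1 ha)] at h1
  simp only [map_zero, LinearMap.zero_apply, map_smul, LinearMap.smul_apply, zero_add,
    add_zero] at h1
  have h2 : S.prod 1 S.L ((p - 1) • (h.circ a b : R)) = (p - 1) • S.prod 1 (a : R) b := by
    rw [map_smul, S.mem_wt.1 (mem_redWt.1 <| h.hasProductWeights.circ p q a b ha hb),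
      ← h.prod_one_eq ha hb]
  have h3 : (z : R) = (p - 1) • (h.circ a b : R) := by
    apply h.L_one_bijective.1
    rw [h2]
    linear_combination (norm := module) (1 / 2 : ℂ) • h1
  conv_lhs => rw [hz, h3, map_smul]
  rfl

lemma IsPhysical.isReducedProducts (h : S.IsPhysical) : S.IsReducedProducts h.circ h.bullet where
  bullet_eq a b := by
    obtain ⟨z, hz⟩ := h.prod_zero_eq_zeroPart_add_D a b
    have := h.isZeroPart_add_D (h.zeroPart (S.prod 0 (a : R) b)).2 z.2
    rwa [← hz] at this
  circ_eq p q a b ha hb _ :=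
    ⟨⟨_, h.prod_one_mem a b⟩, h.isZeroPart_self (h.prod_one_mem a b),
      Subtype.ext (h.circ_eq ha hb)⟩
  circ_zero p q a b ha hb hpq := by
    ext
    rw [h.circ_eq ha hb, hpq, inv_zero, zero_smul, Submodule.coe_zero]

lemma IsPhysical.reducedProducts_unique (h : S.IsPhysical)
    {circ bullet : S.reduced →ₗ[ℂ] S.reduced →ₗ[ℂ] S.reduced}
    (hp : S.IsReducedProducts circ bullet) : circ = h.circ ∧ bullet = h.bullet := by
  constructor
  · ext a b : 2
    induction a using h.reduced_induction with
    | add x y hx hy => rw [map_add, map_add, LinearMap.add_apply, LinearMap.add_apply, hx, hy]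
    | hom p _ a ha =>
    induction b using h.reduced_induction with
    | add x y hx hy => rw [map_add, map_add, hx, hy]
    | hom q _ b hb =>
    by_cases hk : p + q - 2 = 0
    · rw [hp.circ_zero p q a b ha hb hk, h.isReducedProducts.circ_zero p q a b ha hb hk]
    · obtain ⟨z, hz, hz'⟩ := hp.circ_eq p q a b ha hb hk
      obtain ⟨w, hw, hw'⟩ := h.isReducedProducts.circ_eq p q a b ha hb hk
      rw [hz', hw', Subtype.ext ((h.eq_zeroPart hz).trans (h.eq_zeroPart hw).symm)]
  · ext a b : 2
    exact Subtype.ext (h.eq_zeroPart (hp.bullet_eq a b))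

end ConformalSuperalgebra

/-! ### The identities for the products on the reduced subspace -/

namespace ConformalSuperalgebra

variable {R : Type*} [AddCommGroup R] [Module ℂ R] {S : ConformalSuperalgebra R}

lemma IsPhysical.zeroPart_prod_zero_right (h : S.IsPhysical) (a : S.reduced) (x : R) :
    h.zeroPart (S.prod 0 (a : R) x) = h.bullet a (h.zeroPart x) := by
  obtain ⟨y, hy⟩ := h.exists_eq_zeroPart_add_D x
  conv_lhs => rw [hy]
  rw [map_add, prod_zero_D_right, map_add, h.zeroPart_D, add_zero, bullet_apply]

lemma IsPhysical.zeroPart_prod_zero_left (h : S.IsPhysical) (x : R) (b : S.reduced) :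
    h.zeroPart (S.prod 0 x b) = h.bullet (h.zeroPart x) b := by
  obtain ⟨y, hy⟩ := h.exists_eq_zeroPart_add_D x
  conv_lhs => rw [hy]
  rw [map_add, LinearMap.add_apply, prod_zero_D_left, add_zero, bullet_apply]

lemma IsPhysical.prod_one_eq_zeroPart (h : S.IsPhysical) {p q : ℂ} {a b : S.reduced}
    (ha : a ∈ S.redWt p) (hb : b ∈ S.redWt q) :
    h.zeroPart (S.prod 1 (a : R) b) = (p + q - 2) • h.circ a b := by
  rw [h.prod_one_eq ha hb, map_smul, h.zeroPart_coe]

/-- The `0`-part of `a_(1) (b_(0) c)`. -/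
lemma IsPhysical.zeroPart_prod_one_prod_zero (h : S.IsPhysical) {p q r : ℂ} {a b c : S.reduced}
    (ha : a ∈ S.redWt p) (hb : b ∈ S.redWt q) (hc : c ∈ S.redWt r) :
    h.zeroPart (S.prod 1 (a : R) (S.prod 0 (b : R) c)) =
      (p + q + r - 3) • h.circ a (h.bullet b c) + (q - 1) • h.bullet a (h.circ b c) := by
  rw [h.prod_zero_eq hb hc, map_add, map_smul, prod_one_D_right, map_add, map_smul, map_add,
    h.zeroPart_D, zero_add, ← bullet_apply,
    h.prod_one_eq_zeroPart ha (h.hasProductWeights.bullet q r b c hb hc)]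
  ring_nf

/-- The `0`-part of `(a_(0) b)_(1) c`. -/
lemma IsPhysical.zeroPart_prod_one_prod_zero_left (h : S.IsPhysical) {p q r : ℂ}
    {a b c : S.reduced} (ha : a ∈ S.redWt p) (hb : b ∈ S.redWt q) (hc : c ∈ S.redWt r) :
    h.zeroPart (S.prod 1 (S.prod 0 (a : R) b) (c : R)) =
      (p + q + r - 3) • h.circ (h.bullet a b) c - (p - 1) • h.bullet (h.circ a b) c := by
  rw [h.prod_zero_eq ha hb, map_add, map_smul, LinearMap.add_apply, LinearMap.smul_apply,
    prod_one_D_left, map_add, map_smul, map_neg, ← bullet_apply,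
    h.prod_one_eq_zeroPart (h.hasProductWeights.bullet p q a b ha hb) hc]
  ring_nf
  module

/-- The coefficient of `λ` in the Jacobi identity of the `λ`-bracket of reduced vectors. -/
lemma IsPhysical.jacobi_lambda (h : S.IsPhysical) {p q r : ℂ} {i j : ZMod 2} {a b c : S.reduced}
    (hai : a ∈ S.redPar i) (hbj : b ∈ S.redPar j)
    (ha : a ∈ S.redWt p) (hb : b ∈ S.redWt q) (hc : c ∈ S.redWt r) :
    (p + q + r - 3) • h.circ a (h.bullet b c) + (q - 1) • h.bullet a (h.circ b c) =
      (p + q + r - 3) • h.circ (h.bullet a b) c + (q - 1) • h.bullet (h.circ a b) c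
        + superSign i j • (p + r - 2) • h.bullet b (h.circ a c) := by
  have := S.c3 1 0 i j a b c hai hbj
  simp only [Finset.sum_range_succ, Finset.sum_range_zero, Nat.choose_zero_right,
    Nat.choose_one_right, Nat.cast_one, one_smul, zero_add, tsub_zero, tsub_self] at this
  have := congrArg h.zeroPart this
  rw [h.zeroPart_prod_one_prod_zero ha hb hc] at this
  rw [this, map_add, map_add, map_smul, h.zeroPart_prod_one_prod_zero_left ha hb hc,
    h.zeroPart_prod_zero_right, h.zeroPart_prod_zero_left, h.prod_one_eq_zeroPart ha hb,
    h.prod_one_eq_zeroPart ha hc]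
  simp only [map_smul, LinearMap.smul_apply]
  module

/-- The coefficient of `μ` in the Jacobi identity of the `λ`-bracket of reduced vectors. -/
lemma IsPhysical.jacobi_mu (h : S.IsPhysical) {p q r : ℂ} {i j : ZMod 2} {a b c : S.reduced}
    (hai : a ∈ S.redPar i) (hbj : b ∈ S.redPar j)
    (ha : a ∈ S.redWt p) (hb : b ∈ S.redWt q) (hc : c ∈ S.redWt r) :
    (q + r - 2) • h.bullet a (h.circ b c) =
      (p + q + r - 3) • h.circ (h.bullet a b) c - (p - 1) • h.bullet (h.circ a b) c
        + superSign i j • ((p + q + r - 3) • h.circ b (h.bullet a c)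
          + (p - 1) • h.bullet b (h.circ a c)) := by
  have := S.c3 0 1 i j a b c hai hbj
  simp only [Finset.sum_range_succ, Finset.sum_range_zero, Nat.choose_zero_right,
    Nat.cast_one, one_smul, zero_add, tsub_zero, add_zero] at this
  have := congrArg h.zeroPart this
  rw [map_add, map_smul, h.zeroPart_prod_one_prod_zero_left ha hb hc,
    h.zeroPart_prod_one_prod_zero hb ha hc,
    h.zeroPart_prod_zero_right, h.prod_one_eq_zeroPart hb hc] at this
  rw [map_smul] at this
  rw [this, add_comm q p]

/-- The coefficient of `λμ` in the Jacobi identity of the `λ`-bracket of reduced vectors. -/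
lemma IsPhysical.jacobi_lambda_mu (h : S.IsPhysical) {p q r : ℂ} {i j : ZMod 2} {a b c : S.reduced}
    (hai : a ∈ S.redPar i) (hbj : b ∈ S.redPar j)
    (ha : a ∈ S.redWt p) (hb : b ∈ S.redWt q) (hc : c ∈ S.redWt r) :
    (p + q + r - 4) • (q + r - 2) • h.circ a (h.circ b c) =
      (p + q + r - 4) • (q - p) • h.circ (h.circ a b) c
        + (p + q + r - 4) • superSign i j • (p + r - 2) • h.circ b (h.circ a c) := by
  have := S.c3 1 1 i j a b c hai hbj
  have hw := h.hasProductWeights.circ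
  simp only [Finset.sum_range_succ, Finset.sum_range_zero, Nat.choose_zero_right,
    Nat.choose_one_right, Nat.cast_one, one_smul, zero_add, tsub_zero, Nat.reduceAdd,
    Nat.reduceSub] at this
  rw [h.prod_zero_eq ha hb, map_add, LinearMap.add_apply, h.prod_eq_zero _ _ le_rfl, zero_add,
    map_smul, LinearMap.smul_apply, prod_D_left, Nat.add_one_sub_one, h.prod_one_eq hb hc,
    h.prod_one_eq ha hb, h.prod_one_eq ha hc] at this
  simp only [map_smul, LinearMap.smul_apply] at this
  rw [h.prod_one_eq ha (hw q r b c hb hc), h.prod_one_eq hb (hw p r a c ha hc),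
    h.prod_one_eq (hw p q a b ha hb) hc] at this
  ext
  simp only [Submodule.coe_add, Submodule.coe_smul]
  push_cast at this
  linear_combination (norm := module) this

lemma IsPhysical.wtInv_mem_par (h : S.IsPhysical) {i : ZMod 2} {x : R} (hx : x ∈ S.par i) :
    h.wtInv x ∈ S.par i := by
  have hH : ∀ (j : ZMod 2) (y : R), y ∈ S.par j → S.prod 1 S.L y ∈ S.par j := fun j y hy => by
    simpa using S.prod_par 1 0 j S.L y S.L_even hy
  obtain ⟨y, hy, z, hz, hyz⟩ := S.par_grading.exists_eq_add (h.wtInv x)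
  have hx' : x = S.prod 1 S.L y + S.prod 1 S.L z := by rw [← map_add, ← hyz, h.L_one_wtInv]
  have hinj : ∀ w, S.prod 1 S.L w = 0 → w = 0 := fun w hw =>
    h.L_one_bijective.1 (by rw [hw, map_zero])
  rw [hyz]
  fin_cases i
  · rw [hinj z (S.par_grading.eq_zero ?_ (hH 1 z hz)), add_zero]
    · exact hy
    · rw [← sub_eq_of_eq_add' hx']
      exact sub_mem hx (hH 0 y hy)
  · rw [hinj y (S.par_grading.eq_zero (hH 0 y hy) ?_), zero_add]
    · exact hz
    · rw [← sub_eq_of_eq_add hx']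
      exact sub_mem hx (hH 1 z hz)

lemma IsPhysical.zeroPart_mem_redPar (h : S.IsPhysical) {i : ZMod 2} {x : R} (hx : x ∈ S.par i) :
    h.zeroPart x ∈ S.redPar i := by
  obtain ⟨w, hw⟩ := h.exists_eq_zeroPart_add_D x
  obtain ⟨y₀, hy₀, y₁, hy₁, hy⟩ := h.redPar_grading.exists_eq_add (h.zeroPart x)
  obtain ⟨w₀, hw₀, w₁, hw₁, rfl⟩ := S.par_grading.exists_eq_add w
  have hx' : x = ((y₀ : R) + S.D w₀) + (y₁ + S.D w₁) := by
    conv_lhs => rw [hw, hy, map_add, Submodule.coe_add]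
    abel
  have h0 : (y₀ : R) + S.D w₀ ∈ S.par 0 := add_mem hy₀ (S.D_par 0 _ hw₀)
  have h1 : (y₁ : R) + S.D w₁ ∈ S.par 1 := add_mem hy₁ (S.D_par 1 _ hw₁)
  have hz : ∀ (y : S.reduced) (w : R), (y : R) + S.D w = 0 → y = 0 := fun y w hyw => by
    have := congrArg h.zeroPart hyw
    rwa [map_add, h.zeroPart_coe, h.zeroPart_D, add_zero, map_zero] at this
  rw [hy]
  fin_cases i
  · rw [hz y₁ w₁ (S.par_grading.eq_zero ?_ h1), add_zero]
    · exact hy₀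
    · rw [← sub_eq_of_eq_add' hx']
      exact sub_mem hx h0
  · rw [hz y₀ w₀ (S.par_grading.eq_zero h0 ?_), zero_add]
    · exact hy₁
    · rw [← sub_eq_of_eq_add hx']
      exact sub_mem hx h1

lemma IsPhysical.isLieSuperalgebra (h : S.IsPhysical) : IsLieSuperalgebra S.redPar h.bullet where
  grading i j a b ha hb := h.zeroPart_mem_redPar (S.prod_par 0 i j a b ha hb)
  skew i j a b ha hb := by
    rw [h.bullet_apply, prod_zero_of_skew (mem_redPar.1 ha) (mem_redPar.1 hb)
      (fun n hn => h.prod_eq_zero b a hn), map_smul, map_sub, h.zeroPart_D, zero_sub, smul_neg]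
    rfl
  jacobi i j a b c ha hb := by
    have := S.c3 0 0 i j a b c ha hb
    simp only [Finset.sum_range_succ, Finset.sum_range_zero, Nat.choose_zero_right,
      Nat.cast_one, one_smul, zero_add, tsub_zero] at this
    have := congrArg h.zeroPart this
    rw [map_add, map_smul, h.zeroPart_prod_zero_right a (S.prod 0 (b : R) c),
      h.zeroPart_prod_zero_right b (S.prod 0 (a : R) c),
      h.zeroPart_prod_zero_left (S.prod 0 (a : R) b) c] at this
    exact this

lemma IsPhysical.L_circ (h : S.IsPhysical) : h.circ ⟨S.L, h.L_mem_reduced⟩ = LinearMap.id := by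
  ext x : 1
  induction x using h.reduced_induction with
  | add x y hx hy => rw [map_add, hx, hy, map_add]
  | hom k hk x hx =>
    ext
    rw [h.circ_eq (mem_redWt.2 S.L_mem_wt) hx, S.mem_wt.1 (mem_redWt.1 hx), smul_smul,
      add_sub_cancel_left, inv_mul_cancel₀ hk.ne_zero, one_smul, LinearMap.id_apply]

lemma IsPhysical.L_bullet (h : S.IsPhysical) : h.bullet ⟨S.L, h.L_mem_reduced⟩ = 0 := by
  ext x : 1
  rw [h.bullet_apply, S.L_zero, h.zeroPart_D, LinearMap.zero_apply]

lemma IsPhysical.circ_comm (h : S.IsPhysical) {i j : ZMod 2} {a b : S.reduced}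
    (ha : a ∈ S.redPar i) (hb : b ∈ S.redPar j) :
    h.circ a b = superSign i j • h.circ b a := by
  rw [h.circ_apply, prod_one_of_skew (mem_redPar.1 ha) (mem_redPar.1 hb)
    (fun n hn => h.prod_eq_zero b a hn), map_smul, map_smul]
  rfl

lemma IsPhysical.circ_L (h : S.IsPhysical) (x : S.reduced) :
    h.circ x ⟨S.L, h.L_mem_reduced⟩ = x := by
  obtain ⟨y, hy, z, hz, rfl⟩ := h.redPar_grading.exists_eq_add x
  rw [map_add, LinearMap.add_apply, h.circ_comm hy (mem_redPar.2 S.L_even),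
    h.circ_comm hz (mem_redPar.2 S.L_even), L_circ]
  simp [superSign_zero_right]

lemma IsPhysical.redWt_eq_bot_of_re_le (h : S.IsPhysical) {k : ℂ} (hk : k.re ≤ 0)
    {x : S.reduced} (hx : x ∈ S.redWt k) : x = 0 :=
  Subtype.ext (h.eq_zero_of_mem_wt hk hx)

/-- The product `∘` is associative.  By weights, only the case of vectors `L` and of three vectors
of weight `3/2` has to be considered.  In the latter, `u ∘ (v ∘ w)` is skew-symmetric in all three
vectors by the coefficient of `λμ` in the Jacobi identity. -/
lemma IsPhysical.circ_assoc (h : S.IsPhysical) (a b c : S.reduced) :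
    h.circ (h.circ a b) c = h.circ a (h.circ b c) := by
  have hw := h.hasProductWeights.circ
  induction a using h.reduced_induction with
  | add x y hx hy => simp only [map_add, LinearMap.add_apply, hx, hy]
  | hom p hp a ha =>
  induction b using h.reduced_induction with
  | add x y hx hy => simp only [map_add, LinearMap.add_apply, hx, hy]
  | hom q hq b hb =>
  induction c using h.reduced_induction with
  | add x y hx hy => simp only [map_add, hx, hy]
  | hom r hr c hc =>
  rcases hp.eq_two_or_re_le with rfl | hp'
  · obtain ⟨t, rfl⟩ := h.exists_smul_L ha
    simp only [map_smul, LinearMap.smul_apply, L_circ, LinearMap.id_apply]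
  rcases hq.eq_two_or_re_le with rfl | hq'
  · obtain ⟨t, rfl⟩ := h.exists_smul_L hb
    simp only [map_smul, LinearMap.smul_apply, L_circ, circ_L, LinearMap.id_apply]
  rcases hr.eq_two_or_re_le with rfl | hr'
  · obtain ⟨t, rfl⟩ := h.exists_smul_L hc
    simp only [map_smul, circ_L]
  have hsmall : (p + q + r).re ≤ 4 → h.circ (h.circ a b) c = h.circ a (h.circ b c) := by
    intro hs
    rw [h.redWt_eq_bot_of_re_le ?_ (hw _ _ _ _ (hw _ _ _ _ ha hb) hc),
      h.redWt_eq_bot_of_re_le ?_ (hw _ _ _ _ ha (hw _ _ _ _ hb hc))]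
    all_goals
      simp at hs ⊢
      linarith
  have hone : ∀ {k : ℂ}, IsPhysWeight k → k.re ≤ 3 / 2 → k ≠ 3 / 2 → k.re ≤ 1 := by
    rintro k (rfl | rfl | rfl | rfl) hk hk'
    · norm_num at hk
    · exact absurd rfl hk'
    all_goals norm_num
  by_cases hp3 : p = 3 / 2
  swap
  · exact hsmall (by have := hone hp hp' hp3; simp; linarith)
  by_cases hq3 : q = 3 / 2
  swap
  · exact hsmall (by have := hone hq hq' hq3; simp; linarith)
  by_cases hr3 : r = 3 / 2
  swap
  · exact hsmall (by have := hone hr hr' hr3; simp; linarith)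
  subst hp3 hq3 hr3
  have hV : ∀ {x : S.reduced}, x ∈ S.redWt (3 / 2) → x ∈ S.redPar 1 :=
    fun hx => h.wt_three_half_le hx
  have hskew : ∀ x y z : S.reduced, x ∈ S.redWt (3 / 2) → y ∈ S.redWt (3 / 2) →
      z ∈ S.redWt (3 / 2) → h.circ x (h.circ y z) = -h.circ y (h.circ x z) := by
    intro x y z hx hy hz
    have := h.jacobi_lambda_mu (hV hx) (hV hy) hx hy hz
    rw [superSign_one_one] at this
    linear_combination (norm := module) (2 : ℂ) • this
  have hcomm : ∀ x y : S.reduced, x ∈ S.redWt (3 / 2) → y ∈ S.redWt (3 / 2) →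
      h.circ x y = -h.circ y x := by
    intro x y hx hy
    rw [h.circ_comm (hV hx) (hV hy), superSign_one_one, neg_one_smul]
  have hab : h.circ a b ∈ S.redPar 0 := by
    refine h.wt_one_le ?_
    have := hw _ _ _ _ ha hb
    norm_num at this
    exact this
  rw [h.circ_comm hab (hV hc), superSign_zero_left, one_smul, hcomm a b ha hb, map_neg,
    hskew c b a hc hb ha, neg_neg, hcomm c a hc ha, map_neg, hskew a b c ha hb hc]

lemma IsPhysical.isCommSuperalgebra (h : S.IsPhysical) : IsCommSuperalgebra S.redPar h.circ where
  grading i j a b ha hb :=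
    h.zeroPart_mem_redPar (h.wtInv_mem_par (S.prod_par 1 i j a b ha hb))
  comm _ _ _ _ ha hb := h.circ_comm ha hb
  assoc := h.circ_assoc

/-- Even reduced vectors of weight `1` act as derivations of the product `∘`: this is the
coefficient of `μ` in the Jacobi identity. -/
lemma IsPhysical.bullet_circ (h : S.IsPhysical) {a : S.reduced} (ha : a ∈ S.redWt 1)
    (x y : S.reduced) :
    h.bullet a (h.circ x y) = h.circ (h.bullet a x) y + h.circ x (h.bullet a y) := by
  have hw := h.hasProductWeights
  induction x using h.reduced_induction with
  | add x y hx hy => simp only [map_add, LinearMap.add_apply, hx, hy]; abel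
  | hom q hq x hx =>
  induction y using h.reduced_induction with
  | add x y hx hy => simp only [map_add, hx, hy]; abel
  | hom r hr y hy =>
  obtain ⟨j, hj⟩ := hq.par_le h
  by_cases hk : q + r - 2 = 0
  · have hk' : q + r = 2 := by linear_combination hk
    have h1 : h.bullet a (h.circ x y) = 0 := by
      refine h.redWt_eq_bot_of_re_le ?_ (hw.bullet _ _ _ _ ha (hw.circ _ _ _ _ hx hy))
      rw [hk']; norm_num
    have h2 : h.circ (h.bullet a x) y = 0 := by
      refine h.redWt_eq_bot_of_re_le ?_ (hw.circ _ _ _ _ (hw.bullet _ _ _ _ ha hx) hy)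
      rw [show 1 + q - 1 + r - 2 = 0 by linear_combination hk]; norm_num
    have h3 : h.circ x (h.bullet a y) = 0 := by
      refine h.redWt_eq_bot_of_re_le ?_ (hw.circ _ _ _ _ hx (hw.bullet _ _ _ _ ha hy))
      rw [show q + (1 + r - 1) - 2 = 0 by linear_combination hk]; norm_num
    rw [h1, h2, h3, add_zero]
  · have := h.jacobi_mu (i := 0) (h.wt_one_le ha) (hj hx) ha hx hy
    rw [superSign_zero_left] at this
    have h1 : (q + r - 2) • h.bullet a (h.circ x y) =
        (q + r - 2) • (h.circ (h.bullet a x) y + h.circ x (h.bullet a y)) := by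
      linear_combination (norm := module) this
    exact smul_right_injective _ hk h1

/-- A linear form which gives the coordinate of a reduced vector of weight `2` with respect to
`L`.  It is `0` if `L = 0`. -/
lemma IsPhysical.exists_L_coord (h : S.IsPhysical) :
    ∃ g : Module.Dual ℂ S.reduced, ∀ x ∈ S.redWt 2, x = g x • ⟨S.L, h.L_mem_reduced⟩ := by
  by_cases hL : (⟨S.L, h.L_mem_reduced⟩ : S.reduced) = 0
  · refine ⟨0, fun x hx => ?_⟩
    obtain ⟨c, rfl⟩ := h.exists_smul_L hx
    rw [hL, smul_zero, smul_zero]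
  · obtain ⟨g, hcoord⟩ := Module.Projective.exists_dual_eq_one ℂ hL
    refine ⟨g, fun x hx => ?_⟩
    obtain ⟨c, rfl⟩ := h.exists_smul_L hx
    rw [map_smul, hcoord, smul_eq_mul, mul_one]

/-- The products on the reduced subspace satisfy (H0)-(H6).  For (H4), (H5) and (H6), one takes the
coefficient of `λ` in the Jacobi identity for `u`, `v` of weight `3/2` and a third vector of weight
`1/2`, `3/2` and `1`; for the last two, `u = v`. -/
lemma IsPhysical.isHAlgebra (h : S.IsPhysical) :
    IsHAlgebra S.redPar S.redWt ⟨S.L, h.L_mem_reduced⟩ h.circ h.bullet where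
  h0 := ⟨h.L_circ, h.L_bullet⟩
  h1 := h.isLieSuperalgebra
  h2 := h.isCommSuperalgebra
  h3 a ha x y := h.bullet_circ ha x y
  h4 u hu v hv f hf := by
    have := h.jacobi_lambda (h.wt_three_half_le hu) (h.wt_three_half_le hv) hu hv hf
    have h0 : h.circ v f = 0 :=
      h.redWt_eq_bot_of_re_le (by norm_num) (h.hasProductWeights.circ _ _ _ _ hv hf)
    rw [h0, map_zero] at this
    linear_combination (norm := module) (2 : ℂ) • this
  h56 := by
    obtain ⟨g, hcoord⟩ := h.exists_L_coord
    have hw := h.hasProductWeights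
    have hV : ∀ {x : S.reduced}, x ∈ S.redWt (3 / 2) → x ∈ S.redPar 1 :=
      fun hx => h.wt_three_half_le hx
    have hform : ∀ u ∈ S.redWt (3 / 2), ∀ v ∈ S.redWt (3 / 2),
        h.bullet u v = g (h.bullet u v) • ⟨S.L, h.L_mem_reduced⟩ := by
      intro u hu v hv
      have := hw.bullet _ _ _ _ hu hv
      norm_num at this
      exact hcoord _ this
    have hcc : ∀ u ∈ S.redWt (3 / 2), h.circ u u = 0 := by
      intro u hu
      have := h.circ_comm (hV hu) (hV hu)
      rw [superSign_one_one] at this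
      linear_combination (norm := module) (1 / 2 : ℂ) • this
    have hbb : ∀ u ∈ S.redWt (3 / 2), ∀ x, h.bullet u (h.bullet u x) = 0 := by
      intro u hu x
      have := h.isLieSuperalgebra.jacobi 1 1 u u x (hV hu) (hV hu)
      rw [superSign_one_one, hform u hu u hu, map_smul, LinearMap.smul_apply, L_bullet,
        LinearMap.zero_apply, smul_zero] at this
      linear_combination (norm := module) (1 / 2 : ℂ) • this
    have hexp : ∀ u ∈ S.redWt (3 / 2), ∀ x, (h.circ u + h.bullet u) ((h.circ u + h.bullet u) x) =
        h.circ u (h.bullet u x) + h.bullet u (h.circ u x) := by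
      intro u hu x
      simp only [LinearMap.add_apply, map_add]
      rw [← h.circ_assoc, hcc u hu, hbb u hu, map_zero, LinearMap.zero_apply]
      abel
    refine ⟨(h.bullet.compl₁₂ (S.redWt (3 / 2)).subtype (S.redWt (3 / 2)).subtype).compr₂ g,
      fun u v => hform u u.2 v v.2, fun u v => ?_, fun u a ha => ?_⟩
    · have := h.jacobi_lambda (hV u.2) (hV u.2) u.2 u.2 v.2
      rw [hcc u u.2, superSign_one_one, hform u u.2 v v.2, hform u u.2 u u.2] at this
      simp only [map_smul, LinearMap.smul_apply, L_circ, circ_L, LinearMap.id_apply, map_zero,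
        LinearMap.zero_apply] at this
      rw [hexp u u.2, hform u u.2 v v.2, map_smul, circ_L]
      simp only [LinearMap.compr₂_apply, LinearMap.compl₁₂_apply, Submodule.subtype_apply]
      linear_combination (norm := module) (2 / 3 : ℂ) • this
    · have := h.jacobi_lambda (hV u.2) (hV u.2) u.2 u.2 ha
      rw [hcc u u.2, superSign_one_one, hform u u.2 u u.2] at this
      simp only [map_smul, LinearMap.smul_apply, L_circ, LinearMap.id_apply, map_zero,
        LinearMap.zero_apply] at this
      rw [hexp u u.2]
      simp only [LinearMap.compr₂_apply, LinearMap.compl₁₂_apply, Submodule.subtype_apply]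
      linear_combination (norm := module) this

end ConformalSuperalgebra

open ConformalSuperalgebra

/-! ### The linear part of the Jacobi identity for an algebra with (H0)-(H6) -/

section Algebra

variable {P : Type*} [AddCommGroup P] [Module ℂ P]

/-- The coefficients of `∂`, `λ` and `μ` in the Jacobi identity for the `λ`-bracket
`[a_λ b] = a • b + (p - 1) ∂(a ∘ b) + (p + q - 2) λ (a ∘ b)`, where `a`, `b`, `c` have the weights
`p`, `q`, `r`, and `a`, `b` have the parities `i`, `j`. -/
def LinearJacobi (circ bullet : P →ₗ[ℂ] P →ₗ[ℂ] P) (p q r : ℂ) (i j : ZMod 2) (a b c : P) : Prop :=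
  ((p - 1) • circ a (bullet b c) + (q - 1) • bullet a (circ b c) =
    (p + q - 2) • circ (bullet a b) c
      + superSign i j • ((q - 1) • circ b (bullet a c) + (p - 1) • bullet b (circ a c))) ∧
  ((p + q + r - 3) • circ a (bullet b c) + (q - 1) • bullet a (circ b c) =
    (p + q + r - 3) • circ (bullet a b) c + (q - 1) • bullet (circ a b) c
      + superSign i j • (p + r - 2) • bullet b (circ a c)) ∧
  ((q + r - 2) • bullet a (circ b c) =
    (p + q + r - 3) • circ (bullet a b) c - (p - 1) • bullet (circ a b) c
      + superSign i j • ((p + q + r - 3) • circ b (bullet a c)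
        + (p - 1) • bullet b (circ a c)))

variable {par : ZMod 2 → Submodule ℂ P} {W : ℂ → Submodule ℂ P} {L : P}
  {circ bullet : P →ₗ[ℂ] P →ₗ[ℂ] P} {p q r : ℂ} {i j k : ZMod 2} {a b c : P}

/-- Exchanging `a` and `b` exchanges the coefficients of `λ` and `μ`. -/
lemma LinearJacobi.swap (h1 : IsLieSuperalgebra par bullet) (h2 : IsCommSuperalgebra par circ)
    (ha : a ∈ par i) (hb : b ∈ par j) (h : LinearJacobi circ bullet p q r i j a b c) :
    LinearJacobi circ bullet q p r j i b a c := by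
  have hc := h2.comm j i b a hb ha
  have hs := h1.skew j i b a hb ha
  obtain ⟨hd, hl, hm⟩ := h
  rw [superSign_comm j i] at hc hs
  unfold LinearJacobi
  rw [superSign_comm j i, hc, hs]
  rcases superSign_eq_one_or i j with hε | hε <;> rw [hε] at hd hl hm ⊢ <;>
    simp only [map_smul, map_neg, LinearMap.smul_apply, LinearMap.neg_apply]
  · exact ⟨by linear_combination (norm := module) -hd, by linear_combination (norm := module) -hm,
      by linear_combination (norm := module) -hl⟩
  · exact ⟨by linear_combination (norm := module) hd, by linear_combination (norm := module) hm,
      by linear_combination (norm := module) hl⟩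

/-- Exchanging `b` and `c` amounts to the substitution `μ ↦ -λ - μ - ∂`. -/
lemma LinearJacobi.rotate (h1 : IsLieSuperalgebra par bullet) (h2 : IsCommSuperalgebra par circ)
    (ha : a ∈ par i) (hb : b ∈ par j) (hc : c ∈ par k)
    (h : LinearJacobi circ bullet p q r i j a b c) :
    LinearJacobi circ bullet p r q i k a c b := by
  have e1 := h2.comm k j c b hc hb
  have e2 := h1.skew k j c b hc hb
  have e3 := h1.skew _ _ _ _ (h2.grading i k a c ha hc) hb
  have e4 := h2.comm _ _ _ _ (h1.grading i k a c ha hc) hb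
  have e5 := h1.skew _ _ _ _ hc (h2.grading i j a b ha hb)
  have e6 := h2.comm _ _ _ _ hc (h1.grading i j a b ha hb)
  rw [superSign_add_left, superSign_comm k j] at e3 e4
  rw [superSign_comm, superSign_add_left] at e5 e6
  rw [superSign_comm k j] at e1 e2
  obtain ⟨hd, hl, hm⟩ := h
  unfold LinearJacobi
  rw [e1, e2, e3, e4, e5, e6]
  rcases superSign_eq_one_or i j with hij | hij <;>
  rcases superSign_eq_one_or j k with hjk | hjk <;>
  rcases superSign_eq_one_or i k with hik | hik <;>
  rw [hij] at hd hl hm ⊢ <;> rw [hjk] <;> rw [hik] <;>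
  simp only [map_smul, map_neg] <;>
  first
  | exact ⟨by linear_combination (norm := module) hm - hd,
      by linear_combination (norm := module) hm - hl,
      by linear_combination (norm := module) hm⟩
  | exact ⟨by linear_combination (norm := module) hd - hm,
      by linear_combination (norm := module) hl - hm,
      by linear_combination (norm := module) -hm⟩

lemma IsPhysicalGrading.isPhysWeight (hG : IsPhysicalGrading par W L) {k : ℂ} {x : P}
    (hx : x ∈ W k) (hx0 : x ≠ 0) : IsPhysWeight k := by
  by_contra hk
  simp only [IsPhysWeight, not_or] at hk
  rw [hG.weights k hk.1 hk.2.1 hk.2.2.1 hk.2.2.2] at hx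
  exact hx0 hx

lemma IsPhysicalGrading.eq_zero (hG : IsPhysicalGrading par W L) {k : ℂ} (hk : k.re ≤ 0) {x : P}
    (hx : x ∈ W k) : x = 0 := by
  by_contra hx0
  rcases hG.isPhysWeight hx hx0 with rfl | rfl | rfl | rfl <;> norm_num at hk

lemma IsPhysicalGrading.two_le (hG : IsPhysicalGrading par W L) : W 2 ≤ par 0 :=
  hG.even ▸ le_sup_left

lemma IsPhysicalGrading.one_le (hG : IsPhysicalGrading par W L) : W 1 ≤ par 0 :=
  hG.even ▸ le_sup_right

lemma IsPhysicalGrading.three_half_le (hG : IsPhysicalGrading par W L) : W (3 / 2) ≤ par 1 :=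
  hG.odd ▸ le_sup_left

lemma IsPhysicalGrading.half_le (hG : IsPhysicalGrading par W L) : W (1 / 2) ≤ par 1 :=
  hG.odd ▸ le_sup_right

lemma IsPhysicalGrading.L_mem (hG : IsPhysicalGrading par W L) : L ∈ W 2 :=
  hG.two ▸ Submodule.mem_span_singleton_self L

lemma IsPhysicalGrading.exists_smul_L (hG : IsPhysicalGrading par W L) {x : P} (hx : x ∈ W 2) :
    ∃ t : ℂ, x = t • L := by
  rw [hG.two] at hx
  obtain ⟨t, ht⟩ := Submodule.mem_span_singleton.1 hx
  exact ⟨t, ht.symm⟩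

lemma IsHAlgebra.circ_L (hG : IsPhysicalGrading par W L) (hH : IsHAlgebra par W L circ bullet)
    (x : P) : circ x L = x := by
  obtain ⟨y, hy, z, hz, rfl⟩ := hG.super.exists_eq_add x
  have hL := hG.two_le hG.L_mem
  rw [map_add, LinearMap.add_apply, hH.h2.comm 0 0 y L hy hL, hH.h2.comm 1 0 z L hz hL, hH.h0.1]
  simp [superSign_zero_right]

lemma IsHAlgebra.circ_odd (hH : IsHAlgebra par W L circ bullet) (ha : a ∈ par 1)
    (hb : b ∈ par 1) : circ a b = -circ b a := by
  rw [hH.h2.comm 1 1 a b ha hb, superSign_one_one, neg_one_smul]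

lemma IsHAlgebra.bullet_odd (hH : IsHAlgebra par W L circ bullet) (ha : a ∈ par 1)
    (hb : b ∈ par 1) : bullet a b = bullet b a := by
  rw [hH.h1.skew 1 1 a b ha hb, superSign_one_one, neg_one_smul, neg_neg]

lemma IsHAlgebra.circ_even (hH : IsHAlgebra par W L circ bullet) (ha : a ∈ par 0)
    (hb : b ∈ par i) : circ a b = circ b a := by
  rw [hH.h2.comm 0 i a b ha hb, superSign_zero_left, one_smul]

lemma IsHAlgebra.bullet_even (hH : IsHAlgebra par W L circ bullet) (ha : a ∈ par 0)
    (hb : b ∈ par i) : bullet a b = -bullet b a := by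
  rw [hH.h1.skew 0 i a b ha hb, superSign_zero_left, one_smul]

variable {u v w f : P}

lemma IsHAlgebra.bullet_eq_smul_L (hH : IsHAlgebra par W L circ bullet) (hu : u ∈ W (3 / 2))
    (hv : v ∈ W (3 / 2)) : ∃ t : ℂ, bullet u v = t • L := by
  obtain ⟨form, h, -⟩ := hH.h56
  exact ⟨form ⟨u, hu⟩ ⟨v, hv⟩, h ⟨u, hu⟩ ⟨v, hv⟩⟩

lemma IsHAlgebra.circ_bullet_comm (hG : IsPhysicalGrading par W L)
    (hH : IsHAlgebra par W L circ bullet) (hu : u ∈ W (3 / 2)) (hv : v ∈ W (3 / 2)) (x : P) :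
    circ x (bullet u v) = circ (bullet u v) x := by
  obtain ⟨t, ht⟩ := hH.bullet_eq_smul_L hu hv
  rw [ht, map_smul, hH.circ_L hG, map_smul, LinearMap.smul_apply, hH.h0.1, LinearMap.id_apply]

/-- The square of the operator `u∘ + u•`. -/
lemma IsHAlgebra.circ_add_bullet_sq (hG : IsPhysicalGrading par W L)
    (hH : IsHAlgebra par W L circ bullet) (hu : u ∈ W (3 / 2)) (x : P) :
    (circ u + bullet u) ((circ u + bullet u) x) =
      circ u (bullet u x) + bullet u (circ u x) := by
  have hu' := hG.three_half_le hu
  have hcc : circ u u = 0 := by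
    have := hH.circ_odd hu' hu'
    linear_combination (norm := module) (1 / 2 : ℂ) • this
  have hbb : bullet u (bullet u x) = 0 := by
    obtain ⟨t, ht⟩ := hH.bullet_eq_smul_L hu hu
    have := hH.h1.jacobi 1 1 u u x hu' hu'
    rw [superSign_one_one, ht, map_smul, LinearMap.smul_apply, hH.h0.2, LinearMap.zero_apply,
      smul_zero] at this
    linear_combination (norm := module) (1 / 2 : ℂ) • this
  simp only [LinearMap.add_apply, map_add]
  rw [← hH.h2.assoc, hcc, hbb, map_zero, LinearMap.zero_apply]
  abel

/-- The polarization of (H5). -/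
lemma IsHAlgebra.h5_polar (hG : IsPhysicalGrading par W L) (hH : IsHAlgebra par W L circ bullet)
    (hu : u ∈ W (3 / 2)) (hv : v ∈ W (3 / 2)) (hw : w ∈ W (3 / 2)) :
    bullet u (circ v w) + bullet v (circ u w) =
      (2 : ℂ) • circ (bullet u v) w - circ (bullet u w) v - circ (bullet v w) u := by
  have key : ∀ u ∈ W (3 / 2), bullet u (circ u w) =
      circ (bullet u u) w - circ (bullet u w) u := by
    intro u hu
    obtain ⟨form, h, h5, -⟩ := hH.h56
    have := h5 ⟨u, hu⟩ ⟨w, hw⟩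
    rw [hH.circ_add_bullet_sq hG hu, hH.circ_bullet_comm hG hu hw] at this
    have h' : circ (bullet u u) w = form ⟨u, hu⟩ ⟨u, hu⟩ • w := by
      rw [h ⟨u, hu⟩ ⟨u, hu⟩, map_smul, LinearMap.smul_apply, hH.h0.1, LinearMap.id_apply]
    rw [h']
    linear_combination (norm := module) this
  have h1 := key _ hu
  have h2 := key _ hv
  have h3 := key _ (add_mem hu hv)
  simp only [map_add, LinearMap.add_apply] at h3
  rw [hH.bullet_odd (hG.three_half_le hv) (hG.three_half_le hu)] at h3
  linear_combination (norm := module) h3 - h1 - h2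

/-- The polarization of (H6). -/
lemma IsHAlgebra.h6_polar (hG : IsPhysicalGrading par W L) (hH : IsHAlgebra par W L circ bullet)
    (hu : u ∈ W (3 / 2)) (hv : v ∈ W (3 / 2)) (ha : a ∈ W 1) :
    circ u (bullet v a) + circ v (bullet u a) + bullet u (circ v a) + bullet v (circ u a) =
      (2 : ℂ) • circ (bullet u v) a := by
  have key : ∀ u ∈ W (3 / 2), circ u (bullet u a) + bullet u (circ u a) =
      circ (bullet u u) a := by
    intro u hu
    obtain ⟨form, h, -, h6⟩ := hH.h56
    rw [← hH.circ_add_bullet_sq hG hu, h6 ⟨u, hu⟩ a ha, h ⟨u, hu⟩ ⟨u, hu⟩, map_smul,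
      LinearMap.smul_apply, hH.h0.1, LinearMap.id_apply]
  have h1 := key _ hu
  have h2 := key _ hv
  have h3 := key _ (add_mem hu hv)
  simp only [map_add, LinearMap.add_apply] at h3
  rw [hH.bullet_odd (hG.three_half_le hv) (hG.three_half_le hu)] at h3
  linear_combination (norm := module) h3 - h1 - h2

lemma IsHAlgebra.linearJacobi_L (hG : IsPhysicalGrading par W L)
    (hH : IsHAlgebra par W L circ bullet) (ha : a ∈ W 2) :
    LinearJacobi circ bullet 2 q r 0 j a b c := by
  obtain ⟨t, rfl⟩ := hG.exists_smul_L ha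
  unfold LinearJacobi
  simp only [map_smul, LinearMap.smul_apply, hH.h0.1, hH.h0.2, LinearMap.id_apply,
    LinearMap.zero_apply, map_zero, superSign_zero_left]
  exact ⟨by module, by module, by module⟩

/-- For weights `3/2`, `3/2`, `3/2` the linear Jacobi identity is the polarization of (H5). -/
lemma IsHAlgebra.linearJacobi_VVV (hG : IsPhysicalGrading par W L)
    (hH : IsHAlgebra par W L circ bullet) (hu : u ∈ W (3 / 2)) (hv : v ∈ W (3 / 2))
    (hw : w ∈ W (3 / 2)) (huv : circ u v ∈ W 1) :
    LinearJacobi circ bullet (3 / 2) (3 / 2) (3 / 2) 1 1 u v w := by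
  have ou := hG.three_half_le hu
  have ov := hG.three_half_le hv
  have ow := hG.three_half_le hw
  have e1 := hH.h5_polar hG hu hv hw
  have e2 := hH.h5_polar hG hv hw hu
  have e3 := hH.bullet_even (hG.one_le huv) ow
  rw [hH.circ_odd ow ou, hH.circ_odd ov ou, map_neg, map_neg, hH.bullet_odd ov ou,
    hH.bullet_odd ow ou] at e2
  unfold LinearJacobi
  rw [superSign_one_one, e3, hH.circ_bullet_comm hG hv hw, hH.circ_bullet_comm hG hu hw]
  exact ⟨by linear_combination (norm := module) (1 / 2 : ℂ) • e1,
    by linear_combination (norm := module) (1 / 2 : ℂ) • e1 - (1 / 2 : ℂ) • e2,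
    by linear_combination (norm := module) e1 + (1 / 2 : ℂ) • e2⟩

/-- For weights `3/2`, `3/2`, `1` the linear Jacobi identity follows from (H3) and the
polarization of (H6). -/
lemma IsHAlgebra.linearJacobi_VVA (hG : IsPhysicalGrading par W L)
    (hH : IsHAlgebra par W L circ bullet) (hu : u ∈ W (3 / 2)) (hv : v ∈ W (3 / 2))
    (ha : a ∈ W 1) (hua : bullet u a ∈ W (3 / 2)) :
    LinearJacobi circ bullet (3 / 2) (3 / 2) 1 1 1 u v a := by
  have ou := hG.three_half_le hu
  have ov := hG.three_half_le hv
  have e1 := hH.h6_polar hG hu hv ha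
  have e2 := hH.h3 a ha u v
  have e3 : bullet (circ u v) a = -bullet a (circ u v) := by
    rw [hH.bullet_even (hG.one_le ha) (hH.h2.grading 1 1 u v ou ov), neg_neg]
  rw [hH.bullet_even (hG.one_le ha) ou, hH.bullet_even (hG.one_le ha) ov, map_neg, map_neg,
    LinearMap.neg_apply, hH.circ_odd (hG.three_half_le hua) ov] at e2
  unfold LinearJacobi
  rw [superSign_one_one, e3, e2]
  exact ⟨by linear_combination (norm := module) (1 / 2 : ℂ) • e1,
    by linear_combination (norm := module) (1 / 2 : ℂ) • e1,
    by linear_combination (norm := module) (1 / 2 : ℂ) • e1⟩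

/-- For weights `3/2`, `3/2`, `1/2` the linear Jacobi identity is (H4) and (H4) with `u` and `v`
exchanged. -/
lemma IsHAlgebra.linearJacobi_VVF (hG : IsPhysicalGrading par W L)
    (hH : IsHAlgebra par W L circ bullet) (hu : u ∈ W (3 / 2)) (hv : v ∈ W (3 / 2))
    (hf : f ∈ W (1 / 2)) (huf : circ u f = 0) (hvf : circ v f = 0) :
    LinearJacobi circ bullet (3 / 2) (3 / 2) (1 / 2) 1 1 u v f := by
  have ou := hG.three_half_le hu
  have ov := hG.three_half_le hv
  have e1 := hH.h4 u hu v hv f hf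
  have e2 := hH.h4 v hv u hu f hf
  rw [hH.circ_odd ov ou, hH.bullet_odd ov ou, map_neg, LinearMap.neg_apply] at e2
  unfold LinearJacobi
  rw [superSign_one_one, huf, hvf, map_zero, map_zero]
  exact ⟨by linear_combination (norm := module) (1 / 2 : ℂ) • (e1 + e2),
    by linear_combination (norm := module) (1 / 2 : ℂ) • e1,
    by linear_combination (norm := module) (1 / 2 : ℂ) • e2⟩

/-- For weights `3/2`, `1`, `1` the linear Jacobi identity follows from (H3) for both vectors of
weight `1`. -/
lemma IsHAlgebra.linearJacobi_VAA (hG : IsPhysicalGrading par W L)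
    (hH : IsHAlgebra par W L circ bullet) (hu : u ∈ W (3 / 2)) (ha : a ∈ W 1)
    (hb : b ∈ W 1) (hab : circ a b = 0) :
    LinearJacobi circ bullet (3 / 2) 1 1 1 0 u a b := by
  have ou := hG.three_half_le hu
  have ea := hG.one_le ha
  have eb := hG.one_le hb
  have e1 := hH.h3 a ha u b
  have e2 := hH.h3 b hb u a
  have e3 : bullet (circ u a) b = -bullet b (circ u a) := by
    rw [hH.bullet_even eb (hH.h2.grading 1 0 u a ou ea), neg_neg]
  have e4 : circ (bullet u b) a = circ a (bullet u b) := by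
    rw [hH.circ_even ea (hH.h1.grading 1 0 u b ou eb)]
  rw [hH.bullet_even ea ou, map_neg, LinearMap.neg_apply] at e1
  rw [hH.bullet_even eb ou, map_neg, LinearMap.neg_apply, hH.bullet_even eb ea, map_neg, e4] at e2
  unfold LinearJacobi
  rw [superSign_zero_right, hab, map_zero, e3, e2]
  exact ⟨by linear_combination (norm := module) -(1 / 2 : ℂ) • e1,
    by linear_combination (norm := module) -(1 / 2 : ℂ) • e1,
    by linear_combination (norm := module) -(1 / 2 : ℂ) • e1⟩

/-- If the weights add up to at most `3`, all terms of the linear Jacobi identity have weight at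
most `0` and vanish. -/
lemma IsHAlgebra.linearJacobi_of_re_le (hG : IsPhysicalGrading par W L)
    (hW : HasProductWeights W circ bullet) (hs : (p + q + r).re ≤ 3)
    (ha : a ∈ W p) (hb : b ∈ W q) (hc : c ∈ W r) :
    LinearJacobi circ bullet p q r i j a b c := by
  have h0 : ∀ {k : ℂ} {x : P}, k = p + q + r - 3 → x ∈ W k → x = 0 := by
    rintro k x rfl hx
    refine hG.eq_zero ?_ hx
    simp at hs ⊢
    linarith
  unfold LinearJacobi
  rw [h0 (by ring) (hW.circ _ _ _ _ ha (hW.bullet _ _ _ _ hb hc)),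
    h0 (by ring) (hW.bullet _ _ _ _ ha (hW.circ _ _ _ _ hb hc)),
    h0 (by ring) (hW.circ _ _ _ _ (hW.bullet _ _ _ _ ha hb) hc),
    h0 (by ring) (hW.circ _ _ _ _ hb (hW.bullet _ _ _ _ ha hc)),
    h0 (by ring) (hW.bullet _ _ _ _ hb (hW.circ _ _ _ _ ha hc)),
    h0 (by ring) (hW.bullet _ _ _ _ (hW.circ _ _ _ _ ha hb) hc)]
  simp

lemma IsPhysicalGrading.weights_mem (hG : IsPhysicalGrading par W L) {x : P} {k : ℂ}
    (hk : IsPhysWeight k) (hx : x ∈ W k) {i : ZMod 2} (hi : x ∈ par i) (hx0 : x ≠ 0) :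
    (k = 2 ∧ i = 0) ∨ (k = 3 / 2 ∧ i = 1) ∨ (k = 1 ∧ i = 0) ∨ (k = 1 / 2 ∧ i = 1) := by
  have h01 : ∀ i : ZMod 2, i = 0 ∨ i = 1 := by decide
  rcases hk with rfl | rfl | rfl | rfl <;> rcases h01 i with rfl | rfl <;> simp
  · exact (hx0 (hG.super.eq_zero (hG.two_le hx) hi)).elim
  · exact (hx0 (hG.super.eq_zero hi (hG.three_half_le hx))).elim
  · exact (hx0 (hG.super.eq_zero (hG.one_le hx) hi)).elim
  · exact (hx0 (hG.super.eq_zero hi (hG.half_le hx))).elim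

lemma linearJacobi_of_eq_zero (h : a = 0 ∨ b = 0 ∨ c = 0) :
    LinearJacobi circ bullet p q r i j a b c := by
  unfold LinearJacobi
  rcases h with rfl | rfl | rfl <;> simp

lemma IsHAlgebra.linearJacobi_sorted (hG : IsPhysicalGrading par W L)
    (hW : HasProductWeights W circ bullet) (hH : IsHAlgebra par W L circ bullet)
    (hai : a ∈ par i) (hbj : b ∈ par j)
    (ha : a ∈ W p) (hb : b ∈ W q) (hc : c ∈ W r)
    (hqp : q.re ≤ p.re) (hrq : r.re ≤ q.re) :
    LinearJacobi circ bullet p q r i j a b c := by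
  by_cases ha0 : a = 0
  · exact linearJacobi_of_eq_zero (.inl ha0)
  by_cases hb0 : b = 0
  · exact linearJacobi_of_eq_zero (.inr (.inl hb0))
  by_cases hc0 : c = 0
  · exact linearJacobi_of_eq_zero (.inr (.inr hc0))
  have hV2 : ∀ {x y : P}, x ∈ W (3 / 2) → y ∈ W (1 / 2) → circ x y = 0 := fun hx hy =>
    hG.eq_zero (by norm_num) (hW.circ _ _ _ _ hx hy)
  rcases hG.weights_mem (hG.isPhysWeight ha ha0) ha hai ha0 with
    ⟨rfl, rfl⟩ | ⟨rfl, rfl⟩ | ⟨rfl, rfl⟩ | ⟨rfl, rfl⟩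
  · exact hH.linearJacobi_L hG ha
  · rcases hG.weights_mem (hG.isPhysWeight hb hb0) hb hbj hb0 with
      ⟨rfl, rfl⟩ | ⟨rfl, rfl⟩ | ⟨rfl, rfl⟩ | ⟨rfl, rfl⟩
    · norm_num at hqp
    · rcases hG.isPhysWeight hc hc0 with rfl | rfl | rfl | rfl
      · norm_num at hrq
      · refine hH.linearJacobi_VVV hG ha hb hc ?_
        have := hW.circ _ _ _ _ ha hb
        norm_num at this
        exact this
      · refine hH.linearJacobi_VVA hG ha hb hc ?_
        have := hW.bullet _ _ _ _ ha hc
        norm_num at this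
        exact this
      · exact hH.linearJacobi_VVF hG ha hb hc (hV2 ha hc) (hV2 hb hc)
    · rcases hG.isPhysWeight hc hc0 with rfl | rfl | rfl | rfl
      · norm_num at hrq
      · norm_num at hrq
      · exact hH.linearJacobi_VAA hG ha hb hc (hG.eq_zero (by norm_num) (hW.circ _ _ _ _ hb hc))
      · exact IsHAlgebra.linearJacobi_of_re_le hG hW (by norm_num) ha hb hc
    · refine IsHAlgebra.linearJacobi_of_re_le hG hW ?_ ha hb hc
      simp at hrq ⊢
      linarith
  · refine IsHAlgebra.linearJacobi_of_re_le hG hW ?_ ha hb hc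
    simp at hqp hrq ⊢
    linarith
  · refine IsHAlgebra.linearJacobi_of_re_le hG hW ?_ ha hb hc
    simp at hqp hrq ⊢
    linarith

/-- The linear part of the Jacobi identity: as it is invariant under permutations of the three
vectors, one may assume that their weights decrease. -/
lemma IsHAlgebra.linearJacobi (hG : IsPhysicalGrading par W L)
    (hW : HasProductWeights W circ bullet) (hH : IsHAlgebra par W L circ bullet)
    (hai : a ∈ par i) (hbj : b ∈ par j) (hck : c ∈ par k)
    (ha : a ∈ W p) (hb : b ∈ W q) (hc : c ∈ W r) :
    LinearJacobi circ bullet p q r i j a b c := by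
  have key : ∀ {p q r : ℂ} {i j k : ZMod 2} {a b c : P}, a ∈ par i → b ∈ par j → c ∈ par k →
      a ∈ W p → b ∈ W q → c ∈ W r → q.re ≤ p.re →
      LinearJacobi circ bullet p q r i j a b c := by
    intro p q r i j k a b c hai hbj hck ha hb hc hqp
    rcases le_total r.re q.re with hrq | hqr
    · exact hH.linearJacobi_sorted hG hW hai hbj ha hb hc hqp hrq
    rcases le_total r.re p.re with hrp | hpr
    · exact (hH.linearJacobi_sorted hG hW hai hck ha hc hb hrp hqr).rotate hH.h1 hH.h2
        hai hck hbj
    · exact ((hH.linearJacobi_sorted hG hW hck hai hc ha hb hpr hqp).swap hH.h1 hH.h2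
        hck hai).rotate hH.h1 hH.h2 hai hck hbj
  rcases le_total q.re p.re with hqp | hpq
  · exact key hai hbj hck ha hb hc hqp
  · exact (key hbj hai hck hb ha hc hpq).swap hH.h1 hH.h2 hbj hai

end Algebra

/-! ### Sesquilinear products -/

lemma finsum_eq_sum_range {A : Type*} [AddCommMonoid A] {N : ℕ} {h : ℕ → A}
    (hh : ∀ n, N ≤ n → h n = 0) :
    ∑ᶠ k, h k = ∑ k ∈ Finset.range N, h k := by
  refine finsum_eq_sum_of_support_subset _ fun k hk => ?_
  simp only [Finset.coe_range, Set.mem_Iio]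
  by_contra hlt
  exact hk (hh k (not_lt.1 hlt))

section Sesquilinear

variable {R : Type*} [AddCommGroup R] [Module ℂ R]

/-- Products `M n a b = a_(n) b` on a space with an operator `D`, for which almost all `a_(n) b`
vanish and which are sesquilinear: `[∂a_λ b] = -λ [a_λ b]` and `[a_λ ∂b] = (∂ + λ) [a_λ b]`. -/
structure IsSesquilinear (D : Module.End ℂ R) (M : ℕ → R →ₗ[ℂ] R →ₗ[ℂ] R) : Prop where
  eventually_zero : ∀ a b, ∃ N, ∀ n, N ≤ n → M n a b = 0
  left : ∀ n a b, M n (D a) b = -(n : ℂ) • M (n - 1) a b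
  right : ∀ n a b, M n a (D b) = D (M n a b) + (n : ℂ) • M (n - 1) a b

/-- The right-hand side of the skew-symmetry of conformal superalgebras, without the sign: the
coefficients of `-f(-λ - ∂)`, where `f` is a polynomial in `λ` with the coefficients `f n / n!`. -/
noncomputable def skewSeq (D : Module.End ℂ R) (f : ℕ → R) (n : ℕ) : R :=
  ∑ᶠ k : ℕ, (-1 : ℂ) ^ (k + n + 1) • divPow D k (f (n + k))

variable {D : Module.End ℂ R} {M : ℕ → R →ₗ[ℂ] R →ₗ[ℂ] R} {f g : ℕ → R} {N : ℕ}

lemma skewSeq_eq (hf : ∀ n, N ≤ n → f n = 0) (n : ℕ) :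
    skewSeq D f n =
      ∑ k ∈ Finset.range N, (-1 : ℂ) ^ (k + n + 1) • divPow D k (f (n + k)) :=
  finsum_eq_sum_range fun k hk => by rw [hf (n + k) (by omega), map_zero, smul_zero]

lemma divPow_D (k : ℕ) (x : R) : divPow D k (D x) = ((k : ℂ) + 1) • divPow D (k + 1) x := by
  have h1 : ((k ! : ℂ)) ≠ 0 := by exact_mod_cast k.factorial_ne_zero
  have h2 : ((k : ℂ) + 1) ≠ 0 := Nat.cast_add_one_ne_zero k
  simp only [divPow, LinearMap.smul_apply, pow_succ, Module.End.mul_apply, smul_smul,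
    Nat.factorial_succ]
  congr 1
  push_cast
  field_simp

lemma D_divPow (k : ℕ) (x : R) : D (divPow D k x) = ((k : ℂ) + 1) • divPow D (k + 1) x := by
  rw [← divPow_D, divPow, LinearMap.smul_apply, LinearMap.smul_apply, map_smul,
    ← Module.End.mul_apply, ← Module.End.mul_apply, ← pow_succ, ← pow_succ']

/-- The sums which occur when `∂` is moved from one argument to the other. -/
lemma sum_telescope (hf : ∀ n, N ≤ n → f n = 0) (n : ℕ) :
    ∑ k ∈ Finset.range (N + 1),
      (-1 : ℂ) ^ (k + n + 1) • ((k : ℂ) + 1) • divPow D (k + 1) (f (n + k)) =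
    -∑ k ∈ Finset.range (N + 1), (-1 : ℂ) ^ (k + n + 1) • (k : ℂ) • divPow D k (f (n + k - 1)) := by
  have h := Finset.sum_range_sub'
    (fun k : ℕ => (-1 : ℂ) ^ (k + n + 1) • (k : ℂ) • divPow D k (f (n + k - 1))) (N + 1)
  rw [hf (n + (N + 1) - 1) (by omega), Finset.sum_sub_distrib] at h
  simp only [map_zero, smul_zero, Nat.cast_zero, zero_smul, sub_zero] at h
  rw [sub_eq_zero.1 h, ← Finset.sum_neg_distrib]
  refine Finset.sum_congr rfl fun k _ => ?_
  rw [show n + (k + 1) - 1 = n + k by omega]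
  push_cast
  rw [show k + 1 + n + 1 = (k + n + 1) + 1 by ring, pow_succ]
  module

lemma smul_skewSeq_pred (hf : ∀ n, N ≤ n → f n = 0) (n : ℕ) :
    ∑ k ∈ Finset.range (N + 1), (-1 : ℂ) ^ (k + n + 1) • (n : ℂ) • divPow D k (f (n + k - 1)) =
      -(n : ℂ) • skewSeq D f (n - 1) := by
  cases n with
  | zero => simp
  | succ n =>
    rw [skewSeq_eq (fun k hk => hf k ((Nat.le_succ N).trans hk)), Finset.smul_sum]
    refine Finset.sum_congr rfl fun k _ => ?_
    rw [show n + 1 + k - 1 = n + k by omega, Nat.add_sub_cancel,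
      show k + (n + 1) + 1 = (k + n + 1) + 1 by ring, pow_succ]
    module

lemma skewSeq_right (hf : ∀ n, N ≤ n → f n = 0) (n : ℕ) :
    skewSeq D (fun j => D (f j) + (j : ℂ) • f (j - 1)) n = -(n : ℂ) • skewSeq D f (n - 1) := by
  rw [skewSeq_eq (N := N + 1), ← smul_skewSeq_pred hf]
  · have := sum_telescope (D := D) hf n
    simp only [map_add, map_smul, smul_add, divPow_D, Finset.sum_add_distrib]
    rw [this, neg_add_eq_sub, ← Finset.sum_sub_distrib]
    refine Finset.sum_congr rfl fun k _ => ?_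
    push_cast
    module
  · intro k hk
    simp [hf k (by omega), hf (k - 1) (by omega)]

lemma skewSeq_left (hf : ∀ n, N ≤ n → f n = 0) (n : ℕ) :
    skewSeq D (fun j => -(j : ℂ) • f (j - 1)) n =
      D (skewSeq D f n) + (n : ℂ) • skewSeq D f (n - 1) := by
  have h1 := smul_skewSeq_pred (D := D) hf n
  have h2 := sum_telescope (D := D) hf n
  have h3 : D (skewSeq D f n) = ∑ k ∈ Finset.range (N + 1),
      (-1 : ℂ) ^ (k + n + 1) • ((k : ℂ) + 1) • divPow D (k + 1) (f (n + k)) := by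
    rw [skewSeq_eq (fun k hk => hf k ((Nat.le_succ N).trans hk)), map_sum]
    simp only [map_smul, D_divPow]
  have h4 : (n : ℂ) • skewSeq D f (n - 1) = -∑ k ∈ Finset.range (N + 1),
      (-1 : ℂ) ^ (k + n + 1) • (n : ℂ) • divPow D k (f (n + k - 1)) := by
    rw [h1, neg_smul, neg_neg]
  rw [h3, h2, h4, skewSeq_eq (N := N + 1), ← Finset.sum_neg_distrib, ← Finset.sum_neg_distrib,
    ← Finset.sum_add_distrib]
  · refine Finset.sum_congr rfl fun k _ => ?_
    rw [map_smul]
    push_cast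
    module
  · intro k hk
    simp [hf (k - 1) (by omega)]

/-- Skew-symmetry for two vectors, with the sign `ε`. -/
def SkewAt (D : Module.End ℂ R) (M : ℕ → R →ₗ[ℂ] R →ₗ[ℂ] R) (ε : ℂ) (a b : R) : Prop :=
  ∀ n, M n a b = ε • skewSeq D (fun k => M k b a) n

/-- The Jacobi identity for three vectors, with the sign `ε`. -/
def JacobiAt (M : ℕ → R →ₗ[ℂ] R →ₗ[ℂ] R) (ε : ℂ) (a b c : R) : Prop :=
  ∀ m n, M m a (M n b c) =
    ∑ k ∈ Finset.range (m + 1), (m.choose k : ℂ) • M (n + m - k) (M k a b) c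
      + ε • M n b (M m a c)

variable {ε : ℂ} {a b c a' b' c' : R}

lemma JacobiAt.add_left (h : JacobiAt M ε a b c) (h' : JacobiAt M ε a' b c) :
    JacobiAt M ε (a + a') b c := fun m n => by
  simp only [map_add, LinearMap.add_apply, smul_add, Finset.sum_add_distrib]
  rw [h, h']
  abel

lemma JacobiAt.add_mid (h : JacobiAt M ε a b c) (h' : JacobiAt M ε a b' c) :
    JacobiAt M ε a (b + b') c := fun m n => by
  simp only [map_add, LinearMap.add_apply, smul_add, Finset.sum_add_distrib]
  rw [h, h']
  abel

lemma JacobiAt.add_right (h : JacobiAt M ε a b c) (h' : JacobiAt M ε a b c') :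
    JacobiAt M ε a b (c + c') := fun m n => by
  simp only [map_add, smul_add, Finset.sum_add_distrib]
  rw [h, h']
  abel

namespace IsSesquilinear

variable (hM : IsSesquilinear D M)
include hM

lemma skewSeq_add (a b a' b' : R) (n : ℕ) :
    skewSeq D (fun k => M k a b + M k a' b') n =
      skewSeq D (fun k => M k a b) n + skewSeq D (fun k => M k a' b') n := by
  obtain ⟨N, hN⟩ := hM.eventually_zero a b
  obtain ⟨N', hN'⟩ := hM.eventually_zero a' b'
  have h1 : ∀ n, max N N' ≤ n → M n a b = 0 := fun n hn => hN n ((le_max_left _ _).trans hn)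
  have h2 : ∀ n, max N N' ≤ n → M n a' b' = 0 := fun n hn => hN' n ((le_max_right _ _).trans hn)
  rw [skewSeq_eq h1, skewSeq_eq h2, skewSeq_eq (N := max N N')
    (fun n hn => by rw [h1 n hn, h2 n hn, add_zero]), ← Finset.sum_add_distrib]
  simp only [map_add, smul_add]

lemma skewAt_add_left (h : SkewAt D M ε a b) (h' : SkewAt D M ε a' b) :
    SkewAt D M ε (a + a') b := fun n => by
  simp only [map_add, LinearMap.add_apply]
  rw [hM.skewSeq_add, h, h', smul_add]

lemma skewAt_add_right (h : SkewAt D M ε a b) (h' : SkewAt D M ε a b') :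
    SkewAt D M ε a (b + b') := fun n => by
  simp only [map_add, LinearMap.add_apply]
  rw [hM.skewSeq_add, h, h', smul_add]

lemma skewAt_D_left (h : SkewAt D M ε a b) : SkewAt D M ε (D a) b := fun n => by
  obtain ⟨N, hN⟩ := hM.eventually_zero b a
  simp only [hM.left, hM.right]
  rw [skewSeq_right hN, h (n - 1), smul_comm]

lemma skewAt_D_right (h : SkewAt D M ε a b) : SkewAt D M ε a (D b) := fun n => by
  obtain ⟨N, hN⟩ := hM.eventually_zero b a
  simp only [hM.left, hM.right]
  rw [skewSeq_left hN, h n, h (n - 1), map_smul, smul_add, smul_comm (n : ℂ)]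

lemma jacobiAt_D_left (h : JacobiAt M ε a b c) : JacobiAt M ε (D a) b c := fun m n => by
  simp only [hM.left]
  cases m with
  | zero => simp
  | succ m =>
    rw [Nat.add_sub_cancel, h m n, Finset.sum_range_succ' _ (m + 1), smul_add, Finset.smul_sum]
    simp only [map_smul, LinearMap.smul_apply, Nat.cast_zero, neg_zero, zero_smul, map_zero,
      LinearMap.zero_apply, smul_zero, add_zero, Nat.add_sub_cancel]
    congr 1
    · refine Finset.sum_congr rfl fun k _ => ?_
      have hk : ((m + 1 : ℕ) : ℂ) * (m.choose k) =
          ((m + 1).choose (k + 1)) * ((k + 1 : ℕ) : ℂ) := by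
        exact_mod_cast Nat.add_one_mul_choose_eq m k
      rw [show n + (m + 1) - (k + 1) = n + m - k by omega, smul_smul, smul_smul, neg_mul, hk,
        mul_neg]
    · rw [smul_comm]

lemma jacobiAt_D_mid (h : JacobiAt M ε a b c) : JacobiAt M ε a (D b) c := fun m n => by
  have hsum : ∑ k ∈ Finset.range (m + 1), (m.choose k : ℂ) • M (n + m - k) (M k a (D b)) c =
      -(n : ℂ) • ∑ k ∈ Finset.range (m + 1), (m.choose k : ℂ) • M (n + m - k - 1) (M k a b) c := by
    have h2 : ∑ k ∈ Finset.range (m + 1),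
          (m.choose k : ℂ) • (k : ℂ) • M (n + m - k) (M (k - 1) a b) c
        = ∑ k ∈ Finset.range (m + 1),
          (m.choose k : ℂ) • ((m : ℂ) - k) • M (n + m - k - 1) (M k a b) c := by
      rw [Finset.sum_range_succ', Finset.sum_range_succ]
      simp only [Nat.cast_zero, zero_smul, smul_zero, add_zero, sub_self, Nat.add_sub_cancel]
      refine Finset.sum_congr rfl fun k hk => ?_
      have hk' : k ≤ m := (Finset.mem_range.1 hk).le
      have hc : (m.choose (k + 1) : ℂ) * ((k + 1 : ℕ) : ℂ) = m.choose k * ((m : ℂ) - k) := by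
        rw [← Nat.cast_sub hk']
        exact_mod_cast Nat.choose_succ_right_eq m k
      rw [smul_smul, smul_smul, hc, Nat.sub_sub]
    simp only [hM.right, map_add, LinearMap.add_apply, hM.left, map_smul, LinearMap.smul_apply,
      smul_add, Finset.sum_add_distrib]
    rw [h2, ← Finset.sum_add_distrib, Finset.smul_sum]
    refine Finset.sum_congr rfl fun k hk => ?_
    have hk' : k ≤ n + m := by have := Finset.mem_range.1 hk; omega
    rw [Nat.cast_sub hk']
    push_cast
    module
  rw [hsum, hM.left, hM.left, map_smul, h m (n - 1), smul_add, smul_comm ε]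
  cases n with
  | zero => simp
  | succ n =>
    congr 2
    refine Finset.sum_congr rfl fun k hk => ?_
    have := Finset.mem_range.1 hk
    rw [show n + 1 + m - k - 1 = n + 1 - 1 + m - k by omega]

lemma jacobiAt_D_right (h : JacobiAt M ε a b c) : JacobiAt M ε a b (D c) := fun m n => by
  have h1 : (n : ℂ) • ∑ k ∈ Finset.range (m + 1), (m.choose k : ℂ) • M (n - 1 + m - k) (M k a b) c =
      ∑ k ∈ Finset.range (m + 1), (m.choose k : ℂ) • (n : ℂ) • M (n + m - k - 1) (M k a b) c := by
    cases n with
    | zero => simp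
    | succ n =>
      rw [Finset.smul_sum]
      refine Finset.sum_congr rfl fun k hk => ?_
      have := Finset.mem_range.1 hk
      rw [show n + 1 + m - k - 1 = n + 1 - 1 + m - k by omega, smul_comm]
  have h2 : (m : ℂ) • ∑ k ∈ Finset.range (m - 1 + 1),
        ((m - 1).choose k : ℂ) • M (n + (m - 1) - k) (M k a b) c =
      ∑ k ∈ Finset.range (m + 1),
        (m.choose k : ℂ) • ((m : ℂ) - k) • M (n + m - k - 1) (M k a b) c := by
    cases m with
    | zero => simp
    | succ m =>
      rw [Finset.sum_range_succ _ (m + 1), Finset.smul_sum, sub_self, zero_smul, smul_zero,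
        add_zero, Nat.add_sub_cancel]
      refine Finset.sum_congr rfl fun k hk => ?_
      have hk' := Finset.mem_range.1 hk
      have hc : ((m + 1 : ℕ) : ℂ) * (m.choose k) = (m + 1).choose k * (((m + 1 : ℕ) : ℂ) - k) := by
        rw [← Nat.cast_sub (by omega)]
        rw [mul_comm]
        exact_mod_cast Nat.choose_mul_succ_eq m k
      rw [smul_smul, smul_smul, hc, show n + (m + 1) - k - 1 = n + m - k by omega]
  have h3 : ∑ k ∈ Finset.range (m + 1), (m.choose k : ℂ) • M (n + m - k) (M k a b) (D c) =
      D (∑ k ∈ Finset.range (m + 1), (m.choose k : ℂ) • M (n + m - k) (M k a b) c)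
      + ((n : ℂ) • ∑ k ∈ Finset.range (m + 1),
          (m.choose k : ℂ) • M (n - 1 + m - k) (M k a b) c
        + (m : ℂ) • ∑ k ∈ Finset.range (m - 1 + 1),
          ((m - 1).choose k : ℂ) • M (n + (m - 1) - k) (M k a b) c) := by
    rw [h1, h2, ← Finset.sum_add_distrib, map_sum, ← Finset.sum_add_distrib]
    refine Finset.sum_congr rfl fun k hk => ?_
    have hk' : k ≤ n + m := by have := Finset.mem_range.1 hk; omega
    rw [hM.right, Nat.cast_sub hk', map_smul]
    push_cast
    module
  rw [h3, hM.right, hM.right, map_add, map_add, hM.right, hM.right, map_smul, map_smul, h m n,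
    h m (n - 1), h (m - 1) n, map_add, map_smul]
  module

end IsSesquilinear

end Sesquilinear

/-! ### Products on the free `ℂ[∂]`-module -/

section Free

variable {P : Type*} [AddCommGroup P] [Module ℂ P]

/-- The operator `∂` on the free `ℂ[∂]`-module `ℂ[∂] ⊗ P`, realized as `ℕ →₀ P`. -/
noncomputable def shift (P : Type*) [AddCommGroup P] [Module ℂ P] : Module.End ℂ (ℕ →₀ P) :=
  Finsupp.lmapDomain P ℂ Nat.succ

/-- The inclusion of `P` into the free `ℂ[∂]`-module generated by it. -/
noncomputable def gen (P : Type*) [AddCommGroup P] [Module ℂ P] : P →ₗ[ℂ] ℕ →₀ P :=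
  Finsupp.lsingle 0

lemma shift_single (n : ℕ) (a : P) :
    shift P (Finsupp.single n a) = Finsupp.single (n + 1) a := by
  simp [shift, Finsupp.mapDomain_single]

lemma shift_pow_gen (n : ℕ) (a : P) : (shift P ^ n) (gen P a) = Finsupp.single n a := by
  induction n with
  | zero => rfl
  | succ n ih => rw [pow_succ', Module.End.mul_apply, ih, shift_single]

lemma gen_injective : Function.Injective (gen P) := Finsupp.single_injective 0

/-- The `ℂ[∂]`-submodule generated by a subspace `Q` of `P`: all coefficients lie in `Q`. -/
noncomputable def coeffs (Q : Submodule ℂ P) : Submodule ℂ (ℕ →₀ P) :=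
  ⨅ n, Q.comap (Finsupp.lapply n)

lemma mem_coeffs {Q : Submodule ℂ P} {x : ℕ →₀ P} : x ∈ coeffs Q ↔ ∀ n, x n ∈ Q := by
  simp [coeffs, Submodule.mem_iInf]

lemma single_mem_coeffs {Q : Submodule ℂ P} {a : P} (ha : a ∈ Q) (n : ℕ) :
    Finsupp.single n a ∈ coeffs Q := by
  rw [mem_coeffs]
  intro m
  rw [Finsupp.single_apply]
  split_ifs
  exacts [ha, zero_mem _]

lemma gen_mem_coeffs {Q : Submodule ℂ P} {a : P} : gen P a ∈ coeffs Q ↔ a ∈ Q :=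
  ⟨fun h => by simpa [gen] using mem_coeffs.1 h 0, fun h => single_mem_coeffs h 0⟩

@[elab_as_elim]
lemma coeffs_induction {Q : Submodule ℂ P} {motive : (ℕ →₀ P) → Prop} {x : ℕ →₀ P}
    (hx : x ∈ coeffs Q) (hgen : ∀ a ∈ Q, motive (gen P a))
    (hD : ∀ x, motive x → motive (shift P x))
    (hadd : ∀ x y, motive x → motive y → motive (x + y)) : motive x := by
  have hs : ∀ n, ∀ a ∈ Q, motive (Finsupp.single n a) := by
    intro n a ha
    induction n with
    | zero => exact hgen a ha
    | succ n ih => rw [← shift_single]; exact hD _ ih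
  rw [← Finsupp.sum_single x]
  refine Finset.sum_induction _ motive hadd ?_ fun n _ => hs n _ (mem_coeffs.1 hx n)
  simpa using hgen 0 (zero_mem _)

@[elab_as_elim]
lemma free_induction {motive : (ℕ →₀ P) → Prop} (x : ℕ →₀ P) (hgen : ∀ a, motive (gen P a))
    (hD : ∀ x, motive x → motive (shift P x))
    (hadd : ∀ x y, motive x → motive y → motive (x + y)) : motive x :=
  coeffs_induction (Q := ⊤) (motive := motive) (mem_coeffs.2 fun _ => Submodule.mem_top)
    (fun a _ => hgen a) hD hadd

lemma shift_mem_coeffs {Q : Submodule ℂ P} {x : ℕ →₀ P} (hx : x ∈ coeffs Q) :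
    shift P x ∈ coeffs Q := by
  rw [mem_coeffs] at *
  intro n
  cases n with
  | zero =>
    have : shift P x 0 = 0 := Finsupp.mapDomain_of_notMem_range x 0 (by simp)
    rw [this]
    exact zero_mem _
  | succ n =>
    have : shift P x (n + 1) = x n := Finsupp.mapDomain_apply Nat.succ_injective x n
    rw [this]
    exact hx n

lemma coeffs_isSuperGrading {par : ZMod 2 → Submodule ℂ P} (h : IsSuperGrading par) :
    IsSuperGrading fun i => coeffs (par i) := by
  have h01 : ∀ i : ZMod 2, i = 0 ∨ i = 1 := by decide
  constructor
  · rw [iSupIndep_pair (zero_ne_one (α := ZMod 2)) h01, Submodule.disjoint_def]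
    intro x h0 h1
    ext n
    exact h.eq_zero (mem_coeffs.1 h0 n) (mem_coeffs.1 h1 n)
  · rw [eq_top_iff]
    rintro x -
    induction x using Finsupp.induction_linear with
    | zero => exact zero_mem _
    | add x y hx hy => exact add_mem hx hy
    | single n a =>
      obtain ⟨y, hy, z, hz, rfl⟩ := h.exists_eq_add a
      rw [Finsupp.single_add]
      exact add_mem (Submodule.mem_iSup_of_mem 0 (single_mem_coeffs hy n))
        (Submodule.mem_iSup_of_mem 1 (single_mem_coeffs hz n))

/-- The effect on the sequence of products `a_(n) b` of replacing `a` by `∂a`. -/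
noncomputable def seqLeft (P : Type*) [AddCommGroup P] [Module ℂ P] :
    Module.End ℂ (ℕ → ℕ →₀ P) where
  toFun f n := -(n : ℂ) • f (n - 1)
  map_add' f g := by ext1 n; simp only [Pi.add_apply, smul_add]
  map_smul' c f := by ext1 n; simp [smul_comm c]

/-- The effect on the sequence of products `a_(n) b` of replacing `b` by `∂b`. -/
noncomputable def seqRight (P : Type*) [AddCommGroup P] [Module ℂ P] :
    Module.End ℂ (ℕ → ℕ →₀ P) where
  toFun f n := shift P (f n) + (n : ℂ) • f (n - 1)
  map_add' f g := by ext1 n; simp only [Pi.add_apply, map_add, smul_add]; abel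
  map_smul' c f := by
    ext1 n
    simp only [Pi.smul_apply, map_smul, smul_add, RingHom.id_apply, smul_comm c]

lemma seqLeft_apply (f : ℕ → ℕ →₀ P) (n : ℕ) : seqLeft P f n = -(n : ℂ) • f (n - 1) := rfl

lemma seqRight_apply (f : ℕ → ℕ →₀ P) (n : ℕ) :
    seqRight P f n = shift P (f n) + (n : ℂ) • f (n - 1) := rfl

lemma commute_seqRight_seqLeft : Commute (seqRight P) (seqLeft P) := by
  refine LinearMap.ext fun f => funext fun n => ?_
  simp only [Module.End.mul_apply, seqLeft_apply, seqRight_apply, map_smul, smul_add]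
  cases n with
  | zero => simp
  | succ n =>
    cases n with
    | zero => simp
    | succ n =>
      simp only [Nat.add_sub_cancel]
      push_cast
      module

/-- The sequence of products on the free `ℂ[∂]`-module which extends sesquilinearly given products
of the generators. -/
noncomputable def freeProdSeq (β : P →ₗ[ℂ] P →ₗ[ℂ] (ℕ → ℕ →₀ P)) :
    (ℕ →₀ P) →ₗ[ℂ] (ℕ →₀ P) →ₗ[ℂ] (ℕ → ℕ →₀ P) :=
  Finsupp.lsum ℂ fun i => LinearMap.flip <| Finsupp.lsum ℂ fun j =>
    LinearMap.flip <| β.compr₂ (seqLeft P ^ i * seqRight P ^ j)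

/-- The products on the free `ℂ[∂]`-module which extend sesquilinearly given products of the
generators. -/
noncomputable def freeProd (β : P →ₗ[ℂ] P →ₗ[ℂ] (ℕ → ℕ →₀ P)) (n : ℕ) :
    (ℕ →₀ P) →ₗ[ℂ] (ℕ →₀ P) →ₗ[ℂ] (ℕ →₀ P) :=
  (freeProdSeq β).compr₂ (LinearMap.proj n)

variable {β : P →ₗ[ℂ] P →ₗ[ℂ] (ℕ → ℕ →₀ P)}

lemma freeProdSeq_single (i j : ℕ) (a b : P) :
    freeProdSeq β (Finsupp.single i a) (Finsupp.single j b) =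
      (seqLeft P ^ i * seqRight P ^ j) (β a b) := by
  simp [freeProdSeq]

lemma freeProd_apply (n : ℕ) (x y : ℕ →₀ P) : freeProd β n x y = freeProdSeq β x y n := rfl

lemma freeProd_gen (n : ℕ) (a b : P) : freeProd β n (gen P a) (gen P b) = β a b n := by
  rw [freeProd_apply, gen, Finsupp.lsingle_apply, Finsupp.lsingle_apply, freeProdSeq_single]
  simp

lemma freeProdSeq_shift_left (x y : ℕ →₀ P) :
    freeProdSeq β (shift P x) y = seqLeft P (freeProdSeq β x y) := by
  induction x using Finsupp.induction_linear with
  | zero => simp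
  | add x x' hx hx' => simp only [map_add, LinearMap.add_apply, hx, hx']
  | single i a =>
    induction y using Finsupp.induction_linear with
    | zero => simp
    | add y y' hy hy' => simp only [map_add, hy, hy']
    | single j b =>
      rw [shift_single, freeProdSeq_single, freeProdSeq_single, pow_succ', mul_assoc,
        Module.End.mul_apply]

lemma freeProdSeq_shift_right (x y : ℕ →₀ P) :
    freeProdSeq β x (shift P y) = seqRight P (freeProdSeq β x y) := by
  induction x using Finsupp.induction_linear with
  | zero => simp
  | add x x' hx hx' => simp only [map_add, LinearMap.add_apply, hx, hx']
  | single i a =>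
    induction y using Finsupp.induction_linear with
    | zero => simp
    | add y y' hy hy' => simp only [map_add, hy, hy']
    | single j b =>
      rw [shift_single, freeProdSeq_single, freeProdSeq_single, pow_succ', ← Module.End.mul_apply,
        ← mul_assoc, ← mul_assoc, (commute_seqRight_seqLeft.pow_right i).eq]

lemma isSesquilinear_freeProd (hβ : ∀ a b, ∃ N, ∀ n, N ≤ n → β a b n = 0) :
    IsSesquilinear (shift P) (freeProd β) where
  left n a b := by simp only [freeProd_apply, freeProdSeq_shift_left, seqLeft_apply]
  right n a b := by simp only [freeProd_apply, freeProdSeq_shift_right, seqRight_apply]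
  eventually_zero x y := by
    induction x using free_induction with
    | hadd x x' hx hx' =>
      obtain ⟨N, hN⟩ := hx
      obtain ⟨N', hN'⟩ := hx'
      refine ⟨max N N', fun n hn => ?_⟩
      rw [map_add, LinearMap.add_apply, hN n ((le_max_left _ _).trans hn),
        hN' n ((le_max_right _ _).trans hn), add_zero]
    | hD x hx =>
      obtain ⟨N, hN⟩ := hx
      refine ⟨N + 1, fun n hn => ?_⟩
      rw [freeProd_apply, freeProdSeq_shift_left, seqLeft_apply, ← freeProd_apply,
        hN _ (by omega), smul_zero]
    | hgen a =>
      induction y using free_induction with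
      | hadd x x' hx hx' =>
        obtain ⟨N, hN⟩ := hx
        obtain ⟨N', hN'⟩ := hx'
        refine ⟨max N N', fun n hn => ?_⟩
        rw [map_add, hN n ((le_max_left _ _).trans hn),
          hN' n ((le_max_right _ _).trans hn), add_zero]
      | hD x hx =>
        obtain ⟨N, hN⟩ := hx
        refine ⟨N + 1, fun n hn => ?_⟩
        rw [freeProd_apply, freeProdSeq_shift_right, seqRight_apply, ← freeProd_apply,
          ← freeProd_apply, hN _ (by omega), hN _ (by omega), smul_zero, map_zero, add_zero]
      | hgen b =>
        obtain ⟨N, hN⟩ := hβ a b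
        exact ⟨N, fun n hn => by rw [freeProd_gen, hN n hn]⟩

end Free

/-! ### The `λ`-bracket of the generators -/

section Realization

variable {P : Type*} [AddCommGroup P] [Module ℂ P]
variable {par : ZMod 2 → Submodule ℂ P} {W : ℂ → Submodule ℂ P} {L : P}
  {circ bullet : P →ₗ[ℂ] P →ₗ[ℂ] P} {p q r : ℂ} {i j k : ZMod 2} {a b c : P}

/-- The operator which multiplies the vectors of weight `k` by `k`. -/
lemma exists_weight_operator (hi : iSupIndep W) (hs : ⨆ k, W k = ⊤) :
    ∃ w : Module.End ℂ P, ∀ k, ∀ a ∈ W k, w a = k • a := by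
  classical
  have hint : DirectSum.IsInternal W :=
    DirectSum.isInternal_submodule_of_iSupIndep_of_iSup_eq_top hi hs
  let e := LinearEquiv.ofBijective (DirectSum.coeLinearMap W) hint
  let t : (DirectSum ℂ fun k => W k) →ₗ[ℂ] P :=
    DirectSum.toModule ℂ ℂ P fun k => k • (W k).subtype
  refine ⟨t ∘ₗ e.symm.toLinearMap, fun k a ha => ?_⟩
  have h : e.symm a = DirectSum.lof ℂ ℂ (fun k => W k) k ⟨a, ha⟩ := by
    rw [LinearEquiv.symm_apply_eq]
    exact (DirectSum.coeLinearMap_lof W k ⟨a, ha⟩).symm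
  simp [h, t]

/-- The products of the generators: `[a_λ b] = a • b + ∂((w a - a) ∘ b) + λ (wa ∘ b + a ∘ wb -
2 a ∘ b)`, where `w` is the weight operator. -/
noncomputable def genProd (circ bullet : P →ₗ[ℂ] P →ₗ[ℂ] P) (w : Module.End ℂ P) :
    P →ₗ[ℂ] P →ₗ[ℂ] (ℕ → ℕ →₀ P) :=
  (bullet.compr₂ (gen P) + (circ ∘ₗ (w - LinearMap.id)).compr₂ (shift P ∘ₗ gen P)).compr₂
      (LinearMap.single ℂ (fun _ : ℕ => ℕ →₀ P) 0)
    + ((circ ∘ₗ w + circ.compl₂ w - (2 : ℂ) • circ).compr₂ (gen P)).compr₂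
      (LinearMap.single ℂ (fun _ : ℕ => ℕ →₀ P) 1)

lemma genProd_zero (w : Module.End ℂ P) (a b : P) : genProd circ bullet w a b 0 =
    gen P (bullet a b) + shift P (gen P (circ (w a - a) b)) := by
  simp [genProd]

lemma genProd_one (w : Module.End ℂ P) (a b : P) : genProd circ bullet w a b 1 =
    gen P (circ (w a) b + circ a (w b) - (2 : ℂ) • circ a b) := by
  simp [genProd]

lemma genProd_of_two_le (w : Module.End ℂ P) (a b : P) {n : ℕ} (hn : 2 ≤ n) :
    genProd circ bullet w a b n = 0 := by
  have h0 : n ≠ 0 := by omega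
  have h1 : n ≠ 1 := by omega
  simp [genProd, h0, h1]

section Products

variable {w : Module.End ℂ P} (hw : ∀ k, ∀ a ∈ W k, w a = k • a)

lemma isSesquilinear_genProd (w : Module.End ℂ P) :
    IsSesquilinear (shift P) (freeProd (genProd circ bullet w)) :=
  isSesquilinear_freeProd fun a b => ⟨2, fun _ hn => genProd_of_two_le w a b hn⟩

lemma prod_gen_of_two_le {n : ℕ} (hn : 2 ≤ n) (a b : P) :
    freeProd (genProd circ bullet w) n (gen P a) (gen P b) = 0 := by
  rw [freeProd_gen, genProd_of_two_le w a b hn]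

lemma prod_prod_gen_right {m n : ℕ} (h : 3 ≤ m + n) (a b c : P) :
    freeProd (genProd circ bullet w) m (gen P a)
      (freeProd (genProd circ bullet w) n (gen P b) (gen P c)) = 0 := by
  rcases n with _ | _ | n
  · rw [freeProd_gen, genProd_zero, map_add, (isSesquilinear_genProd w).right,
      prod_gen_of_two_le (by omega), prod_gen_of_two_le (by omega),
      prod_gen_of_two_le (by omega)]
    simp
  · rw [freeProd_gen, zero_add, genProd_one, prod_gen_of_two_le (by omega)]
  · rw [prod_gen_of_two_le (by omega), map_zero]

lemma prod_prod_gen_left {m n : ℕ} (h : 3 ≤ m + n) (a b c : P) :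
    freeProd (genProd circ bullet w) m (freeProd (genProd circ bullet w) n (gen P a) (gen P b))
      (gen P c) = 0 := by
  rcases n with _ | _ | n
  · rw [freeProd_gen, genProd_zero, map_add, LinearMap.add_apply, (isSesquilinear_genProd w).left,
      prod_gen_of_two_le (by omega), prod_gen_of_two_le (by omega)]
    simp
  · rw [freeProd_gen, zero_add, genProd_one, prod_gen_of_two_le (by omega)]
  · rw [prod_gen_of_two_le (by omega), map_zero, LinearMap.zero_apply]

include hw

lemma prod_zero_gen (ha : a ∈ W p) : freeProd (genProd circ bullet w) 0 (gen P a) (gen P b) =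
    gen P (bullet a b) + (p - 1) • shift P (gen P (circ a b)) := by
  rw [freeProd_gen, genProd_zero, hw p a ha,
    show p • a - a = (p - 1) • a by module]
  simp only [map_smul, LinearMap.smul_apply]

lemma prod_one_gen (ha : a ∈ W p) (hb : b ∈ W q) :
    freeProd (genProd circ bullet w) 1 (gen P a) (gen P b) =
      (p + q - 2) • gen P (circ a b) := by
  rw [freeProd_gen, genProd_one, hw p a ha, hw q b hb]
  simp only [map_smul, LinearMap.smul_apply, map_add, map_sub]
  module

/-- Skew-symmetry for generators. -/
lemma skewAt_gen (hH : IsHAlgebra par W L circ bullet) (hai : a ∈ par i) (hbj : b ∈ par j)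
    (ha : a ∈ W p) (hb : b ∈ W q) :
    SkewAt (shift P) (freeProd (genProd circ bullet w)) (superSign i j) (gen P a) (gen P b) := by
  intro n
  rw [skewSeq_eq (N := 2) fun n hn => prod_gen_of_two_le hn b a]
  simp only [Finset.sum_range_succ, Finset.sum_range_zero, divPow]
  rcases n with _ | _ | n
  · simp only [zero_add, prod_zero_gen hw ha, prod_zero_gen hw hb, prod_one_gen hw hb ha]
    rw [hH.h1.skew i j a b hai hbj, hH.h2.comm i j a b hai hbj]
    simp
    module
  · simp only [zero_add, prod_one_gen hw hb ha, prod_one_gen hw ha hb,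
      Nat.reduceAdd, prod_gen_of_two_le (le_refl 2)]
    rw [hH.h2.comm i j a b hai hbj]
    simp
    module
  · rw [prod_gen_of_two_le (by omega), prod_gen_of_two_le (by omega),
      prod_gen_of_two_le (by omega)]
    simp

/-- The Jacobi identity for generators. -/
lemma jacobiAt_gen (hG : IsPhysicalGrading par W L)
    (hW : HasProductWeights W circ bullet) (hH : IsHAlgebra par W L circ bullet)
    (hai : a ∈ par i) (hbj : b ∈ par j) (hck : c ∈ par k)
    (ha : a ∈ W p) (hb : b ∈ W q) (hc : c ∈ W r) :
    JacobiAt (freeProd (genProd circ bullet w)) (superSign i j) (gen P a) (gen P b)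
      (gen P c) := by
  have hM := isSesquilinear_genProd (circ := circ) (bullet := bullet) w
  obtain ⟨hd, hl, hm⟩ := hH.linearJacobi hG hW hai hbj hck ha hb hc
  have hj := hH.h1.jacobi i j a b c hai hbj
  have ht := hH.h2.assoc a b c
  have ht' : circ b (circ a c) = superSign i j • circ a (circ b c) := by
    rw [← hH.h2.assoc, ← hH.h2.assoc, hH.h2.comm j i b a hbj hai, superSign_comm, map_smul,
      LinearMap.smul_apply]
  have wab := hW.bullet _ _ _ _ ha hb
  have wbc := hW.bullet _ _ _ _ hb hc
  have wac := hW.bullet _ _ _ _ ha hc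
  have vab := hW.circ _ _ _ _ ha hb
  have vbc := hW.circ _ _ _ _ hb hc
  have vac := hW.circ _ _ _ _ ha hc
  have hε := superSign_eq_one_or i j
  generalize superSign i j = ε at *
  have hd' := congrArg (gen P) hd
  have hl' := congrArg (gen P) hl
  have hm' := congrArg (gen P) hm
  have hj' := congrArg (gen P) hj
  simp only [map_add, map_sub, map_smul] at hd' hl' hm' hj'
  have hd'' := congrArg (shift P) hd'
  simp only [map_add, map_smul] at hd''
  intro m n
  by_cases hmn : 3 ≤ m + n
  · rw [prod_prod_gen_right hmn, prod_prod_gen_right (by omega), Finset.sum_eq_zero]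
    · simp
    · intro k hk
      have := Finset.mem_range.1 hk
      rw [prod_prod_gen_left (by omega), smul_zero]
  have hcases : (m = 0 ∧ n = 0) ∨ (m = 1 ∧ n = 0) ∨ (m = 0 ∧ n = 1) ∨ (m = 2 ∧ n = 0) ∨
      (m = 1 ∧ n = 1) ∨ (m = 0 ∧ n = 2) := by omega
  have za := fun x => prod_zero_gen (circ := circ) (bullet := bullet) hw ha (b := x)
  have zb := fun x => prod_zero_gen (circ := circ) (bullet := bullet) hw hb (b := x)
  have zab := fun x => prod_zero_gen (circ := circ) (bullet := bullet) hw wab (b := x)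
  have zab' := fun x => prod_zero_gen (circ := circ) (bullet := bullet) hw vab (b := x)
  have t2 := fun x y => prod_gen_of_two_le (w := w) (circ := circ) (bullet := bullet)
    (le_refl 2) x y
  rcases hcases with ⟨rfl, rfl⟩ | ⟨rfl, rfl⟩ | ⟨rfl, rfl⟩ | ⟨rfl, rfl⟩ | ⟨rfl, rfl⟩ | ⟨rfl, rfl⟩ <;>
    simp only [Finset.sum_range_succ, Finset.sum_range_zero, Nat.reduceAdd, Nat.reduceSub,
      za, zb, zab, zab', t2, hM.left, hM.right, map_add, map_smul, LinearMap.add_apply,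
      LinearMap.smul_apply, map_zero, LinearMap.zero_apply,
      prod_one_gen hw ha hb, prod_one_gen hw ha hc, prod_one_gen hw hb hc,
      prod_one_gen hw ha wbc, prod_one_gen hw ha vbc, prod_one_gen hw hb wac,
      prod_one_gen hw hb vac, prod_one_gen hw wab hc, prod_one_gen hw vab hc, ht, ht',
      Nat.choose_self, Nat.choose_zero_right, Nat.choose_one_right]
  · rcases hε with rfl | rfl <;>
    (linear_combination (norm := skip) hj' + hd''; push_cast; module)
  · rcases hε with rfl | rfl <;>
    (linear_combination (norm := skip) hl'; push_cast; module)
  · rcases hε with rfl | rfl <;>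
    (linear_combination (norm := skip) hm'; push_cast; module)
  · rcases hε with rfl | rfl <;> (push_cast; module)
  · rcases hε with rfl | rfl <;> (push_cast; module)
  · rcases hε with rfl | rfl <;> (push_cast; module)

end Products

end Realization

/-! ### The conformal superalgebra of an algebra with (H0)-(H6) -/

section Realization

variable {P : Type*} [AddCommGroup P] [Module ℂ P]
variable {par : ZMod 2 → Submodule ℂ P} {W : ℂ → Submodule ℂ P} {L : P}
  {circ bullet : P →ₗ[ℂ] P →ₗ[ℂ] P} {p q r : ℂ} {i j k : ZMod 2} {a b c : P}

lemma IsPhysicalGrading.par_induction (hG : IsPhysicalGrading par W L) {motive : P → Prop}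
    (ha : a ∈ par i) (hom : ∀ k, ∀ a ∈ W k, a ∈ par i → motive a)
    (add : ∀ a b, motive a → motive b → motive (a + b)) : motive a := by
  have h01 : ∀ i : ZMod 2, i = 0 ∨ i = 1 := by decide
  rcases h01 i with rfl | rfl
  · rw [hG.even] at ha
    obtain ⟨y, hy, z, hz, rfl⟩ := Submodule.mem_sup.1 ha
    exact add _ _ (hom _ _ hy (hG.two_le hy)) (hom _ _ hz (hG.one_le hz))
  · rw [hG.odd] at ha
    obtain ⟨y, hy, z, hz, rfl⟩ := Submodule.mem_sup.1 ha
    exact add _ _ (hom _ _ hy (hG.three_half_le hy)) (hom _ _ hz (hG.half_le hz))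

@[elab_as_elim]
lemma IsPhysicalGrading.induction (hG : IsPhysicalGrading par W L) {motive : P → Prop} (a : P)
    (hom : ∀ k i, ∀ a ∈ W k, a ∈ par i → motive a)
    (add : ∀ a b, motive a → motive b → motive (a + b)) : motive a := by
  obtain ⟨y, hy, z, hz, rfl⟩ := hG.super.exists_eq_add a
  exact add _ _ (hG.par_induction (motive := motive) hy (fun k => hom k 0) add)
    (hG.par_induction (motive := motive) hz (fun k => hom k 1) add)

section Extension

variable {w : Module.End ℂ P} (hw : ∀ k, ∀ a ∈ W k, w a = k • a)
  (hG : IsPhysicalGrading par W L) (hW : HasProductWeights W circ bullet)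
  (hH : IsHAlgebra par W L circ bullet)

include hw hG hH

lemma freeProd_mem_coeffs (n : ℕ) {x y : ℕ →₀ P} (hx : x ∈ coeffs (par i))
    (hy : y ∈ coeffs (par j)) :
    freeProd (genProd circ bullet w) n x y ∈ coeffs (par (i + j)) := by
  have hM := isSesquilinear_genProd (circ := circ) (bullet := bullet) w
  revert n
  refine coeffs_induction hx (fun a ha => ?_)
    (fun x hx n => by rw [hM.left]; exact Submodule.smul_mem _ _ (hx _))
    (fun x x' hx hx' n => by rw [map_add, LinearMap.add_apply]; exact add_mem (hx n) (hx' n))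
  refine coeffs_induction hy (fun b hb n => ?_)
    (fun x hx n => by
      rw [hM.right]
      exact add_mem (shift_mem_coeffs (hx _)) (Submodule.smul_mem _ _ (hx _)))
    (fun x x' hx hx' n => by rw [map_add]; exact add_mem (hx n) (hx' n))
  refine hG.par_induction
    (motive := fun a => freeProd (genProd circ bullet w) n (gen P a) (gen P b) ∈ _) ha
    (fun p a ha hai => ?_)
    (fun a a' ha ha' => by rw [map_add, map_add, LinearMap.add_apply]; exact add_mem ha ha')
  refine hG.par_induction
    (motive := fun b => freeProd (genProd circ bullet w) n (gen P a) (gen P b) ∈ _) hb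
    (fun q b hb hbj => ?_)
    (fun a a' ha ha' => by rw [map_add, map_add]; exact add_mem ha ha')
  rcases n with _ | _ | n
  · rw [prod_zero_gen hw ha]
    exact add_mem (gen_mem_coeffs.2 (hH.h1.grading i j a b hai hbj))
      (Submodule.smul_mem _ _ (shift_mem_coeffs (gen_mem_coeffs.2 (hH.h2.grading i j a b hai hbj))))
  · rw [zero_add, prod_one_gen hw ha hb]
    exact Submodule.smul_mem _ _ (gen_mem_coeffs.2 (hH.h2.grading i j a b hai hbj))
  · rw [prod_gen_of_two_le (by omega)]
    exact zero_mem _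

lemma skewAt_freeProd {x y : ℕ →₀ P} (hx : x ∈ coeffs (par i)) (hy : y ∈ coeffs (par j)) :
    SkewAt (shift P) (freeProd (genProd circ bullet w)) (superSign i j) x y := by
  have hM := isSesquilinear_genProd (circ := circ) (bullet := bullet) w
  refine coeffs_induction hx (fun a ha => ?_) (fun x hx => hM.skewAt_D_left hx)
    (fun x x' hx hx' => hM.skewAt_add_left hx hx')
  refine coeffs_induction hy (fun b hb => ?_) (fun x hx => hM.skewAt_D_right hx)
    (fun x x' hx hx' => hM.skewAt_add_right hx hx')
  refine hG.par_induction (motive := fun a => SkewAt _ _ _ (gen P a) (gen P b)) ha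
    (fun p a ha hai => ?_)
    (fun a a' ha ha' => by rw [map_add]; exact hM.skewAt_add_left ha ha')
  refine hG.par_induction (motive := fun b => SkewAt _ _ _ (gen P a) (gen P b)) hb
    (fun q b hb hbj => ?_)
    (fun a a' ha ha' => by rw [map_add]; exact hM.skewAt_add_right ha ha')
  exact skewAt_gen hw hH hai hbj ha hb

lemma prod_zero_L (x : ℕ →₀ P) :
    freeProd (genProd circ bullet w) 0 (gen P L) x = shift P x := by
  have hM := isSesquilinear_genProd (circ := circ) (bullet := bullet) w
  induction x using free_induction with
  | hD x hx => rw [hM.right, hx]; simp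
  | hadd x x' hx hx' => rw [map_add, hx, hx', map_add]
  | hgen a =>
    rw [prod_zero_gen hw hG.L_mem, hH.h0.1, hH.h0.2]
    simp only [LinearMap.zero_apply, map_zero, LinearMap.id_apply]
    module

lemma prod_one_L_gen (ha : a ∈ W p) :
    freeProd (genProd circ bullet w) 1 (gen P L) (gen P a) = p • gen P a := by
  rw [prod_one_gen hw hG.L_mem ha, hH.h0.1, LinearMap.id_apply, add_sub_cancel_left]

lemma prod_one_L_shift (x : ℕ →₀ P) :
    freeProd (genProd circ bullet w) 1 (gen P L) (shift P x) =
      shift P (freeProd (genProd circ bullet w) 1 (gen P L) x) + shift P x := by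
  have hM := isSesquilinear_genProd (circ := circ) (bullet := bullet) w
  rw [hM.right, Nat.sub_self, prod_zero_L hw hG hH, Nat.cast_one, one_smul]

/-- A vector whose coefficients have weight `p` is a sum of vectors of weights in `p + ℕ`. -/
lemma coeffs_le_iSup_eigenspace (p : ℂ) :
    coeffs (W p) ≤ ⨆ n : ℕ,
      Module.End.eigenspace (freeProd (genProd circ bullet w) 1 (gen P L)) (p + n) := by
  intro x hx
  refine coeffs_induction hx (fun a ha => ?_) (fun x hx => ?_) (fun x y hx hy => add_mem hx hy)
  · refine Submodule.mem_iSup_of_mem 0 (Module.End.mem_eigenspace_iff.2 ?_)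
    rw [prod_one_L_gen hw hG hH ha, Nat.cast_zero, add_zero]
  · induction hx using Submodule.iSup_induction' with
    | mem n y hy =>
      refine Submodule.mem_iSup_of_mem (n + 1) (Module.End.mem_eigenspace_iff.2 ?_)
      rw [prod_one_L_shift hw hG hH, Module.End.mem_eigenspace_iff.1 hy, map_smul]
      push_cast
      module
    | zero => rw [map_zero]; exact zero_mem _
    | add y z _ _ hy hz => rw [map_add]; exact add_mem hy hz

include hW in
lemma jacobiAt_freeProd {x y z : ℕ →₀ P} (hx : x ∈ coeffs (par i)) (hy : y ∈ coeffs (par j)) :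
    JacobiAt (freeProd (genProd circ bullet w)) (superSign i j) x y z := by
  have hM := isSesquilinear_genProd (circ := circ) (bullet := bullet) w
  refine free_induction z (fun c => ?_) (fun x hx => hM.jacobiAt_D_right hx)
    (fun x x' hx hx' => hx.add_right hx')
  refine coeffs_induction hx (fun a ha => ?_) (fun x hx => hM.jacobiAt_D_left hx)
    (fun x x' hx hx' => hx.add_left hx')
  refine coeffs_induction hy (fun b hb => ?_) (fun x hx => hM.jacobiAt_D_mid hx)
    (fun x x' hx hx' => hx.add_mid hx')
  refine hG.induction c (fun r k c hc hck => ?_)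
    (fun a a' ha ha' => by rw [map_add]; exact ha.add_right ha')
  refine hG.par_induction (motive := fun a => JacobiAt _ _ (gen P a) (gen P b) _) ha
    (fun p a ha hai => ?_)
    (fun a a' ha ha' => by rw [map_add]; exact ha.add_left ha')
  refine hG.par_induction (motive := fun b => JacobiAt _ _ (gen P a) (gen P b) _) hb
    (fun q b hb hbj => ?_)
    (fun a a' ha ha' => by rw [map_add]; exact ha.add_mid ha')
  exact jacobiAt_gen hw hG hW hH hai hbj hck ha hb hc

end Extension

/-- The conformal superalgebra generated by an algebra with (H0)-(H6), on the free `ℂ[∂]`-module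
`ℕ →₀ P`. -/
noncomputable def realization {w : Module.End ℂ P} (hw : ∀ k, ∀ a ∈ W k, w a = k • a)
    (hG : IsPhysicalGrading par W L) (hW : HasProductWeights W circ bullet)
    (hH : IsHAlgebra par W L circ bullet) : ConformalSuperalgebra (ℕ →₀ P) where
  par i := coeffs (par i)
  par_grading := coeffs_isSuperGrading hG.super
  prod := freeProd (genProd circ bullet w)
  prod_par n i j x y hx hy := freeProd_mem_coeffs hw hG hH n hx hy
  D := shift P
  D_par i x hx := shift_mem_coeffs hx
  L := gen P L
  L_even := gen_mem_coeffs.2 (hG.two_le hG.L_mem)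
  c0 := (isSesquilinear_genProd w).eventually_zero
  c1 := (isSesquilinear_genProd w).left
  c2 n i j x y hx hy := skewAt_freeProd hw hG hH hx hy n
  c3 m n i j x y z hx hy := jacobiAt_freeProd hw hG hW hH hx hy m n
  L_one := prod_one_L_gen hw hG hH hG.L_mem
  L_two := prod_gen_of_two_le le_rfl L L
  L_zero := prod_zero_L hw hG hH
  L_diag := by
    rw [eq_top_iff]
    rintro x -
    induction x using Finsupp.induction_linear with
    | zero => exact zero_mem _
    | add x y hx hy => exact add_mem hx hy
    | single n a =>
      refine hG.induction a (fun p i a ha _ => ?_)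
        (fun a b ha hb => by rw [Finsupp.single_add]; exact add_mem ha hb)
      exact (iSup_le fun n : ℕ => le_iSup (Module.End.eigenspace _) (p + (n : ℂ)))
        (coeffs_le_iSup_eigenspace hw hG hH p (single_mem_coeffs ha n))

section Physical

variable {w : Module.End ℂ P} (hw : ∀ k, ∀ a ∈ W k, w a = k • a)
  (hG : IsPhysicalGrading par W L) (hW : HasProductWeights W circ bullet)
  (hH : IsHAlgebra par W L circ bullet)

lemma gen_mem_wt (ha : a ∈ W p) : gen P a ∈ (realization hw hG hW hH).wt p :=
  (realization hw hG hW hH).mem_wt.2 (prod_one_L_gen hw hG hH ha)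

/-- The weight spaces of `P` are as large as those of the realization allow, because they span
`P`. -/
lemma gen_mem_wt_iff : gen P a ∈ (realization hw hG hW hH).wt p ↔ a ∈ W p := by
  refine ⟨fun h => ?_, gen_mem_wt hw hG hW hH⟩
  have hE := iSupIndep_comap (realization hw hG hW hH).iSupIndep_wt gen_injective
  have hle : ∀ k, W k ≤ ((realization hw hG hW hH).wt k).comap (gen P) :=
    fun k a ha => gen_mem_wt hw hG hW hH ha
  have htop : a ∈ W p ⊔ ⨆ (k : ℂ) (_ : k ≠ p), W k := by
    have : ⨆ k, W k ≤ W p ⊔ ⨆ (k : ℂ) (_ : k ≠ p), W k := iSup_le fun k => by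
      by_cases hk : k = p
      · exact hk ▸ le_sup_left
      · exact le_sup_of_le_right (le_iSup₂_of_le k hk le_rfl)
    exact this (hG.span ▸ Submodule.mem_top)
  obtain ⟨b, hb, c, hc, rfl⟩ := Submodule.mem_sup.1 htop
  have hcp := Submodule.sub_mem _ (Submodule.mem_comap.2 h) (hle p hb)
  rw [add_sub_cancel_left] at hcp
  rw [Submodule.disjoint_def.1 (hE p) c hcp (iSup₂_mono (fun k _ => hle k) hc), add_zero]
  exact hb

lemma coeffs_le_iSup_wt (p : ℂ) :
    coeffs (W p) ≤ ⨆ n : ℕ, (realization hw hG hW hH).wt (p + n) :=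
  coeffs_le_iSup_eigenspace hw hG hH p

lemma coeffs_sup_le {Q Q' : Submodule ℂ P} : coeffs (Q ⊔ Q') ≤ coeffs Q ⊔ coeffs Q' := by
  intro x hx
  refine coeffs_induction hx (fun a ha => ?_) (fun x hx => ?_) (fun x y hx hy => add_mem hx hy)
  · obtain ⟨b, hb, c, hc, rfl⟩ := Submodule.mem_sup.1 ha
    rw [map_add]
    exact Submodule.add_mem_sup (gen_mem_coeffs.2 hb) (gen_mem_coeffs.2 hc)
  · obtain ⟨b, hb, c, hc, rfl⟩ := Submodule.mem_sup.1 hx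
    rw [map_add]
    exact Submodule.add_mem_sup (shift_mem_coeffs hb) (shift_mem_coeffs hc)

lemma coeffs_even_le :
    coeffs (par 0) ≤ ⨆ n : ℕ, (realization hw hG hW hH).wt (n : ℂ) := by
  rw [hG.even]
  refine coeffs_sup_le.trans (sup_le ?_ ?_)
  · refine (coeffs_le_iSup_wt hw hG hW hH 2).trans (iSup_le fun n => ?_)
    refine le_iSup_of_le (2 + n) (le_of_eq ?_)
    push_cast; rfl
  · refine (coeffs_le_iSup_wt hw hG hW hH 1).trans (iSup_le fun n => ?_)
    refine le_iSup_of_le (1 + n) (le_of_eq ?_)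
    push_cast; rfl

lemma coeffs_odd_le :
    coeffs (par 1) ≤ ⨆ n : ℕ, (realization hw hG hW hH).wt ((n : ℂ) + 1 / 2) := by
  rw [hG.odd]
  refine coeffs_sup_le.trans (sup_le ?_ ?_)
  · refine (coeffs_le_iSup_wt hw hG hW hH (3 / 2)).trans (iSup_le fun n => ?_)
    refine le_iSup_of_le (1 + n) (le_of_eq ?_)
    push_cast; congr 1; ring
  · refine (coeffs_le_iSup_wt hw hG hW hH (1 / 2)).trans (iSup_le fun n => ?_)
    refine le_iSup_of_le n (le_of_eq ?_)
    congr 1; ring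

lemma nat_ne_nat_add_half (m n : ℕ) : (n : ℂ) + 1 / 2 ≠ m := by
  intro h
  have h2 : ((2 * n + 1 : ℕ) : ℂ) = ((2 * m : ℕ) : ℂ) := by
    push_cast; linear_combination 2 * h
  have := Nat.cast_injective h2
  omega

/-- If the vectors of parity `i` are sums of vectors of weights `κ n`, a vector of any other weight
has the other parity `j`. -/
lemma mem_coeffs_of_mem_wt {S : ConformalSuperalgebra (ℕ →₀ P)} {κ : ℕ → ℂ} {l : ℂ}
    {i j : ZMod 2} (hij : ∀ x, ∃ y ∈ S.par i, ∃ z ∈ S.par j, x = y + z)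
    (hdisj : ∀ x, x ∈ S.par i → x ∈ S.par j → x = 0)
    (hi : S.par i ≤ ⨆ n, S.wt (κ n)) (hl : ∀ n, κ n ≠ l) : S.wt l ≤ S.par j := by
  intro x hx
  obtain ⟨y, hy, z, hz, rfl⟩ := hij x
  have hH : ∀ (j : ZMod 2) (y), y ∈ S.par j → S.prod 1 S.L y - l • y ∈ S.par j := fun j y hy => by
    have := S.prod_par 1 0 j S.L y S.L_even hy
    rw [zero_add] at this
    exact sub_mem this (Submodule.smul_mem _ _ hy)
  have hsum : (S.prod 1 S.L y - l • y) + (S.prod 1 S.L z - l • z) = 0 := by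
    have := S.mem_wt.1 hx
    rw [map_add, smul_add] at this
    linear_combination (norm := module) this
  have hy0 : S.prod 1 S.L y - l • y = 0 := by
    refine hdisj _ (hH i y hy) ?_
    rw [eq_neg_of_add_eq_zero_left hsum]
    exact neg_mem (hH j z hz)
  have hyl : y ∈ S.wt l := S.mem_wt.2 (sub_eq_zero.1 hy0)
  have hle : (⨆ n, S.wt (κ n)) ≤ ⨆ (k : ℂ) (_ : k ≠ l), S.wt k :=
    iSup_le fun n => le_iSup₂_of_le (κ n) (hl n) le_rfl
  rw [Submodule.disjoint_def.1 (S.iSupIndep_wt l) y hyl (hle (hi hy)), zero_add]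
  exact hz

lemma realization_isPhysical [FiniteDimensional ℂ P] :
    (realization hw hG hW hH).IsPhysical := by
  have hsplit : ∀ x : ℕ →₀ P, ∃ y ∈ (realization hw hG hW hH).par 0,
      ∃ z ∈ (realization hw hG hW hH).par 1, x = y + z :=
    fun x => (realization hw hG hW hH).par_grading.exists_eq_add x
  have hsplit' : ∀ x : ℕ →₀ P, ∃ y ∈ (realization hw hG hW hH).par 1,
      ∃ z ∈ (realization hw hG hW hH).par 0, x = y + z := fun x => by
    obtain ⟨y, hy, z, hz, h⟩ := hsplit x
    exact ⟨z, hz, y, hy, h.trans (add_comm y z)⟩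
  have hdisj : ∀ x : ℕ →₀ P, x ∈ (realization hw hG hW hH).par 0 →
      x ∈ (realization hw hG hW hH).par 1 → x = 0 :=
    fun x => (realization hw hG hW hH).par_grading.eq_zero
  refine ⟨LinearMap.range (gen P), ⟨inferInstance, ?_, ?_, ?_, ?_, ?_⟩, ?_, ?_⟩
  · refine le_antisymm (iSup_le fun i => inf_le_left) ?_
    rintro _ ⟨a, rfl⟩
    obtain ⟨y, hy, z, hz, rfl⟩ := hG.super.exists_eq_add a
    rw [map_add]
    exact add_mem (Submodule.mem_iSup_of_mem 0 ⟨⟨y, rfl⟩, gen_mem_coeffs.2 hy⟩)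
      (Submodule.mem_iSup_of_mem 1 ⟨⟨z, rfl⟩, gen_mem_coeffs.2 hz⟩)
  · rw [eq_top_iff]
    rintro x -
    induction x using Finsupp.induction_linear with
    | zero => exact zero_mem _
    | add x y hx hy => exact add_mem hx hy
    | single n a =>
      exact Submodule.mem_iSup_of_mem n ⟨gen P a, ⟨a, rfl⟩, shift_pow_gen n a⟩
  · intro k hk
    by_contra hk'
    refine hk ((Submodule.eq_bot_iff _).2 fun x hx => ?_)
    refine hdisj x ?_ ?_
    · refine mem_coeffs_of_mem_wt hsplit' (fun x h1 h0 => hdisj x h0 h1)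
        (coeffs_odd_le hw hG hW hH) (fun n hn => hk' ⟨2 * n + 1, ?_⟩) hx
      rw [← hn]; push_cast; ring
    · refine mem_coeffs_of_mem_wt hsplit hdisj
        (coeffs_even_le hw hG hW hH) (fun n hn => hk' ⟨2 * n, ?_⟩) hx
      rw [← hn]; push_cast; ring
  · refine le_antisymm (coeffs_even_le hw hG hW hH) (iSup_le fun n => ?_)
    exact mem_coeffs_of_mem_wt hsplit' (fun x h1 h0 => hdisj x h0 h1)
      (coeffs_odd_le hw hG hW hH) (fun m => nat_ne_nat_add_half n m)
  · refine le_antisymm (coeffs_odd_le hw hG hW hH) (iSup_le fun n => ?_)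
    exact mem_coeffs_of_mem_wt hsplit hdisj
      (coeffs_even_le hw hG hW hH) (fun m => (nat_ne_nat_add_half m n).symm)
  · rintro _ ⟨a, rfl⟩
    refine hG.induction a (fun p i a ha hai => ?_)
      (fun a b ha hb => by rw [map_add]; exact add_mem ha hb)
    by_cases ha0 : a = 0
    · rw [ha0, map_zero]; exact zero_mem _
    have hg := gen_mem_wt hw hG hW hH ha
    rcases hG.isPhysWeight ha ha0 with rfl | rfl | rfl | rfl
    · exact Submodule.mem_sup_left (Submodule.mem_sup_left (Submodule.mem_sup_left hg))
    · exact Submodule.mem_sup_left (Submodule.mem_sup_left (Submodule.mem_sup_right hg))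
    · exact Submodule.mem_sup_left (Submodule.mem_sup_right hg)
    · exact Submodule.mem_sup_right hg
  · rw [show (realization hw hG hW hH).L = gen P L from rfl, ← Set.image_singleton,
      ← Submodule.map_span, ← hG.two]
    refine le_antisymm ?_ ?_
    · rintro _ ⟨⟨a, rfl⟩, ha⟩
      exact ⟨a, (gen_mem_wt_iff hw hG hW hH).1 ha, rfl⟩
    · rintro _ ⟨a, ha, rfl⟩
      exact ⟨⟨a, rfl⟩, gen_mem_wt hw hG hW hH ha⟩

end Physical

end Realization

/-! ### The reduced subspace of the realization -/

section Realization

variable {P : Type*} [AddCommGroup P] [Module ℂ P] [FiniteDimensional ℂ P]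
variable {par : ZMod 2 → Submodule ℂ P} {W : ℂ → Submodule ℂ P} {L : P}
  {circ bullet : P →ₗ[ℂ] P →ₗ[ℂ] P} {w : Module.End ℂ P} (hw : ∀ k, ∀ a ∈ W k, w a = k • a)
  (hG : IsPhysicalGrading par W L) (hW : HasProductWeights W circ bullet)
  (hH : IsHAlgebra par W L circ bullet)

/-- The reduced vectors of the realization are the generators: these are killed by `L_(2)`, and
together with the image of `∂` they span. -/
lemma reduced_realization : (realization hw hG hW hH).reduced = LinearMap.range (gen P) := by
  refine (realization_isPhysical hw hG hW hH).reduced_eq ?_ ?_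
  · rintro _ ⟨a, rfl⟩
    exact (realization_isPhysical hw hG hW hH).mem_reduced.2 (prod_gen_of_two_le le_rfl L a)
  · rw [eq_top_iff]
    rintro x -
    refine free_induction x (fun a => Submodule.mem_sup_left ⟨a, rfl⟩)
      (fun x _ => Submodule.mem_sup_right ⟨x, rfl⟩) (fun x y hx hy => add_mem hx hy)

/-- The generators of the realization are its reduced vectors. -/
noncomputable def realizationEquiv : P ≃ₗ[ℂ] (realization hw hG hW hH).reduced :=
  LinearEquiv.ofInjective (gen P) gen_injective ≪≫ₗ
    LinearEquiv.ofEq _ _ (reduced_realization hw hG hW hH).symm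

lemma realizationEquiv_apply (a : P) :
    (realizationEquiv hw hG hW hH a : ℕ →₀ P) = gen P a := rfl

lemma realizationEquiv_isRealization : IsRealization par W L circ bullet
    (realization hw hG hW hH) (realizationEquiv hw hG hW hH) := by
  have hS := realization_isPhysical hw hG hW hH
  have hmap : ∀ {Q : Submodule ℂ P} {Q' : Submodule ℂ (ℕ →₀ P)}, (∀ a, gen P a ∈ Q' ↔ a ∈ Q) →
      Q.map (realizationEquiv hw hG hW hH : P →ₗ[ℂ] (realization hw hG hW hH).reduced) =
        Q'.comap (realization hw hG hW hH).reduced.subtype := by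
    intro Q Q' h
    ext x
    obtain ⟨a, rfl⟩ := (realizationEquiv hw hG hW hH).surjective x
    rw [Submodule.mem_map_equiv, LinearEquiv.symm_apply_apply]
    exact (h a).symm
  have hmem : ∀ a, gen P a ∈ (realization hw hG hW hH).reduced :=
    fun a => (realizationEquiv hw hG hW hH a).2
  refine ⟨rfl, fun i => hmap fun a => gen_mem_coeffs, fun k => hmap fun a =>
    gen_mem_wt_iff hw hG hW hH, fun a b => ?_, fun p q a b ha hb => ?_, fun n a b hn => ?_⟩
  · have : (realization hw hG hW hH).prod 0 (gen P a) (gen P b) =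
        gen P (bullet a b) + (realization hw hG hW hH).D (gen P (circ (w a - a) b)) :=
      (freeProd_gen 0 a b).trans (genProd_zero w a b)
    rw [realizationEquiv_apply, realizationEquiv_apply, realizationEquiv_apply, this]
    exact hS.isZeroPart_add_D (hmem _) (hmem _)
  · have : (realization hw hG hW hH).prod 1 (gen P a) (gen P b) =
        gen P ((p + q - 2) • circ a b) := (prod_one_gen hw ha hb).trans (map_smul _ _ _).symm
    rw [realizationEquiv_apply, realizationEquiv_apply, realizationEquiv_apply, this]
    exact hS.isZeroPart_self (hmem _)
  · have : (realization hw hG hW hH).prod n (gen P a) (gen P b) = 0 := prod_gen_of_two_le hn a b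
    rw [realizationEquiv_apply, realizationEquiv_apply, this]
    exact hS.isZeroPart_self (zero_mem _)

end Realization

end PhysConf

theorem mainTheorem6 :
    (∀ (R : Type v) [AddCommGroup R] [Module ℂ R] (S : ConformalSuperalgebra R),
      S.IsPhysical →
        ∃ (hL : S.L ∈ S.reduced) (circ bullet : S.reduced →ₗ[ℂ] S.reduced →ₗ[ℂ] S.reduced),
          S.IsReducedProducts circ bullet ∧
          (∀ circ' bullet', S.IsReducedProducts circ' bullet' →
            circ' = circ ∧ bullet' = bullet) ∧
          IsPhysicalGrading S.redPar S.redWt ⟨S.L, hL⟩ ∧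
          HasProductWeights S.redWt circ bullet ∧
          IsHAlgebra S.redPar S.redWt ⟨S.L, hL⟩ circ bullet) ∧
    (∀ (P : Type u) [AddCommGroup P] [Module ℂ P] [FiniteDimensional ℂ P]
      (par : ZMod 2 → Submodule ℂ P) (W : ℂ → Submodule ℂ P) (L : P)
      (circ bullet : P →ₗ[ℂ] P →ₗ[ℂ] P),
      IsPhysicalGrading par W L → HasProductWeights W circ bullet →
      IsHAlgebra par W L circ bullet →
        ∃ (R : Type u) (_ : AddCommGroup R) (_ : Module ℂ R) (S : ConformalSuperalgebra R)
          (e : P ≃ₗ[ℂ] S.reduced),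
          S.IsPhysical ∧ IsRealization par W L circ bullet S e) := by
  refine ⟨fun R _ _ S h => ⟨h.L_mem_reduced, h.circ, h.bullet, h.isReducedProducts,
    fun _ _ => h.reducedProducts_unique, h.isPhysicalGrading, h.hasProductWeights, h.isHAlgebra⟩,
    fun P _ _ _ par W L circ bullet hG hW hH => ?_⟩
  obtain ⟨w, hw⟩ := exists_weight_operator hG.indep hG.span
  exact ⟨ℕ →₀ P, inferInstance, inferInstance, realization hw hG hW hH,
    realizationEquiv hw hG hW hH, realization_isPhysical hw hG hW hH,
    realizationEquiv_isRealization hw hG hW hH⟩
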